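/- **Conventions.** $\mathfrak A$ is a C\*-algebra, $\mathfrak{sa}(\mathfrak A)$ its self-adjoint part, $\mathscr S(\mathfrak A)$ its state space, $\mathfrak u\mathfrak A$ is $\mathfrak A$ if it is unital and $\mathfrak A\oplus\mathbb C1$ otherwise. A seminorm defined on a dense subspace is extended by $\infty$ off its domain. A *Lipschitz pair* $(\mathfrak A,L)$ is a seminorm $L$ defined on a dense subspace of $\mathfrak{sa}(\mathfrak u\mathfrak A)$ with $\{L=0\}=\mathbb R1$. Put $\mathsf{mk}_L(\varphi,\psi)=\sup\{|\varphi(a)-\psi(a)|:a\in\mathfrak{sa}(\mathfrak A),L(a)\le1\}$. A *topography* $\mathfrak M$ on $\mathfrak A$ is an Abelian C\*-subalgebra which contains an approximate unit of $\mathfrak A$; $\mathfrak M^\sigma$ is its spectrum. For compact $K\subseteq\mathfrak M^\sigma$, the indicator function $1_K$ is viewed as a projection in $\mathfrak M^{**}\subseteq\mathfrak A^{**}$, and states are extended to $\mathfrak A^{**}$; put $\mathscr S[\mathfrak A|K]=\{\varphi\in\mathscr S(\mathfrak A):\varphi(1_K)=1\}$, $\mathfrak L(\mathfrak A|\mathfrak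 M,K)=\{a\in\mathfrak{sa}(\mathfrak A):1_Ka1_K=a,\ L(a)<\infty\}$, and $\mathfrak L(\mathfrak A|\mathfrak M,\star)=\bigcup_K\mathfrak L(\mathfrak A|\mathfrak M,K)$ (the Lipschitz locally supported elements). A set $S\subseteq\mathscr S(\mathfrak A)$ is *tame* if $\lim_K\sup\{|\varphi(a-1_Ka1_K)|:\varphi\in S,a\in\mathfrak{sa}(\mathfrak A),L(a)\le1\}=0$ along the compact $K\subseteq\mathfrak M^\sigma$ ordered by inclusion. $(\mathfrak A,L,\mathfrak M)$ is a *quantum locally compact metric space* (QLCMS) if $(\mathfrak A,L)$ is a Lipschitz pair, $\mathfrak M$ is a topography on $\mathfrak A$, and $\mathsf{mk}_L$ metrizes the weak\* topology on every tame set. It is *standard* if $\{m\in\mathfrak{sa}(\mathfrak M):L(m)<\infty\}$ is dense in $\mathfrak{sa}(\mathfrak M)$. Write $\mathsf{mk}^\sigma_L(x,y)=\sup\{|x(m)-y(m)|:m\in\mathfrak{sa}(\mathfrak M),L(m)\le1\}$. A *proper quantum metric space* is a QLCMS $(\mathfrak A,L,\mathfrak M)$ with $\mathfrak A$ separable; $L$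 norm lower semicontinuous on $\mathfrak{sa}(\mathfrak A)$; $L(\tfrac{ab+ba}2)$ and $L(\tfrac{ab-ba}{2i})$ at most $\|a\|L(b)+L(a)\|b\|$ for all $a,b\in\mathfrak{sa}(\mathfrak A)$; $\mathfrak L(\mathfrak A|\mathfrak M,\star)$ norm dense in $\{a\in\mathfrak{sa}(\mathfrak A):L(a)<\infty\}$; $\mathfrak L(\mathfrak A|\mathfrak M,\star)\cap\mathfrak M$ dense in $\mathfrak{sa}(\mathfrak M)$; and $(\mathfrak M^\sigma,\mathsf{mk}^\sigma_L)$ a proper metric space (closed balls are compact). It is *pointed* when a base point $\mu\in\mathfrak M^\sigma$ is chosen; then $B_r$ is the closed $\mathsf{mk}^\sigma_L$-ball of radius $r$ about $\mu$, and $\mathfrak L(\mathfrak A|\mu,r)=\mathfrak L(\mathfrak A|\mathfrak M,B_r)$, $\mathscr S[\mathfrak A|\mu,r]=\mathscr S[\mathfrak A|B_r]$. $(\mathfrak A,L,\mathfrak M)$ is a *strongly proper quantum metric space* if $L$ is a seminorm on a dense subspace of $\mathfrak A$, $\mathfrak A$ is separable, $L$ is lower semicontinuous, $(\mathfrak A,L|_{\mathfrak{sa}(\mathfrak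 A)},\mathfrak M)$ is a standard QLCMS, $L(ab)\le\|a\|L(b)+\|b\|L(a)$ for all $a,b\in\mathfrak A$, and there is an approximate unit $(e_n)_{n\in\mathbb N}$ of $\mathfrak A$ in $\mathfrak{sa}(\mathfrak M)$ with $\|e_n\|\le1$, $e_n\in\mathfrak L(\mathfrak A|\mathfrak M,\star)$ and $L(e_n)\to0$. The seminorm is identified with its restriction to $\mathfrak{sa}(\mathfrak A)$ when appropriate. A *topographic morphism* is a surjective \*-morphism which maps topography into topography and some approximate unit contained in the topography to an approximate unit. An *isometric isomorphism* from $\mathbb A=(\mathfrak A,L_{\mathfrak A},\mathfrak M_{\mathfrak A},\mu_{\mathfrak A})$ to $\mathbb B=(\mathfrak B,L_{\mathfrak B},\mathfrak M_{\mathfrak B},\mu_{\mathfrak B})$ (pointed proper quantum metric spaces) is a topographic morphism $\pi$ which is a \*-isomorphism, maps $\mathfrak L(\mathfrak A|\mathfrak M_{\mathfrak A},\star)$ onto $\mathfrak L(\mathfrak B|\mathfrak M_{\mathfrak B},\star)$ and $\mathfrak M_{\mathfrak A}$ onto $\mathfrak M_{\mathfrak B}$, and satisfies $L_{\mathfrak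 B}\circ\pi=L_{\mathfrak A}$ on $\mathfrak L(\mathfrak A|\mathfrak M_{\mathfrak A},\star)$ and $\mu_{\mathfrak B}\circ\pi=\mu_{\mathfrak A}$. A *passage* $\tau=(\mathfrak D,L_{\mathfrak D},\mathfrak M_{\mathfrak D},\pi,\mathbb A,\rho,\mathbb B)$ from its domain $\mathbb A$ to its codomain $\mathbb B$ is a QLCMS $(\mathfrak D,L_{\mathfrak D},\mathfrak M_{\mathfrak D})$ with $L_{\mathfrak D}$ lower semicontinuous and topographic morphisms $\pi:\mathfrak D\to\mathfrak A$, $\rho:\mathfrak D\to\mathfrak B$; $\tau^{-1}$ exchanges $(\pi,\mathbb A)$ and $(\rho,\mathbb B)$. For $r,\varepsilon>0$ and $K\subseteq\mathfrak M_{\mathfrak D}^\sigma$ compact, the *target set* $\mathfrak t(a)$ of $a\in\mathfrak L(\mathfrak A|\mu_{\mathfrak A},r)$ is the set of the $\rho(d)$ with $d\in\mathfrak L(\mathfrak D|\mathfrak M_{\mathfrak D},K)$, $\pi(d)=a$, $\rho(d)\in\mathfrak L(\mathfrak B|\mu_{\mathfrak B},r+4\varepsilon)$ and $L_{\mathfrak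 D}(d)\le L_{\mathfrak A}(a)$. The pair $(\varepsilon,K)$ is *$r$-left admissible* if $\pi^*(\mathscr S[\mathfrak A|\mu_{\mathfrak A},r])\subseteq\mathscr S[\mathfrak D|K]$; every $\varphi\in\mathscr S[\mathfrak D|K]$ is within $\mathsf{mk}_{L_{\mathfrak D}}$-distance $\varepsilon$ of some element of $\pi^*(\mathscr S[\mathfrak A|\mu_{\mathfrak A},r+4\varepsilon])$; $\mathfrak t(a)\ne\emptyset$ for all $a\in\mathfrak L(\mathfrak A|\mu_{\mathfrak A},r)$; $\mathfrak t(a)\cap\mathfrak M_{\mathfrak B}\neq\emptyset$ for all $a\in\mathfrak L(\mathfrak A|\mu_{\mathfrak A},r)\cap\mathfrak M_{\mathfrak A}$; and $L_{\mathfrak B}(\rho(d))\le L_{\mathfrak D}(d)$ for all $d\in\mathfrak L(\mathfrak D|\mathfrak M_{\mathfrak D},K)$. It is *$r$-admissible* if it is $r$-left admissible for $\tau$ and for $\tau^{-1}$, $\mathsf{mk}^\sigma_{L_{\mathfrak D}}(\mu_{\mathfrak A}\circ\pi,\mu_{\mathfrak B}\circ\rho)\le\varepsilon$, and the two Leibniz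 inequalities above hold for $L_{\mathfrak D}$ on $\mathfrak L(\mathfrak D|\mathfrak M_{\mathfrak D},K)$. A number $\varepsilon>0$ is *$r$-admissible* if there are compact sets $(K_t)_{0<t\le r}$, increasing in $t$, such that $(\varepsilon,K_t)$ is $t$-admissible for all $t\in(0,r]$. The passage $\tau$ is an *$r$-tunnel* from $\mathbb A$ to $\mathbb B$ if an $r$-admissible number exists; its *$r$-extent* $\chi(\tau|r)$ is the infimum of the $r$-admissible numbers. Let $\mathcal C$ be a nonempty class of pointed proper quantum metric spaces. A class $\mathcal T$ of passages is *weakly appropriate* for $\mathcal C$ if (1) every $\tau\in\mathcal T$ is, for some $r>0$, an $r$-tunnel between elements of $\mathcal C$; (2) $\tau\in\mathcal T$ implies $\tau^{-1}\in\mathcal T$; (3) if $\tau_1,\tau_2\in\mathcal T$ are $r$-tunnels, the codomain of $\tau_1$ is the domain of $\tau_2$, $\varepsilon_j>\chi(\tau_j|r)$ for $j=1,2$, $0<t\le r-4\max\{\varepsilon_1,\varepsilon_2\}$ and $\alpha>0$, then there is a $t$-tunnel $\tau\in\mathcal T$ from the domain of $\tau_1$ to the codomain of $\tau_2$ with $\chi(\tau|t)\le\varepsilon_1+\varepsilon_2+\alpha$;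 (4) for each isometric isomorphism $h:\mathbb A\to\mathbb B$ with $\mathbb A,\mathbb B\in\mathcal C$, the passages $(\mathfrak A,L_{\mathfrak A},\mathfrak M_{\mathfrak A},\mathrm{id},\mathbb A,h,\mathbb B)$ and $(\mathfrak B,L_{\mathfrak B},\mathfrak M_{\mathfrak B},\mathrm{id},\mathbb B,h^{-1},\mathbb A)$ lie in $\mathcal T$. Then $\Lambda_{r,\mathcal T}(\mathbb A,\mathbb B)$ is the infimum of the $\chi(\tau|r)$ over all $r$-tunnels $\tau\in\mathcal T$ from $\mathbb A$ to $\mathbb B$ ($\infty$ if there are none), and the *topographic Gromov–Hausdorff $\mathcal T$-propinquity* is $$\Lambda_{\mathcal T}(\mathbb A,\mathbb B)=\min\Bigl\{\inf\{\varepsilon>0:\Lambda_{1/\varepsilon,\mathcal T}(\mathbb A,\mathbb B)<\varepsilon\},\ \tfrac{\sqrt2}4\Bigr\}.$$ **Statement.** (I) Let $(\mathfrak A,L,\mathfrak M)$ be a strongly proper quantum metric space. Then $(\mathfrak A,L,\mathfrak M)$ is a proper quantum metric space, and if $\mathfrak A\ne0$ it can be pointed, i.e. $\mathfrak M^\sigma\neq\emptyset$.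 Moreover, for every $a\in\mathfrak{sa}(\mathfrak A)$ with $L(a)<\infty$ there is a sequence $(a_n)_{n\in\mathbb N}$ in $\mathfrak L(\mathfrak A|\mathfrak M,\star)$ which converges to $a$ in norm and satisfies $\lim_nL(a_n)=L(a)$; if $a\in\mathfrak M$, then the $a_n$ can be chosen in $\mathfrak M$. (II) Let $\mathcal C$ be a nonempty class of pointed proper quantum metric spaces, and let $\mathcal T$ be weakly appropriate for $\mathcal C$. Let $\mathbb A=(\mathfrak A,L_{\mathfrak A},\mathfrak M_{\mathfrak A},\mu_{\mathfrak A})$ and $\mathbb B=(\mathfrak B,L_{\mathfrak B},\mathfrak M_{\mathfrak B},\mu_{\mathfrak B})$ in $\mathcal C$ be strongly proper. If $\Lambda_{\mathcal T}(\mathbb A,\mathbb B)=0$, then there is a (pointed) isometric isomorphism $\pi:\mathbb A\to\mathbb B$ such that $L_{\mathfrak B}(\pi(a))=L_{\mathfrak A}(a)$ for all $a\in\mathfrak{sa}(\mathfrak A)$ and $L_{\mathfrak A}(\pi^{-1}(b))=L_{\mathfrak B}(b)$ for all $b\in\mathfrak{sa}(\mathfrak B)$. -/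

import Mathlib

open Filter Topology
open scoped ENNReal ComplexOrder CStarAlgebra

universe u

noncomputable section

namespace TopographicPropinquity

/-! ### The bidual of a C*-algebra and the indicator projections of a topography -/

section Bidual

variable {X Y Z : Type*} [NormedAddCommGroup X] [NormedSpace ℂ X]
  [NormedAddCommGroup Y] [NormedSpace ℂ Y] [NormedAddCommGroup Z] [NormedSpace ℂ Z]

/-- The Banach space bidual. -/
abbrev Bidual (X : Type*) [NormedAddCommGroup X] [NormedSpace ℂ X] : Type _ :=
  StrongDual ℂ (StrongDual ℂ X)

/-- The canonical embedding of a space in its bidual. -/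
def toBidual : X →L[ℂ] Bidual X := NormedSpace.inclusionInDoubleDual ℂ X

/-- The transpose of a bounded bilinear map `m`, that is
`⟨arensTranspose m φ x, y⟩ = φ (m x y)`. -/
def arensTranspose (m : X →L[ℂ] Y →L[ℂ] Z) :
    StrongDual ℂ Z →L[ℂ] X →L[ℂ] StrongDual ℂ Y :=
  ((ContinuousLinearMap.compL ℂ X (Y →L[ℂ] Z) (Y →L[ℂ] ℂ)).flip m).comp
    (ContinuousLinearMap.compL ℂ Y Z ℂ)

theorem arensTranspose_apply (m : X →L[ℂ] Y →L[ℂ] Z) (φ : StrongDual ℂ Z) (x : X) (y : Y) :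
    arensTranspose m φ x y = φ (m x y) := rfl

/-- The (first) Arens product on the bidual which extends a bounded bilinear product `m`: the third
transpose of `m`. -/
def arensMul (m : X →L[ℂ] X →L[ℂ] X) (F G : Bidual X) : Bidual X :=
  arensTranspose (arensTranspose (arensTranspose m)) F G

end Bidual

section Topography

variable {A : Type*} [NonUnitalCStarAlgebra A]

/-- The product of the bidual `A**` of a C*-algebra, which is thereby identified with the enveloping
von Neumann algebra of `A`. -/
def bidualMul (F G : Bidual A) : Bidual A := arensMul (ContinuousLinearMap.mul ℂ A) F G

/-- The Gelfand spectrum of (the commutative C*-algebra) `M`, with its weak* topology. -/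
abbrev Spec (M : NonUnitalStarSubalgebra ℂ A) : Type _ := WeakDual.characterSpace ℂ M

/-- The elements `f` of `M` which, as functions on the spectrum, satisfy `0 ≤ f ≤ 1`, and `f = 1`
on `K`. -/
def dominating (M : NonUnitalStarSubalgebra ℂ A) (K : Set (Spec M)) : Set M :=
  {f | (∀ x : Spec M, 0 ≤ x f ∧ x f ≤ 1) ∧ ∀ x ∈ K, x f = 1}

/-- The set `dominating M K` is directed downwards for the pointwise order (it is closed under
products); this is the filter of its final sections, along which `f` decreases to the indicator
function of `K` when `K` is compact. -/
def decreasingTo (M : NonUnitalStarSubalgebra ℂ A) (K : Set (Spec M)) : Filter M :=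
  ⨅ g ∈ dominating M K, 𝓟 {f | f ∈ dominating M K ∧ ∀ x : Spec M, x f ≤ x g}

/-- The indicator function `1_K` of a compact subset `K` of the spectrum of `M`, as a projection in
`M** ⊆ A**`: the weak* limit of the net of all `f ∈ M` with `0 ≤ f ≤ 1` and `f = 1` on `K`. -/
def indicator (M : NonUnitalStarSubalgebra ℂ A) (K : Set (Spec M)) : Bidual A :=
  WeakDual.toStrongDual
    (@limUnder (WeakDual ℂ (StrongDual ℂ A)) _ M ⟨0⟩ (decreasingTo M K)
      (fun f => StrongDual.toWeakDual (toBidual (f : A))))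

/-- The corner `1_K a 1_K` of `a ∈ A`, computed in `A**`. -/
def corner (M : NonUnitalStarSubalgebra ℂ A) (K : Set (Spec M)) (a : A) : Bidual A :=
  bidualMul (bidualMul (indicator M K) (toBidual a)) (indicator M K)

/-- `M` is a topography on `A`: an Abelian C*-subalgebra of `A` which contains an approximate unit
of `A`. -/
structure IsTopography (M : NonUnitalStarSubalgebra ℂ A) : Prop where
  isClosed : IsClosed (M : Set A)
  comm : ∀ a ∈ M, ∀ b ∈ M, a * b = b * a
  exists_approximateUnit : ∃ l : Filter A, l.IsApproximateUnit ∧ (M : Set A) ∈ l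

/-! ### States -/

variable (A) in
/-- The state space: positive linear functionals of norm one. -/
def stateSpace : Set (WeakDual ℂ A) :=
  {φ | (∀ a : A, 0 ≤ φ (star a * a)) ∧ ‖WeakDual.toStrongDual φ‖ = 1}

/-- The value on `F ∈ A**` of the normal extension to `A**` of a functional `φ` on `A`. -/
def extend (φ : WeakDual ℂ A) (F : Bidual A) : ℂ := F (WeakDual.toStrongDual φ)

/-- `𝒮[A|K]`: the states `φ` of `A` with `φ (1_K) = 1`. -/
def statesOn (M : NonUnitalStarSubalgebra ℂ A) (K : Set (Spec M)) : Set (WeakDual ℂ A) :=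
  {φ | φ ∈ stateSpace A ∧ extend φ (indicator M K) = 1}

/-! ### Lipschitz seminorms -/

/-- A Lipschitz pair `(A, L)`. A densely defined seminorm is encoded as a function with values in
`[0, ∞]`, infinite off its domain. A seminorm on a dense subspace of the self-adjoint part of
the unitization `A ⊕ ℂ1` of a nonunital `A` whose kernel is `ℝ1` is determined by its
restriction to `A`, since `L (a + t1) = L a`, and `L` here is that restriction. Elements of `A`
which lie in `ℝ1` are those which act on `A` by a real scalar: the real multiples of the unit if
`A` is unital, and only `0` if it is not. -/
structure IsLipschitzPair (L : A → ℝ≥0∞) : Prop where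
  eq_top : ∀ a, ¬ IsSelfAdjoint a → L a = ∞
  add_le : ∀ a b, L (a + b) ≤ L a + L b
  smul : ∀ (t : ℝ) (a : A), L ((t : ℂ) • a) = ENNReal.ofReal |t| * L a
  dense : ∀ a : A, IsSelfAdjoint a → a ∈ closure {b | L b < ∞}
  eq_zero_iff : ∀ a, L a = 0 ↔ ∃ t : ℝ, ∀ b : A, a * b = (t : ℂ) • b ∧ b * a = (t : ℂ) • b

/-- The Monge-Kantorovich extended metric associated with a seminorm `L` on the self-adjoint part
of `X`. -/
def mongeKantorovich {X : Type*} (L : X → ℝ≥0∞) (φ ψ : X → ℂ) : ℝ≥0∞ :=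
  ⨆ a : X, ⨆ _ : L a ≤ 1, ‖φ a - ψ a‖ₑ

/-- The Monge-Kantorovich extended metric of the restriction of `L` to `M`. -/
def sigmaKantorovich (L : A → ℝ≥0∞) (M : NonUnitalStarSubalgebra ℂ A) (x y : M → ℂ) : ℝ≥0∞ :=
  mongeKantorovich (fun m : M => L m) x y

/-- Tame sets of states: the limit of
`sup {|φ (a - 1_K a 1_K)| : φ ∈ S, a self-adjoint, L a ≤ 1}` over the compact subsets `K` of the
spectrum of `M`, ordered by inclusion, is zero. -/
def IsTame (L : A → ℝ≥0∞) (M : NonUnitalStarSubalgebra ℂ A) (S : Set (WeakDual ℂ A)) : Prop :=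
  Tendsto (fun K : TopologicalSpace.Compacts (Spec M) =>
    ⨆ φ ∈ S, ⨆ a : A, ⨆ _ : L a ≤ 1,
      ‖extend φ (toBidual a - corner M (K : Set (Spec M)) a)‖ₑ) atTop (𝓝 0)

/-- The restriction of the Monge-Kantorovich extended metric to `S` metrizes the weak* topology
restricted to `S`. -/
def Metrizes (L : A → ℝ≥0∞) (S : Set (WeakDual ℂ A)) : Prop :=
  ∃ m : EMetricSpace S,
    (∀ φ ψ : S, m.edist φ ψ = mongeKantorovich L (φ : WeakDual ℂ A) (ψ : WeakDual ℂ A)) ∧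
    m.toUniformSpace.toTopologicalSpace = instTopologicalSpaceSubtype

/-- Quantum locally compact metric spaces `(A, L, M)`. -/
structure IsQLCMS (L : A → ℝ≥0∞) (M : NonUnitalStarSubalgebra ℂ A) : Prop where
  lipschitzPair : IsLipschitzPair L
  topography : IsTopography M
  metrizes : ∀ S ⊆ stateSpace A, IsTame L M S → Metrizes L S

/-- `𝔏(A|M, K)`: the self-adjoint `a` with `1_K a 1_K = a` and `L a < ∞`. -/
def Loc (L : A → ℝ≥0∞) (M : NonUnitalStarSubalgebra ℂ A) (K : Set (Spec M)) : Set A :=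
  {a | IsSelfAdjoint a ∧ corner M K a = toBidual a ∧ L a < ∞}

/-- The Lipschitz locally supported elements. -/
def LocStar (L : A → ℝ≥0∞) (M : NonUnitalStarSubalgebra ℂ A) : Set A :=
  ⋃ K : TopologicalSpace.Compacts (Spec M), Loc L M (K : Set (Spec M))

/-- A quantum locally compact metric space is standard when the domain of `L` meets the
self-adjoint part of `M` in a dense set. -/
def IsStandard (L : A → ℝ≥0∞) (M : NonUnitalStarSubalgebra ℂ A) : Prop :=
  ∀ m ∈ M, IsSelfAdjoint m → m ∈ closure {b | b ∈ M ∧ L b < ∞}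

/-- The Leibniz inequalities on `S`, for the Jordan product `(ab + ba)/2` and the Lie product
`(ab - ba)/(2i)`. -/
def LeibnizOn (L : A → ℝ≥0∞) (S : Set A) : Prop :=
  ∀ a ∈ S, ∀ b ∈ S,
    L ((1 / 2 : ℂ) • (a * b + b * a)) ≤ ‖a‖ₑ * L b + L a * ‖b‖ₑ ∧
    L ((1 / (2 * Complex.I) : ℂ) • (a * b - b * a)) ≤ ‖a‖ₑ * L b + L a * ‖b‖ₑ

/-- The spectrum of `M`, with the Monge-Kantorovich metric of the restriction of `L` to `M`, is a
proper metric space: a metric space (with the topology of the metric) whose closed balls are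
compact. -/
def HasProperSpectrum (L : A → ℝ≥0∞) (M : NonUnitalStarSubalgebra ℂ A) : Prop :=
  ∃ m : MetricSpace (Spec M),
    (∀ x y : Spec M, m.edist x y = sigmaKantorovich L M x y) ∧
    @ProperSpace (Spec M) m.toPseudoMetricSpace

/-- Proper quantum metric spaces `(A, L, M)`. -/
structure IsProperQMS (L : A → ℝ≥0∞) (M : NonUnitalStarSubalgebra ℂ A) : Prop where
  isQLCMS : IsQLCMS L M
  separable : TopologicalSpace.SeparableSpace A
  leibniz : LeibnizOn L {a | IsSelfAdjoint a}
  lowerSemicontinuous : LowerSemicontinuous L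
  locStar_dense : {a | L a < ∞} ⊆ closure (LocStar L M)
  locStar_inter_dense : ∀ m ∈ M, IsSelfAdjoint m → m ∈ closure (LocStar L M ∩ (M : Set A))
  properSpectrum : HasProperSpectrum L M

open Classical in
/-- The restriction to the self-adjoint part of `A` of a densely defined seminorm on `A`. -/
def saRestrict (L : A → ℝ≥0∞) (a : A) : ℝ≥0∞ := if IsSelfAdjoint a then L a else ∞

/-- Strongly proper quantum metric spaces `(A, L, M)`. Here `L` is defined on a dense subspace of
the whole of `A`, and is infinite off this subspace. -/
structure IsStronglyProper (L : A → ℝ≥0∞) (M : NonUnitalStarSubalgebra ℂ A) : Prop where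
  add_le : ∀ a b, L (a + b) ≤ L a + L b
  smul : ∀ (c : ℂ) (a : A), L (c • a) = ‖c‖ₑ * L a
  dense : Dense {a | L a < ∞}
  separable : TopologicalSpace.SeparableSpace A
  lowerSemicontinuous : LowerSemicontinuous L
  isQLCMS : IsQLCMS (saRestrict L) M
  isStandard : IsStandard (saRestrict L) M
  leibniz : ∀ a b, L (a * b) ≤ ‖a‖ₑ * L b + ‖b‖ₑ * L a
  exists_approximateUnit : ∃ e : ℕ → A, (atTop.map e).IsApproximateUnit ∧
    (∀ n, e n ∈ M ∧ IsSelfAdjoint (e n) ∧ ‖e n‖ ≤ 1 ∧ e n ∈ LocStar (saRestrict L) M) ∧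
    Tendsto (fun n => L (e n)) atTop (𝓝 0)

/-- Topographic morphisms: *-epimorphisms mapping the topography `N` into the topography `M`, and
some approximate unit in `N` to an approximate unit. -/
structure IsTopographicMorphism {D : Type*} [NonUnitalCStarAlgebra D] (π : D →⋆ₙₐ[ℂ] A)
    (N : NonUnitalStarSubalgebra ℂ D) (M : NonUnitalStarSubalgebra ℂ A) : Prop where
  surjective : Function.Surjective π
  map_mem : ∀ d ∈ N, π d ∈ M
  map_approximateUnit : ∃ l : Filter D, l.IsApproximateUnit ∧ (N : Set D) ∈ l ∧
    (l.map π).IsApproximateUnit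

/-- The dual map `φ ↦ φ ∘ π`. -/
def pullback {D : Type*} [NonUnitalCStarAlgebra D] (π : D →⋆ₙₐ[ℂ] A) (φ : WeakDual ℂ A) :
    WeakDual ℂ D :=
  StrongDual.toWeakDual
    { toFun := fun d => φ (π d)
      map_add' := fun x y => by simp
      map_smul' := fun c x => by simp
      cont := φ.continuous.comp (map_continuous π) }

end Topography

/-! ### Pointed proper quantum metric spaces -/

/-- Pointed proper quantum metric spaces `(A, L, M, μ)`. -/
structure PPQMS : Type (u + 1) where
  carrier : Type u
  [cstar : NonUnitalCStarAlgebra carrier]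
  L : carrier → ℝ≥0∞
  M : NonUnitalStarSubalgebra ℂ carrier
  base : Spec M
  isProper : IsProperQMS L M

attribute [instance] PPQMS.cstar

namespace PPQMS

/-- The closed ball of the spectrum of the topography, centered at the base point. -/
def ball (A : PPQMS.{u}) (r : ℝ) : Set (Spec A.M) :=
  {x | sigmaKantorovich A.L A.M x A.base ≤ ENNReal.ofReal r}

/-- `𝔏(A|M, μ, r)`. -/
def loc (A : PPQMS.{u}) (r : ℝ) : Set A.carrier := Loc A.L A.M (A.ball r)

/-- `𝔏(A|M, ⋆)`. -/
def locStar (A : PPQMS.{u}) : Set A.carrier := LocStar A.L A.M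

/-- `𝒮[A|μ, r]`. -/
def states (A : PPQMS.{u}) (r : ℝ) : Set (WeakDual ℂ A.carrier) := statesOn A.M (A.ball r)

/-- The underlying proper quantum metric space is strongly proper, for a seminorm on `A` of which
`L` is the restriction to the self-adjoint part. -/
def IsStronglyProper (A : PPQMS.{u}) : Prop :=
  ∃ L' : A.carrier → ℝ≥0∞, TopographicPropinquity.IsStronglyProper L' A.M ∧ A.L = saRestrict L'

end PPQMS

/-- (Pointed) isometric isomorphisms. A *-isomorphism which maps the Lipschitz locally supported
elements onto the Lipschitz locally supported elements restricts to a bijection between these sets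
which preserves the linear, Jordan and Lie operations. -/
structure IsometricIso (A B : PPQMS.{u}) where
  equiv : A.carrier ≃⋆ₐ[ℂ] B.carrier
  topographic : IsTopographicMorphism equiv.toNonUnitalStarAlgHom A.M B.M
  image_locStar : equiv '' A.locStar = B.locStar
  image_topography : equiv '' (A.M : Set A.carrier) = (B.M : Set B.carrier)
  map_L : ∀ a ∈ A.locStar, B.L (equiv a) = A.L a
  map_base : ∀ (m : A.carrier) (hm : m ∈ A.M) (hm' : equiv m ∈ B.M),
    B.base ⟨equiv m, hm'⟩ = A.base ⟨m, hm⟩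

theorem IsTopography.isTopographicMorphism {A B : Type*} [NonUnitalCStarAlgebra A]
    [NonUnitalCStarAlgebra B] {M : NonUnitalStarSubalgebra ℂ A} {N : NonUnitalStarSubalgebra ℂ B}
    (h : IsTopography M) (e : A ≃⋆ₐ[ℂ] B) (hMN : ∀ a ∈ M, e a ∈ N) :
    IsTopographicMorphism e.toNonUnitalStarAlgHom M N := by
  have hc : Continuous e := map_continuous e.toNonUnitalStarAlgHom
  obtain ⟨l, hl, hM⟩ := h.exists_approximateUnit
  refine ⟨e.surjective, hMN, l, hl, hM, @IsApproximateUnit.mk _ _ _ _ ?_ ?_ ?_⟩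
  · intro b
    have := (hc.tendsto _).comp (hl.tendsto_mul_left (e.symm b))
    simpa [tendsto_map'_iff, Function.comp_def] using this
  · intro b
    have := (hc.tendsto _).comp (hl.tendsto_mul_right (e.symm b))
    simpa [tendsto_map'_iff, Function.comp_def] using this
  · have := hl.neBot
    infer_instance

/-- The inverse of an isometric isomorphism. -/
def IsometricIso.symm {A B : PPQMS.{u}} (h : IsometricIso A B) : IsometricIso B A where
  equiv := h.equiv.symm
  topographic := by
    refine B.isProper.isQLCMS.topography.isTopographicMorphism _ ?_
    intro b hb
    have : b ∈ h.equiv '' (A.M : Set A.carrier) := h.image_topography ▸ hb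
    obtain ⟨a, ha, rfl⟩ := this
    simpa using ha
  image_locStar := by
    rw [← h.image_locStar, Set.image_image]
    simp
  image_topography := by
    rw [← h.image_topography, Set.image_image]
    simp
  map_L := by
    intro b hb
    rw [← h.image_locStar] at hb
    obtain ⟨a, ha, rfl⟩ := hb
    simpa using (h.map_L a ha).symm
  map_base := by
    intro b hb hb'
    have := h.map_base (h.equiv.symm b) hb' (by simpa using hb)
    simpa using this.symm

/-! ### Passages, tunnels and their extent -/

/-- Passages `(D, L, M, π, dom, ρ, cod)`. -/
structure Passage : Type (u + 1) where
  dom : PPQMS.{u}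
  cod : PPQMS.{u}
  D : Type u
  [cstar : NonUnitalCStarAlgebra D]
  L : D → ℝ≥0∞
  M : NonUnitalStarSubalgebra ℂ D
  π : D →⋆ₙₐ[ℂ] dom.carrier
  ρ : D →⋆ₙₐ[ℂ] cod.carrier
  isQLCMS : IsQLCMS L M
  lowerSemicontinuous : LowerSemicontinuous L
  topographic_π : IsTopographicMorphism π M dom.M
  topographic_ρ : IsTopographicMorphism ρ M cod.M

attribute [instance] Passage.cstar

namespace Passage

/-- The inverse passage. -/
def inverse (τ : Passage.{u}) : Passage.{u} where
  dom := τ.cod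
  cod := τ.dom
  D := τ.D
  L := τ.L
  M := τ.M
  π := τ.ρ
  ρ := τ.π
  isQLCMS := τ.isQLCMS
  lowerSemicontinuous := τ.lowerSemicontinuous
  topographic_π := τ.topographic_ρ
  topographic_ρ := τ.topographic_π

/-- The passage `(A, L_A, M_A, id, A, h, B)` of an isometric isomorphism `h` from `A` to `B`. -/
def ofIsometricIso {A B : PPQMS.{u}} (h : IsometricIso A B) : Passage.{u} where
  dom := A
  cod := B
  D := A.carrier
  L := A.L
  M := A.M
  π := NonUnitalStarAlgHom.id ℂ A.carrier
  ρ := h.equiv.toNonUnitalStarAlgHom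
  isQLCMS := A.isProper.isQLCMS
  lowerSemicontinuous := A.isProper.lowerSemicontinuous
  topographic_π :=
    A.isProper.isQLCMS.topography.isTopographicMorphism (StarAlgEquiv.refl ℂ A.carrier)
      (fun _ ha => ha)
  topographic_ρ := h.topographic

/-- The lift set of `a` associated with `(l, r, ε, K)`. -/
def liftSet (τ : Passage.{u}) (a : τ.dom.carrier) (l : ℝ≥0∞) (r ε : ℝ) (K : Set (Spec τ.M)) :
    Set τ.D :=
  {d | d ∈ Loc τ.L τ.M K ∧ τ.π d = a ∧ τ.ρ d ∈ τ.cod.loc (r + 4 * ε) ∧ τ.L d ≤ l}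

/-- The target set of `a` associated with `(l, r, ε, K)`. -/
def targetSet (τ : Passage.{u}) (a : τ.dom.carrier) (l : ℝ≥0∞) (r ε : ℝ) (K : Set (Spec τ.M)) :
    Set τ.cod.carrier :=
  τ.ρ '' τ.liftSet a l r ε K

/-- The pair `(ε, K)` is `r`-left admissible for `τ`. -/
structure IsLeftAdmissible (τ : Passage.{u}) (r ε : ℝ) (K : Set (Spec τ.M)) : Prop where
  pos : 0 < ε
  isCompact : IsCompact K
  states_subset : pullback τ.π '' τ.dom.states r ⊆ statesOn τ.M K
  subset_states : ∀ φ ∈ statesOn τ.M K, ∃ ψ ∈ pullback τ.π '' τ.dom.states (r + 4 * ε),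
    mongeKantorovich τ.L φ ψ ≤ ENNReal.ofReal ε
  target_nonempty : ∀ a ∈ τ.dom.loc r, (τ.targetSet a (τ.dom.L a) r ε K).Nonempty
  target_inter_nonempty : ∀ a ∈ τ.dom.loc r, a ∈ τ.dom.M →
    (τ.targetSet a (τ.dom.L a) r ε K ∩ (τ.cod.M : Set τ.cod.carrier)).Nonempty
  map_le : ∀ d ∈ Loc τ.L τ.M K, τ.cod.L (τ.ρ d) ≤ τ.L d

/-- The pair `(ε, K)` is `r`-admissible for `τ`: it is `r`-left admissible for `τ` and for its
inverse, the base points are at distance at most `ε`, and the Leibniz inequalities hold on the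
elements supported in `K`. -/
structure IsAdmissiblePair (τ : Passage.{u}) (r ε : ℝ) (K : Set (Spec τ.M)) : Prop where
  left : τ.IsLeftAdmissible r ε K
  right : τ.inverse.IsLeftAdmissible r ε K
  base : sigmaKantorovich τ.L τ.M
      (fun d => τ.dom.base ⟨τ.π d, τ.topographic_π.map_mem d d.2⟩)
      (fun d => τ.cod.base ⟨τ.ρ d, τ.topographic_ρ.map_mem d d.2⟩) ≤ ENNReal.ofReal ε
  leibniz : LeibnizOn τ.L (Loc τ.L τ.M K)

/-- The set of the `r`-admissible numbers of `τ`. -/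
def Adm (τ : Passage.{u}) (r : ℝ) : Set ℝ :=
  {ε | 0 < ε ∧ ∃ K : ℝ → Set (Spec τ.M),
    (∀ t t', 0 < t → t ≤ t' → t' ≤ r → K t ⊆ K t') ∧
    ∀ t, 0 < t → t ≤ r → τ.IsAdmissiblePair t ε (K t)}

/-- `τ` is an `r`-tunnel from its domain to its codomain. -/
def IsTunnel (τ : Passage.{u}) (r : ℝ) : Prop := 0 < r ∧ (τ.Adm r).Nonempty

/-- The `r`-extent of `τ`: the infimum of its `r`-admissible numbers. -/
def extent (τ : Passage.{u}) (r : ℝ) : ℝ≥0∞ := ⨅ ε ∈ τ.Adm r, ENNReal.ofReal ε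

end Passage

/-! ### The propinquity -/

/-- The class `T` of passages is weakly appropriate for the class `C`. -/
structure IsWeaklyAppropriate (C : Set PPQMS.{u}) (T : Set Passage.{u}) : Prop where
  tunnel : ∀ τ ∈ T, τ.dom ∈ C ∧ τ.cod ∈ C ∧ ∃ r : ℝ, τ.IsTunnel r
  inverse : ∀ τ ∈ T, τ.inverse ∈ T
  composition : ∀ τ₁ ∈ T, ∀ τ₂ ∈ T, τ₁.cod = τ₂.dom → ∀ r : ℝ, τ₁.IsTunnel r → τ₂.IsTunnel r →
    ∀ ε₁ ε₂ : ℝ, τ₁.extent r < ENNReal.ofReal ε₁ → τ₂.extent r < ENNReal.ofReal ε₂ →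
    ∀ t α : ℝ, 0 < t → t ≤ r - 4 * max ε₁ ε₂ → 0 < α →
    ∃ τ ∈ T, τ.dom = τ₁.dom ∧ τ.cod = τ₂.cod ∧ τ.IsTunnel t ∧
      τ.extent t ≤ ENNReal.ofReal (ε₁ + ε₂ + α)
  isometricIso : ∀ A ∈ C, ∀ B ∈ C, ∀ h : IsometricIso A B,
    Passage.ofIsometricIso h ∈ T ∧ Passage.ofIsometricIso h.symm ∈ T

/-- The `r`-local propinquity: the infimum of the `r`-extents of the `r`-tunnels in `T` from `A` to
`B`, infinite if there are none. -/
def localPropinquity (T : Set Passage.{u}) (r : ℝ) (A B : PPQMS.{u}) : ℝ≥0∞ :=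
  ⨅ τ : Passage.{u}, ⨅ _ : τ ∈ T ∧ τ.dom = A ∧ τ.cod = B ∧ τ.IsTunnel r, τ.extent r

/-- The topographic Gromov-Hausdorff propinquity. -/
def propinquity (T : Set Passage.{u}) (A B : PPQMS.{u}) : ℝ≥0∞ :=
  min (⨅ ε : ℝ, ⨅ _ : 0 < ε ∧ localPropinquity T (1 / ε) A B < ENNReal.ofReal ε, ENNReal.ofReal ε)
    (ENNReal.ofReal (√2 / 4))

end TopographicPropinquity

end

open TopographicPropinquity

namespace TopographicPropinquity

/-! ### Gelfand duality for commutative non-unital C*-algebras -/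

section Gelfand

variable {N : Type*} [NonUnitalCommCStarAlgebra N]

/-! Support in a compact set K is defined through the projection 1_K of the bidual. The first task
is to remove the bidual: `mem_Loc` and `mem_statesOn` express support in K by the functions f of the
topography with 0 ≤ f ≤ 1 and f = 1 on K. An element a is supported on K when fa = a = af for all of
them, and a state φ when φ(f) = 1.

Part (I). For the given approximate unit, e_n a e_n is compactly supported, and two uses of the
Leibniz inequality give L(e_n a e_n) ≤ L(a) + 2‖a‖L(e_n). Lower semicontinuity bounds the limit from
the other side (`exists_approximation`). The same e_n control the spectrum: as L(e_n) → 0, some e_n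
stays away from 0 on a whole ball, which therefore lies in a weak* compact set
(`exists_isCompact_ball_subset`).

Part (II). Propinquity zero yields tunnels D_n with ε_n → 0 and radii tending to infinity. Along an
ultrafilter, a and b are linked when they are the limits of π_n(d_n) and ρ_n(d_n), for some d_n with
bounded seminorms and supports of bounded radius. A state supported on K_t is ε_n-close to one
factoring through π_n and to one factoring through ρ_n, so ‖π_n(d_n)‖ and ‖ρ_n(d_n)‖ differ by
O(ε_n), and linked elements have equal norms (`Linked.norm_eq`). The Leibniz inequalities on D_n
make the relation stable under Jordan and Lie products. Compactness (`exists_tendsto_of_Loc`) gives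
each locally supported a a partner b with L_B(b) ≤ L_A(a) (`exists_linked`).

The relation is thus a Jordan-Lie subspace of A × B with dense projections, and the closure of its
complex span is the graph of a *-isomorphism (`exists_starAlgEquiv`). By symmetry it preserves the
seminorms of locally supported elements. Strong properness extends this to all self-adjoint
elements, by the approximation of part (I) and lower semicontinuity (`le_of_isStronglyProper`). -/

theorem character_star (x : WeakDual.characterSpace ℂ N) (m : N) : x (star m) = star (x m) := by
  -- Algebra homomorphisms from a unital C*-algebra to ℂ preserve the star, so the character is
  -- extended to the unitization.
  let χ : Unitization ℂ N →ₐ[ℂ] ℂ := Unitization.lift (WeakDual.CharacterSpace.toNonUnitalAlgHom x)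
  have hχ : ∀ m : N, χ m = x m := fun m => by simp [χ]
  have := AlgHomClass.instStarHomClass (F := Unitization ℂ N →ₐ[ℂ] ℂ) (A := Unitization ℂ N)
  rw [← hχ, ← hχ, Unitization.inr_star, map_star]

/-- A character of a commutative C*-algebra as a *-homomorphism. -/
noncomputable def characterStarHom (x : WeakDual.characterSpace ℂ N) : N →⋆ₙₐ[ℂ] ℂ :=
  { WeakDual.CharacterSpace.toNonUnitalAlgHom x with map_star' := character_star x }

theorem characterStarHom_apply (x : WeakDual.characterSpace ℂ N) (m : N) :
    characterStarHom x m = x m := rfl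

theorem norm_character_apply_le (x : WeakDual.characterSpace ℂ N) (m : N) : ‖x m‖ ≤ ‖m‖ :=
  NonUnitalStarAlgHom.norm_apply_le (characterStarHom x) m

/-- The Gelfand transform of the unitization is isometric and its character space is compact, so
some character attains the norm of m. Its restriction to `N` is not zero because m is not. -/
theorem exists_character_norm_eq {m : N} (hm : m ≠ 0) :
    ∃ x : WeakDual.characterSpace ℂ N, ‖x m‖ = ‖m‖ := by
  obtain ⟨χ, -, hχ⟩ := isCompact_univ.exists_isMaxOn Set.univ_nonempty
    (f := fun χ : WeakDual.characterSpace ℂ (Unitization ℂ N) => ‖χ (m : Unitization ℂ N)‖)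
    ((WeakDual.eval_continuous _).comp continuous_subtype_val).norm.continuousOn
  have h1 : ‖m‖ ≤ ‖χ (m : Unitization ℂ N)‖ := by
    rw [← Unitization.norm_inr (𝕜 := ℂ) m,
      ← (gelfandTransform_isometry (Unitization ℂ N)).norm_map_of_map_zero (map_zero _)]
    exact (ContinuousMap.norm_le _ (norm_nonneg _)).2 fun y => hχ (Set.mem_univ y)
  have h2 : 0 < ‖m‖ := norm_pos_iff.2 hm
  let φ : WeakDual ℂ N := StrongDual.toWeakDual
    ((WeakDual.CharacterSpace.toCLM χ).comp ⟨Unitization.inrHom ℂ ℂ N, (Unitization.isometry_inr (𝕜 := ℂ)).continuous⟩)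
  have hφ : ∀ a : N, φ a = χ (a : Unitization ℂ N) := fun _ => rfl
  refine ⟨⟨φ, ?_, fun a b => ?_⟩, ?_⟩
  · intro h
    have h3 : χ (m : Unitization ℂ N) = 0 := by rw [← hφ m, h]; rfl
    rw [h3, norm_zero] at h1
    exact h1.not_gt h2
  · rw [hφ, hφ, hφ, Unitization.inr_mul, map_mul]
  · refine le_antisymm (norm_character_apply_le _ m) ?_
    exact h1

/-- A character is a *-homomorphism to ℂ, hence commutes with the functional calculus, and the
calculus of a real scalar is evaluation. -/
theorem character_cfcₙ (x : WeakDual.characterSpace ℂ N) {g : ℝ → ℝ} (hg : Continuous g)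
    (h0 : g 0 = 0) {m : N} (hm : IsSelfAdjoint m) : x (cfcₙ g m) = (g (x m).re : ℂ) := by
  have h := (characterStarHom x).map_cfcₙ (S := ℂ) g m
    (hg.continuousOn) h0 (map_continuous (characterStarHom x)) hm (hm.map _)
  rw [characterStarHom_apply, characterStarHom_apply] at h
  rw [h, cfcₙ_eq_cfc]
  have hr : x m = algebraMap ℝ ℂ (x m).re := by
    have := (hm.map (characterStarHom x))
    rw [characterStarHom_apply] at this
    exact (Complex.conj_eq_iff_re.1 this).symm
  conv_lhs => rw [hr]
  rw [cfc_algebraMap]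
  rfl

end Gelfand

/-! ### Gelfand theory of a topography inside the ambient algebra. -/

section Topography

variable {A : Type*} [NonUnitalCStarAlgebra A] {M : NonUnitalStarSubalgebra ℂ A}

namespace IsTopography

/-- A topography is a commutative C*-algebra. -/
noncomputable abbrev commCStar (hM : IsTopography M) : NonUnitalCommCStarAlgebra M :=
  { NonUnitalStarSubalgebra.nonUnitalCStarAlgebra M (h_closed := hM.isClosed) with
    mul_comm := fun a b => Subtype.ext (hM.comm a a.2 b b.2) }

variable (hM : IsTopography M)
include hM

theorem apply_star (x : Spec M) (m : M) : x (star m) = star (x m) :=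
  letI := hM.commCStar; character_star x m

theorem norm_apply_le (x : Spec M) (m : M) : ‖x m‖ ≤ ‖(m : A)‖ :=
  letI := hM.commCStar; norm_character_apply_le x m

theorem exists_norm_eq {m : M} (hm : m ≠ 0) : ∃ x : Spec M, ‖x m‖ = ‖(m : A)‖ :=
  letI := hM.commCStar; exists_character_norm_eq hm

theorem norm_le {m : M} {C : ℝ} (hC : 0 ≤ C) (h : ∀ x : Spec M, ‖x m‖ ≤ C) : ‖(m : A)‖ ≤ C := by
  by_cases hm : m = 0
  · simpa [hm] using hC
  · obtain ⟨x, hx⟩ := hM.exists_norm_eq hm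
    exact hx ▸ h x

theorem ext {m m' : M} (h : ∀ x : Spec M, x m = x m') : m = m' := by
  have := hM.norm_le (m := m - m') le_rfl fun x => by rw [map_sub, h, sub_self, norm_zero]
  rw [← sub_eq_zero, ← norm_le_zero_iff]
  exact this

theorem isSelfAdjoint {m : M} (h : ∀ x : Spec M, ((x m).re : ℂ) = x m) : IsSelfAdjoint m :=
  hM.ext fun x => by rw [hM.apply_star, ← h x]; simp

theorem re_apply (x : Spec M) {m : M} (hm : IsSelfAdjoint m) : ((x m).re : ℂ) = x m := by
  have := hM.apply_star x m
  rw [hm.star_eq] at this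
  exact Complex.conj_eq_iff_re.1 this.symm

theorem exists_apply_eq {m : M} (hm : IsSelfAdjoint m) {g : ℝ → ℝ} (hg : Continuous g)
    (h0 : g 0 = 0) :
    ∃ m' : M, IsSelfAdjoint m' ∧ ∀ x : Spec M, x m' = (g (x m).re : ℂ) := by
  let _ := hM.commCStar
  exact ⟨cfcₙ g m, cfcₙ_predicate g m, fun x => character_cfcₙ x hg h0 hm⟩

end IsTopography

end Topography

/-! ### The indicator projection of a compact subset of the spectrum -/

section Indicator

variable {A : Type*} [NonUnitalCStarAlgebra A] {M : NonUnitalStarSubalgebra ℂ A}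
  {K : Set (Spec M)}

theorem continuous_spec_apply (m : M) : Continuous fun x : Spec M => x m :=
  (WeakDual.eval_continuous m).comp continuous_subtype_val

theorem norm_le_one_of_mem_Icc {z : ℂ} (h : 0 ≤ z ∧ z ≤ 1) : ‖z‖ ≤ 1 := by
  have := Complex.norm_of_nonneg' h.1
  have h1 := h.2
  rw [← this] at h1
  exact_mod_cast h1

theorem mul_mem_dominating {f g : M} (hf : f ∈ dominating M K) (hg : g ∈ dominating M K) :
    f * g ∈ dominating M K := by
  refine ⟨fun x => ?_, fun x hx => by rw [map_mul, hf.2 x hx, hg.2 x hx, one_mul]⟩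
  rw [map_mul]
  exact ⟨mul_nonneg (hf.1 x).1 (hg.1 x).1, mul_le_one₀ (hf.1 x).2 (hg.1 x).1 (hg.1 x).2⟩

theorem dominating_anti {K' : Set (Spec M)} (h : K ⊆ K') : dominating M K' ⊆ dominating M K :=
  fun _ hf => ⟨hf.1, fun x hx => hf.2 x (h hx)⟩

namespace IsTopography

variable (hM : IsTopography M)
include hM

theorem norm_le_one_of_dominating {f : M} (hf : f ∈ dominating M K) : ‖(f : A)‖ ≤ 1 :=
  hM.norm_le zero_le_one fun x => norm_le_one_of_mem_Icc (hf.1 x)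

theorem isSelfAdjoint_of_nonneg {f : M} (hf : ∀ x : Spec M, 0 ≤ x f) : IsSelfAdjoint f :=
  hM.isSelfAdjoint fun x => (Complex.eq_re_of_ofReal_le (hf x)).symm

/-- An element of a topography which is nonnegative on the spectrum is a square. -/
theorem exists_mul_self_eq {f : M} (hf : ∀ x : Spec M, 0 ≤ x f) :
    ∃ s : M, IsSelfAdjoint s ∧ s * s = f := by
  obtain ⟨s, hs, hsx⟩ := hM.exists_apply_eq (hM.isSelfAdjoint_of_nonneg hf) Real.continuous_sqrt
    Real.sqrt_zero
  refine ⟨s, hs, hM.ext fun x => ?_⟩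
  have h0 : 0 ≤ (x f).re := (Complex.le_def.1 (hf x)).1
  rw [map_mul, hsx, ← Complex.ofReal_mul, Real.mul_self_sqrt h0]
  exact hM.re_apply x (hM.isSelfAdjoint_of_nonneg hf)

/-- Near each x in K a multiple of m*m exceeds 1. Finitely many of these cover K, and their sum,
truncated to [0, 1] by functional calculus, equals 1 on K. -/
theorem dominating_nonempty (hK : IsCompact K) : (dominating M K).Nonempty := by
  obtain ⟨h, hsa, h0, h1⟩ : ∃ h : M, IsSelfAdjoint h ∧ (∀ x : Spec M, 0 ≤ (x h).re) ∧
      ∀ x ∈ K, 1 ≤ (x h).re := by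
    refine hK.induction_on (p := fun S : Set (Spec M) => ∃ h : M, IsSelfAdjoint h ∧
      (∀ x : Spec M, 0 ≤ (x h).re) ∧ ∀ x ∈ S, 1 ≤ (x h).re) ?_ ?_ ?_ ?_
    · exact ⟨0, .zero _, by simp, by simp⟩
    · rintro s t hst ⟨h, h1, h2, h3⟩
      exact ⟨h, h1, h2, fun x hx => h3 x (hst hx)⟩
    · rintro s t ⟨h, h1, h2, h3⟩ ⟨h', h1', h2', h3'⟩
      refine ⟨h + h', h1.add h1', fun x => ?_, fun x hx => ?_⟩
      · simpa using add_nonneg (h2 x) (h2' x)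
      · rw [map_add, Complex.add_re]
        rcases hx with hx | hx
        · linarith [h3 x hx, h2' x]
        · linarith [h3' x hx, h2 x]
    · intro x _
      obtain ⟨m, hm⟩ : ∃ m : M, x m ≠ 0 := by
        by_contra! hc
        exact x.2.1 (ContinuousLinearMap.ext hc)
      have hval (c : ℝ) (y : Spec M) :
          y ((c : ℂ) • (star m * m)) = ((c * ‖y m‖ ^ 2 : ℝ) : ℂ) := by
        rw [map_smul, map_mul, hM.apply_star, smul_eq_mul, Complex.star_def, Complex.conj_mul']
        push_cast; rfl
      have hx : 0 < ‖x m‖ ^ 2 := by positivity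
      have hc : 0 < 2 / ‖x m‖ ^ 2 := by positivity
      refine ⟨{y | 1 < 2 / ‖x m‖ ^ 2 * ‖y m‖ ^ 2}, mem_nhdsWithin_of_mem_nhds
        (IsOpen.mem_nhds (isOpen_lt continuous_const ?_) ?_),
        ((2 / ‖x m‖ ^ 2 : ℝ) : ℂ) • (star m * m), ?_, fun y => ?_, fun y hy => ?_⟩
      · exact continuous_const.mul ((continuous_spec_apply m).norm.pow 2)
      · have : 2 / ‖x m‖ ^ 2 * ‖x m‖ ^ 2 = 2 := by field_simp
        simp [this]
      · exact hM.isSelfAdjoint fun y => by rw [hval, Complex.ofReal_re]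
      · rw [hval, Complex.ofReal_re]; positivity
      · rw [hval, Complex.ofReal_re]; exact le_of_lt hy
  obtain ⟨f, -, hf⟩ := hM.exists_apply_eq hsa (g := fun t => max 0 (min t 1)) (by fun_prop) (by simp)
  refine ⟨f, fun x => ?_, fun x hx => ?_⟩
  · rw [hf]
    refine ⟨?_, ?_⟩
    · exact_mod_cast le_max_left _ _
    · exact_mod_cast max_le zero_le_one (min_le_right _ _)
  · rw [hf, min_eq_right (h1 x hx), max_eq_right zero_le_one, Complex.ofReal_one]

end IsTopography

theorem hasBasis_decreasingTo (hne : (dominating M K).Nonempty) :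
    (decreasingTo M K).HasBasis (fun g => g ∈ dominating M K)
      fun g => {f | f ∈ dominating M K ∧ ∀ x : Spec M, x f ≤ x g} := by
  refine hasBasis_biInf_principal ?_ hne
  intro g hg g' hg'
  refine ⟨g * g', mul_mem_dominating hg hg', fun f hf => ⟨hf.1, fun x => (hf.2 x).trans ?_⟩,
    fun f hf => ⟨hf.1, fun x => (hf.2 x).trans ?_⟩⟩
  · rw [map_mul]
    exact mul_le_of_le_one_right (hg.1 x).1 (hg'.1 x).2
  · rw [map_mul]
    exact mul_le_of_le_one_left (hg'.1 x).1 (hg.1 x).2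

theorem decreasingTo_neBot (hne : (dominating M K).Nonempty) : (decreasingTo M K).NeBot :=
  (hasBasis_decreasingTo hne).neBot_iff.2 fun {g} hg => ⟨g, hg, fun _ => le_rfl⟩

theorem dominating_mem_decreasingTo (hne : (dominating M K).Nonempty) :
    dominating M K ∈ decreasingTo M K :=
  (hasBasis_decreasingTo hne).mem_iff.2 ⟨hne.some, hne.some_mem, fun _ hf => hf.1⟩

/-- The identity f₀ 1_K = 1_K at the level of nets. -/
theorem tendsto_mul_left_decreasingTo (hne : (dominating M K).Nonempty) {f₀ : M}
    (hf₀ : f₀ ∈ dominating M K) :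
    Tendsto (fun f => f₀ * f) (decreasingTo M K) (decreasingTo M K) := by
  refine ((hasBasis_decreasingTo hne).tendsto_iff (hasBasis_decreasingTo hne)).2 fun g hg =>
    ⟨g, hg, fun f hf => ⟨mul_mem_dominating hf₀ hf.1, fun x => ?_⟩⟩
  rw [map_mul]
  exact (mul_le_of_le_one_left (hf.1.1 x).1 (hf₀.1 x).2).trans (hf.2 x)

/-- A bounded functional is Cauchy along a decreasing net of functions in a topography. -/
theorem IsTopography.cauchy_map (hM : IsTopography M) (hne : (dominating M K).Nonempty)
    (φ : StrongDual ℂ A) :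
    Cauchy (map (fun f : M => φ f) (decreasingTo M K)) := by
  have := decreasingTo_neBot hne
  have key : ∀ ε > 0, ∃ g ∈ dominating M K, ∀ f ∈ dominating M K, (∀ x : Spec M, x f ≤ x g) →
      ‖φ g - φ f‖ < ε := by
    by_contra! hcon
    obtain ⟨ε, hε, hcon⟩ := hcon
    -- If the Cauchy property fails, iteration produces a decreasing sequence on which φ jumps by at
    -- least ε at every step.
    choose! next h1 h2 h3 using hcon
    obtain ⟨f₀, hf₀⟩ := hne
    let s : ℕ → M := fun n => next^[n] f₀
    have hs1 (n : ℕ) : s (n + 1) = next (s n) := Function.iterate_succ_apply' _ _ _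
    have hs : ∀ n, s n ∈ dominating M K := fun n => by
      induction n with
      | zero => exact hf₀
      | succ n ih => rw [hs1]; exact h1 _ ih
    -- The phases w make every jump of φ positive. The sum of w k • (s k - s (k+1)) still has norm
    -- at most 1, since on the spectrum the moduli telescope, whereas φ takes a value at least nε on
    -- it.
    let w : ℕ → ℂ := fun n => star (φ (s n) - φ (s (n + 1))) / ‖φ (s n) - φ (s (n + 1))‖
    have hpos (n : ℕ) : 0 < ‖φ (s n) - φ (s (n + 1))‖ := by
      rw [hs1]; exact hε.trans_le (h3 _ (hs n))
    have hw (n : ℕ) : ‖w n‖ = 1 := by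
      simp only [w, norm_div, norm_star, Complex.norm_real, norm_norm]
      exact div_self (hpos n).ne'
    have hφw (n : ℕ) : w n * (φ (s n) - φ (s (n + 1))) = (‖φ (s n) - φ (s (n + 1))‖ : ℂ) := by
      have : (‖φ (s n) - φ (s (n + 1))‖ : ℂ) ≠ 0 := by exact_mod_cast (hpos n).ne'
      simp only [w, Complex.star_def]
      rw [div_mul_eq_mul_div, Complex.conj_mul', div_eq_iff this, sq]
    have hnorm (n : ℕ) : ‖((∑ k ∈ Finset.range n, w k • (s k - s (k + 1)) : M) : A)‖ ≤ 1 := by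
      refine hM.norm_le zero_le_one fun x => ?_
      have hterm (k : ℕ) : ‖w k * (x (s k) - x (s (k + 1)))‖ =
          (x (s k)).re - (x (s (k + 1))).re := by
        rw [norm_mul, hw, one_mul, ← Complex.sub_re]
        have h := sub_nonneg.2 (h2 (s k) (hs k) x)
        rw [← hs1] at h
        exact (Complex.re_eq_norm.2 h).symm
      calc ‖x (∑ k ∈ Finset.range n, w k • (s k - s (k + 1)))‖
          = ‖∑ k ∈ Finset.range n, w k * (x (s k) - x (s (k + 1)))‖ := by
            simp only [map_sum, map_smul, map_sub, smul_eq_mul]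
        _ ≤ ∑ k ∈ Finset.range n, ‖w k * (x (s k) - x (s (k + 1)))‖ := norm_sum_le _ _
        _ = (x (s 0)).re - (x (s n)).re := by
            simp only [hterm]
            exact Finset.sum_range_sub' (fun k => (x (s k)).re) n
        _ ≤ 1 := by
            have a := (Complex.le_def.1 ((hs n).1 x).1).1
            have b := (Complex.le_def.1 ((hs 0).1 x).2).1
            simp only [Complex.zero_re, Complex.one_re] at a b
            linarith
    have hbig (n : ℕ) : n * ε ≤ ‖φ‖ := by
      calc n * ε = ∑ _k ∈ Finset.range n, ε := by simp
        _ ≤ ∑ k ∈ Finset.range n, ‖φ (s k) - φ (s (k + 1))‖ :=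
            Finset.sum_le_sum fun k _ => by rw [hs1]; exact h3 _ (hs k)
        _ = ‖φ ((∑ k ∈ Finset.range n, w k • (s k - s (k + 1)) : M) : A)‖ := by
            have : φ ((∑ k ∈ Finset.range n, w k • (s k - s (k + 1)) : M) : A) =
                ((∑ k ∈ Finset.range n, ‖φ (s k) - φ (s (k + 1))‖ : ℝ) : ℂ) := by
              push_cast
              rw [map_sum]
              refine Finset.sum_congr rfl fun k _ => ?_
              rw [map_smul, map_sub, smul_eq_mul, hφw]
            rw [this, Complex.norm_real, Real.norm_of_nonneg]
            exact Finset.sum_nonneg fun _ _ => norm_nonneg _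
        _ ≤ ‖φ‖ := by simpa using φ.le_opNorm_of_le (hnorm n)
    obtain ⟨n, hn⟩ := exists_nat_gt (‖φ‖ / ε)
    rw [div_lt_iff₀ hε] at hn
    exact (hbig n).not_gt hn
  refine Metric.cauchy_iff.2 ⟨inferInstance, fun ε hε => ?_⟩
  obtain ⟨g, hg, hgf⟩ := key (ε / 2) (half_pos hε)
  refine ⟨_, image_mem_map ((hasBasis_decreasingTo hne).mem_of_mem hg), ?_⟩
  rintro _ ⟨f, hf, rfl⟩ _ ⟨f', hf', rfl⟩
  have e1 := hgf f hf.1 hf.2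
  have e2 := hgf f' hf'.1 hf'.2
  rw [← dist_eq_norm] at e1 e2
  rw [dist_comm] at e1
  calc dist (φ f) (φ f') ≤ dist (φ f) (φ g) + dist (φ g) (φ f') := dist_triangle _ _ _
    _ < ε := by linarith

/-- `indicator` is a `limUnder`, meaningful only once the net is known to converge. Pointwise limits
exist by `cauchy_map`, and they form a functional of norm at most 1 because the net lies in the unit
ball. -/
theorem IsTopography.tendsto_indicator (hM : IsTopography M) (hne : (dominating M K).Nonempty)
    (φ : StrongDual ℂ A) :
    Tendsto (fun f : M => φ f) (decreasingTo M K) (𝓝 (indicator M K φ)) := by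
  have := decreasingTo_neBot hne
  choose F hF using fun φ : StrongDual ℂ A => cauchy_map_iff_exists_tendsto.1 (hM.cauchy_map hne φ)
  have hbound (φ : StrongDual ℂ A) : ‖F φ‖ ≤ 1 * ‖φ‖ := by
    refine le_of_tendsto (hF φ).norm ?_
    filter_upwards [dominating_mem_decreasingTo hne] with f hf
    rw [one_mul]
    simpa using φ.le_opNorm_of_le (hM.norm_le_one_of_dominating hf)
  let F' : Bidual A := LinearMap.mkContinuous
    { toFun := F
      map_add' := fun φ ψ => tendsto_nhds_unique (hF _) ((hF φ).add (hF ψ))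
      map_smul' := fun c φ => tendsto_nhds_unique (hF _) ((hF φ).const_smul c) } 1 hbound
  have hlim : Tendsto (fun f : M => StrongDual.toWeakDual (toBidual (f : A))) (decreasingTo M K)
      (𝓝 (StrongDual.toWeakDual F')) := by
    rw [tendsto_iff_forall_eval_tendsto_topDualPairing]
    exact hF
  have h : indicator M K = F' := by
    have := hlim.limUnder_eq
    rw [indicator]
    exact congrArg WeakDual.toStrongDual this
  rw [h]
  exact hF φ

/-- The functional `z ↦ ⟨φ (z ·), 1_K⟩`. -/
noncomputable def rightCut (M : NonUnitalStarSubalgebra ℂ A) (K : Set (Spec M))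
    (φ : StrongDual ℂ A) : StrongDual ℂ A :=
  arensTranspose (arensTranspose (ContinuousLinearMap.mul ℂ A)) (indicator M K) φ

namespace IsTopography

variable (hM : IsTopography M) (hne : (dominating M K).Nonempty)
include hM hne

theorem tendsto_rightCut (φ : StrongDual ℂ A) (z : A) :
    Tendsto (fun g : M => φ (z * g)) (decreasingTo M K) (𝓝 (rightCut M K φ z)) :=
  hM.tendsto_indicator hne (arensTranspose (ContinuousLinearMap.mul ℂ A) φ z)

/-- The Arens product is an iterated limit: in 1_K a 1_K the right factor is taken to the limit
first, inside `rightCut`, and then the left one. -/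
theorem tendsto_corner (φ : StrongDual ℂ A) (a : A) :
    Tendsto (fun f : M => rightCut M K φ (f * a)) (decreasingTo M K) (𝓝 (corner M K a φ)) :=
  hM.tendsto_indicator hne
    (arensTranspose (arensTranspose (ContinuousLinearMap.mul ℂ A)) (toBidual a) (rightCut M K φ))

theorem corner_apply_eq {φ : StrongDual ℂ A} {a : A} {c : ℂ}
    (h : ∀ f ∈ dominating M K, ∀ g ∈ dominating M K, φ (f * a * g) = c) :
    corner M K a φ = c := by
  have := decreasingTo_neBot hne
  refine tendsto_nhds_unique (hM.tendsto_corner hne φ a) (tendsto_const_nhds.congr' ?_)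
  filter_upwards [dominating_mem_decreasingTo hne] with f hf
  refine tendsto_nhds_unique (tendsto_const_nhds.congr' ?_) (hM.tendsto_rightCut hne φ (f * a))
  filter_upwards [dominating_mem_decreasingTo hne] with g hg
  exact (h f hf g hg).symm

/-- Replacing φ by φ(f₀ ·) or φ(· f₀) leaves the iterated limit unchanged, as f₀ is absorbed by the
net. If the corner of a is a itself, this says φ(f₀ a) = φ(a) = φ(a f₀) for every φ, and functionals
separate points. -/
theorem corner_eq_iff {a : A} :
    corner M K a = toBidual a ↔ ∀ f ∈ dominating M K, (f : A) * a = a ∧ a * f = a := by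
  have := decreasingTo_neBot hne
  refine ⟨fun h f₀ hf₀ => ?_, fun h => ?_⟩
  · have happ (φ : StrongDual ℂ A) : corner M K a φ = φ a := by rw [h]; rfl
    constructor
    · refine (SeparatingDual.eq_iff_forall_dual_eq (R := ℂ)).2 fun φ => ?_
      let φ₀ : StrongDual ℂ A := φ.comp (ContinuousLinearMap.mul ℂ A f₀)
      have hcut (z : A) : rightCut M K φ₀ z = rightCut M K φ (f₀ * z) := by
        refine tendsto_nhds_unique (hM.tendsto_rightCut hne φ₀ z) ?_
        refine (hM.tendsto_rightCut hne φ (f₀ * z)).congr fun g => ?_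
        simp [φ₀, mul_assoc]
      have h1 := hM.tendsto_corner hne φ₀ a
      have h2 := (hM.tendsto_corner hne φ a).comp (tendsto_mul_left_decreasingTo hne hf₀)
      have h3 : corner M K a φ₀ = corner M K a φ := by
        refine tendsto_nhds_unique h1 (h2.congr fun f => ?_)
        simp [hcut, mul_assoc]
      rw [happ, happ] at h3
      exact h3
    · refine (SeparatingDual.eq_iff_forall_dual_eq (R := ℂ)).2 fun φ => ?_
      let φ₀ : StrongDual ℂ A := φ.comp ((ContinuousLinearMap.mul ℂ A).flip f₀)
      have hcut (z : A) : rightCut M K φ₀ z = rightCut M K φ z := by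
        refine tendsto_nhds_unique (hM.tendsto_rightCut hne φ₀ z) ?_
        refine ((hM.tendsto_rightCut hne φ z).comp
          (tendsto_mul_left_decreasingTo hne hf₀)).congr fun g => ?_
        simp only [φ₀, Function.comp_apply, ContinuousLinearMap.comp_apply,
          ContinuousLinearMap.flip_apply, ContinuousLinearMap.mul_apply', mul_assoc,
          NonUnitalStarSubalgebra.coe_mul]
        -- Here f₀ stands to the right of g; commutativity of the topography moves it to the side on
        -- which the net absorbs it.
        rw [hM.comm f₀ f₀.2 g g.2]
      have h3 : corner M K a φ₀ = corner M K a φ := by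
        refine tendsto_nhds_unique (hM.tendsto_corner hne φ₀ a)
          ((hM.tendsto_corner hne φ a).congr fun f => ?_)
        rw [hcut]
      rw [happ, happ] at h3
      exact h3
  · refine ContinuousLinearMap.ext fun φ => ?_
    refine (hM.corner_apply_eq hne fun f hf g hg => ?_).trans (b := φ a) rfl
    rw [(h f hf).1, (h g hg).2]

end IsTopography

theorem IsTopography.mem_Loc (hM : IsTopography M) (hK : IsCompact K) {L : A → ℝ≥0∞} {a : A} :
    a ∈ Loc L M K ↔ IsSelfAdjoint a ∧
      (∀ f ∈ dominating M K, (f : A) * a = a ∧ a * f = a) ∧ L a < ∞ := by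
  rw [← hM.corner_eq_iff (hM.dominating_nonempty hK)]; rfl

theorem IsTopography.Loc_mono (hM : IsTopography M) (hK : IsCompact K) {K' : Set (Spec M)}
    (hK' : IsCompact K') (h : K ⊆ K') {L : A → ℝ≥0∞} : Loc L M K ⊆ Loc L M K' := fun a ha => by
  rw [hM.mem_Loc hK] at ha
  exact (hM.mem_Loc hK').2 ⟨ha.1, fun f hf => ha.2.1 f (dominating_anti h hf), ha.2.2⟩

end Indicator

/-! ### Functionals which attain their norm at a positive contraction -/

section Norms

attribute [local instance] CStarAlgebra.spectralOrder CStarAlgebra.spectralOrderedRing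

theorem exists_commuting_sqrt {U : Type*} [CStarAlgebra U] {h : U} (h0 : 0 ≤ h) (h1 : h ≤ 1) :
    ∃ s t : U, IsSelfAdjoint s ∧ IsSelfAdjoint t ∧ Commute s t ∧ s * s = h ∧ t * t = 1 - h := by
  have hsp : ∀ x ∈ spectrum ℝ h, 0 ≤ x ∧ x ≤ 1 := fun x hx =>
    ⟨spectrum_nonneg_of_nonneg h0 hx, (CFC.le_one_iff h).1 h1 x hx⟩
  have hsa : IsSelfAdjoint h := .of_nonneg h0
  refine ⟨cfc Real.sqrt h, cfc (fun x => Real.sqrt (1 - x)) h, cfc_predicate _ _, cfc_predicate _ _,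
    cfc_commute_cfc _ _ _, ?_, ?_⟩
  · rw [← cfc_mul _ _ h]
    conv_rhs => rw [← cfc_id' ℝ h]
    exact cfc_congr fun x hx => Real.mul_self_sqrt (hsp x hx).1
  · rw [← cfc_mul _ _ h]
    conv_rhs => rw [← cfc_id' ℝ h, ← cfc_one ℝ h, ← cfc_sub _ _ h]
    exact cfc_congr fun x hx => Real.mul_self_sqrt (sub_nonneg.2 (hsp x hx).2)

/-- Put s = √h, t = √(1 - h) and y = z t a. The matrix with rows (s, t) and (t, -s) is a
self-adjoint unitary. It sends the column (s, y) to one with first entry h + z(a - ha), so the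
square of that entry is dominated by s² + y*y. -/
theorem norm_add_smul_sq_le {U : Type*} [CStarAlgebra U] {h : U} (h0 : 0 ≤ h) (h1 : h ≤ 1) (a : U)
    (z : ℂ) : ‖h + z • (a - h * a)‖ ^ 2 ≤ 1 + ‖z‖ ^ 2 * ‖a‖ ^ 2 := by
  obtain ⟨s, t, hs, ht, hst, hss, htt⟩ := exists_commuting_sqrt h0 h1
  have ns : ‖s‖ ^ 2 ≤ 1 := by
    rw [sq, ← CStarRing.norm_star_mul_self, hs.star_eq, hss]
    exact (CStarAlgebra.norm_le_one_iff_of_nonneg h).2 h1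
  have nt : ‖t‖ ^ 2 ≤ 1 := by
    rw [sq, ← CStarRing.norm_star_mul_self, ht.star_eq, htt]
    exact (CStarAlgebra.norm_le_one_iff_of_nonneg _ (sub_nonneg.2 h1)).2 (sub_le_self _ h0)
  set y := z • (t * a) with hy
  have hc : h + z • (a - h * a) = s * s + t * y := by
    rw [hss, hy, mul_smul_comm, ← mul_assoc, htt, sub_mul, one_mul]
  have key : star (s * s + t * y) * (s * s + t * y) + star (t * s - s * y) * (t * s - s * y) =
      s * s + star y * y := by
    have e1 : s * t = t * s := hst
    have e2 : t * t + s * s = 1 := by rw [htt, hss, sub_add_cancel]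
    simp only [star_add, star_sub, star_mul, hs.star_eq, ht.star_eq]
    calc (s * s + star y * t) * (s * s + t * y) + (s * t - star y * s) * (t * s - s * y)
        = s * (s * s + t * t) * s + s * (s * t - t * s) * y + star y * (t * s - s * t) * s
          + star y * (t * t + s * s) * y := by noncomm_ring
      _ = s * s + star y * y := by rw [e1, add_comm (s * s), e2]; noncomm_ring
  rw [hc, sq, ← CStarRing.norm_star_mul_self]
  calc ‖star (s * s + t * y) * (s * s + t * y)‖ ≤ ‖s * s + star y * y‖ := by
        rw [← key]
        exact CStarAlgebra.norm_le_norm_of_nonneg_of_le (star_mul_self_nonneg _)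
          (le_add_of_nonneg_right (star_mul_self_nonneg _))
    _ ≤ ‖s * s‖ + ‖star y * y‖ := norm_add_le _ _
    _ ≤ 1 + ‖z‖ ^ 2 * ‖a‖ ^ 2 := by
        have a1 : ‖s * s‖ ≤ 1 := (norm_mul_le _ _).trans (by rwa [← sq])
        have a2 : ‖star y * y‖ = ‖y‖ ^ 2 := by rw [CStarRing.norm_star_mul_self, sq]
        have a3 : ‖y‖ ≤ ‖z‖ * (‖t‖ * ‖a‖) := by
          rw [hy, norm_smul]; gcongr; exact norm_mul_le _ _
        have a4 : ‖y‖ ^ 2 ≤ ‖z‖ ^ 2 * (1 * ‖a‖ ^ 2) := by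
          calc ‖y‖ ^ 2 ≤ (‖z‖ * (‖t‖ * ‖a‖)) ^ 2 := by gcongr
            _ = ‖z‖ ^ 2 * (‖t‖ ^ 2 * ‖a‖ ^ 2) := by ring
            _ ≤ _ := by gcongr
        linarith

section NonUnital

variable {A : Type*} [NonUnitalCStarAlgebra A] {φ : StrongDual ℂ A} {k : A}

theorem inr_star_mul_self_mem (hk : ‖k‖ ≤ 1) :
    (0 : Unitization ℂ A) ≤ ((star k * k : A) : Unitization ℂ A) ∧
      ((star k * k : A) : Unitization ℂ A) ≤ 1 := by
  have h0 : (0 : Unitization ℂ A) ≤ ((star k * k : A) : Unitization ℂ A) := by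
    rw [Unitization.inr_mul, Unitization.inr_star]
    exact star_mul_self_nonneg _
  refine ⟨h0, (CStarAlgebra.norm_le_one_iff_of_nonneg _ h0).1 ?_⟩
  rw [Unitization.norm_inr, CStarRing.norm_star_mul_self]
  exact mul_le_one₀ hk (norm_nonneg _) hk

/-- The norm grows only quadratically in z, while φ(h + z b) = 1 + z φ(b) grows linearly. Taking z
to be a small multiple δ of the conjugate of φ(b) forces φ(b) = 0; δ = 1/(C + 1) is small enough
since δC ≤ 1. -/
theorem apply_eq_zero_of_norm_add_smul_sq_le (hφ : ‖φ‖ ≤ 1) {h b : A} {C : ℝ} (hC : 0 ≤ C)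
    (h1 : φ h = 1) (hb : ∀ z : ℂ, ‖h + z • b‖ ^ 2 ≤ 1 + ‖z‖ ^ 2 * C) : φ b = 0 := by
  by_contra hne
  have hw : 0 < ‖φ b‖ ^ 2 := by positivity
  have hC1 : 0 < C + 1 := by positivity
  set δ : ℝ := (C + 1)⁻¹ with hδ
  have hδ0 : 0 < δ := by positivity
  have hz := hb ((δ : ℂ) * star (φ b))
  have e1 : φ (h + ((δ : ℂ) * star (φ b)) • b) = ((1 + δ * ‖φ b‖ ^ 2 : ℝ) : ℂ) := by
    rw [map_add, map_smul, h1, smul_eq_mul, mul_assoc, Complex.star_def, Complex.conj_mul']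
    push_cast; rfl
  have e2 := φ.le_of_opNorm_le hφ (h + ((δ : ℂ) * star (φ b)) • b)
  rw [e1, Complex.norm_real, one_mul, Real.norm_of_nonneg (by positivity)] at e2
  have e3 : (1 + δ * ‖φ b‖ ^ 2) ^ 2 ≤ 1 + ‖(δ : ℂ) * star (φ b)‖ ^ 2 * C :=
    (pow_le_pow_left₀ (by positivity) e2 2).trans hz
  rw [norm_mul, norm_star, Complex.norm_real, Real.norm_of_nonneg hδ0.le, mul_pow] at e3
  have e4 : δ * C ≤ 1 := by
    rw [hδ, inv_mul_le_iff₀ hC1]; linarith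
  nlinarith [mul_le_mul_of_nonneg_left e4 (mul_nonneg hδ0.le hw.le), mul_pos hδ0 hw,
    sq_nonneg (δ * ‖φ b‖ ^ 2)]

variable (hφ : ‖φ‖ ≤ 1) (hk : ‖k‖ ≤ 1) (h1 : φ (star k * k) = 1)
include hφ hk h1

/-- Substitute for the Cauchy-Schwarz argument, which is not yet available: φ is only known to be
contractive, and its positivity is deduced from this identity. -/
theorem apply_mul_left (a : A) : φ (star k * k * a) = φ a := by
  obtain ⟨p0, p1⟩ := inr_star_mul_self_mem hk
  have := apply_eq_zero_of_norm_add_smul_sq_le hφ (b := a - star k * k * a)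
    (sq_nonneg ‖a‖) h1 fun z => by
      have := norm_add_smul_sq_le p0 p1 (a : Unitization ℂ A) z
      rwa [← Unitization.inr_mul, ← Unitization.inr_sub, ← Unitization.inr_smul,
        ← Unitization.inr_add, Unitization.norm_inr, Unitization.norm_inr] at this
  rw [map_sub, sub_eq_zero] at this
  exact this.symm

theorem apply_mul_right (a : A) : φ (a * (star k * k)) = φ a := by
  obtain ⟨p0, p1⟩ := inr_star_mul_self_mem hk
  have := apply_eq_zero_of_norm_add_smul_sq_le hφ (b := a - a * (star k * k))
    (sq_nonneg ‖a‖) h1 fun z => by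
      have := norm_add_smul_sq_le p0 p1 (star a : Unitization ℂ A) (star z)
      rw [← Unitization.inr_star, ← Unitization.inr_mul, ← Unitization.inr_sub,
        ← Unitization.inr_smul, ← Unitization.inr_add, Unitization.norm_inr, Unitization.norm_inr,
        norm_star, norm_star, ← norm_star] at this
      simpa [mul_assoc] using this
  rw [map_sub, sub_eq_zero] at this
  exact this.symm

/-- With h = k*k, compression by h turns a - z1, an element of the unitization, into an element of
`A` on which φ takes the value φ(a) - z. So φ behaves like a contractive unital functional. -/
theorem norm_apply_sub_le (a : A) (z : ℂ) :
    ‖φ a - z‖ ≤ ‖(a : Unitization ℂ A) - z • (1 : Unitization ℂ A)‖ := by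
  set h := star k * k with hh
  have e : φ (h * a * h - z • (h * h)) = φ a - z := by
    rw [map_sub, map_smul, apply_mul_right hφ hk h1, apply_mul_left hφ hk h1,
      apply_mul_left hφ hk h1, h1, smul_eq_mul, mul_one]
  have hn : ‖(h : Unitization ℂ A)‖ ≤ 1 := by
    rw [Unitization.norm_inr, CStarRing.norm_star_mul_self]
    exact mul_le_one₀ hk (norm_nonneg _) hk
  have e2 : ((h * a * h - z • (h * h) : A) : Unitization ℂ A) =
      h * ((a : Unitization ℂ A) - z • (1 : Unitization ℂ A)) * h := by
    simp [mul_sub, sub_mul, Unitization.inr_sub]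
  rw [← e]
  refine (φ.le_of_opNorm_le hφ _).trans ?_
  rw [one_mul, ← Unitization.norm_inr (𝕜 := ℂ), e2]
  calc _ ≤ ‖(h : Unitization ℂ A)‖ * ‖(a : Unitization ℂ A) - z • (1 : Unitization ℂ A)‖ *
        ‖(h : Unitization ℂ A)‖ := norm_mul₃_le
    _ ≤ 1 * ‖(a : Unitization ℂ A) - z • (1 : Unitization ℂ A)‖ * 1 := by gcongr
    _ = _ := by ring

theorem im_apply_eq_zero {a : A} (ha : IsSelfAdjoint a) : (φ a).im = 0 := by
  have key (t : ℝ) : (φ a).re ^ 2 + ((φ a).im - t) ^ 2 ≤ ‖a‖ ^ 2 + t ^ 2 := by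
    have e := norm_apply_sub_le hφ hk h1 a (t * Complex.I)
    have e1 : ‖φ a - t * Complex.I‖ ^ 2 = (φ a).re ^ 2 + ((φ a).im - t) ^ 2 := by
      rw [Complex.sq_norm, Complex.normSq_apply]
      simp; ring
    have e2 : star ((a : Unitization ℂ A) - (t * Complex.I) • (1 : Unitization ℂ A)) *
        ((a : Unitization ℂ A) - (t * Complex.I) • (1 : Unitization ℂ A)) =
        star (a : Unitization ℂ A) * a + ((t ^ 2 : ℝ) : ℂ) • (1 : Unitization ℂ A) := by
      have hs : star (a : Unitization ℂ A) = a := by rw [← Unitization.inr_star, ha.star_eq]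
      rw [star_sub, star_smul, star_one, hs, sub_mul, mul_sub, mul_sub]
      simp only [smul_mul_assoc, mul_smul_comm, one_mul, mul_one, smul_smul, star_mul']
      have : t * Complex.I * (star (t : ℂ) * star Complex.I) = ((t ^ 2 : ℝ) : ℂ) := by
        simp only [Complex.star_def, Complex.conj_ofReal, Complex.conj_I]
        ring_nf; simp
      rw [this]
      have h2 : star (t : ℂ) * star Complex.I = - (t * Complex.I) := by
        simp
      rw [h2, neg_smul]
      abel
    rw [← e1]
    calc ‖φ a - t * Complex.I‖ ^ 2
        ≤ ‖(a : Unitization ℂ A) - (t * Complex.I) • (1 : Unitization ℂ A)‖ ^ 2 := by gcongr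
      _ = ‖star (a : Unitization ℂ A) * a + ((t ^ 2 : ℝ) : ℂ) • (1 : Unitization ℂ A)‖ := by
          rw [sq, ← CStarRing.norm_star_mul_self, e2]
      _ ≤ ‖star (a : Unitization ℂ A) * a‖ + ‖((t ^ 2 : ℝ) : ℂ) • (1 : Unitization ℂ A)‖ :=
          norm_add_le _ _
      _ = ‖a‖ ^ 2 + t ^ 2 := by
          rw [CStarRing.norm_star_mul_self, norm_smul, norm_one, mul_one, Complex.norm_real,
            Real.norm_of_nonneg (sq_nonneg t), Unitization.norm_inr, sq ‖a‖]
  by_contra hne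
  -- This t makes -2t Im φ(a) equal to ‖a‖² + 1, which contradicts `key`.
  have := key (-(‖a‖ ^ 2 + 1) / (2 * (φ a).im))
  have e : (φ a).im * (-(‖a‖ ^ 2 + 1) / (2 * (φ a).im)) = -(‖a‖ ^ 2 + 1) / 2 := by
    field_simp
  nlinarith [sq_nonneg (φ a).re, sq_nonneg (φ a).im]

/-- For b = a*a one has ‖b - ‖b‖1‖ ≤ ‖b‖, so the real number φ(b) lies within ‖b‖ of ‖b‖. -/
theorem apply_star_mul_self_nonneg (a : A) : 0 ≤ φ (star a * a) := by
  have him := im_apply_eq_zero hφ hk h1 (IsSelfAdjoint.star_mul_self a)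
  set b := star a * a
  have hb : (0 : Unitization ℂ A) ≤ (b : Unitization ℂ A) := by
    rw [Unitization.inr_mul, Unitization.inr_star]
    exact star_mul_self_nonneg _
  have e1 : ‖(b : Unitization ℂ A) - (‖b‖ : ℂ) • (1 : Unitization ℂ A)‖ ≤ ‖b‖ := by
    have h2 : (b : Unitization ℂ A) ≤ (‖b‖ : ℂ) • (1 : Unitization ℂ A) := by
      have := (CStarAlgebra.norm_le_iff_le_algebraMap (b : Unitization ℂ A) (norm_nonneg b) hb).1
        (Unitization.norm_inr b).le
      rwa [Algebra.algebraMap_eq_smul_one] at this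
    rw [norm_sub_rev]
    have h3 := CStarAlgebra.norm_le_norm_of_nonneg_of_le (sub_nonneg.2 h2) (sub_le_self _ hb)
    refine h3.trans ?_
    rw [norm_smul, norm_one, mul_one, Complex.norm_real, norm_norm]
  have e2 := (norm_apply_sub_le hφ hk h1 b ‖b‖).trans e1
  have e3 := (Complex.abs_re_le_norm _).trans e2
  rw [Complex.sub_re, Complex.ofReal_re] at e3
  refine Complex.le_def.2 ⟨?_, him.symm⟩
  have := (abs_le.1 e3).1
  simp only [Complex.zero_re]
  linarith

theorem toWeakDual_mem_stateSpace : StrongDual.toWeakDual φ ∈ stateSpace A := by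
  refine ⟨fun a => apply_star_mul_self_nonneg hφ hk h1 a, le_antisymm hφ ?_⟩
  have := φ.le_opNorm (star k * k)
  rw [h1, norm_one, CStarRing.norm_star_mul_self] at this
  calc 1 ≤ ‖φ‖ * (‖k‖ * ‖k‖) := this
    _ ≤ ‖φ‖ * 1 := by gcongr; exact mul_le_one₀ hk (norm_nonneg _) hk
    _ = ‖φ‖ := mul_one _

end NonUnital

end Norms

/-! ### States supported on a compact subset of the spectrum -/

section States

variable {A : Type*} [NonUnitalCStarAlgebra A] {M : NonUnitalStarSubalgebra ℂ A}
  {K : Set (Spec M)}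

theorem exists_norm_le_one_extension (N : NonUnitalStarSubalgebra ℂ A) (x : StrongDual ℂ N)
    (hx : ∀ n, ‖x n‖ ≤ ‖n‖) : ∃ φ : StrongDual ℂ A, ‖φ‖ ≤ 1 ∧ ∀ n : N, φ n = x n := by
  obtain ⟨g, hg, hn⟩ := exists_extension_norm_eq (𝕜 := ℂ)
    (N.toNonUnitalSubalgebra.toSubmodule : Submodule ℂ A) x
  exact ⟨g, hn.trans_le (ContinuousLinearMap.opNorm_le_bound _ zero_le_one
    fun n => by simpa using! hx n), hg⟩

theorem IsTopography.exists_star_mul_self_eq (hM : IsTopography M) {f : M}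
    (hf : f ∈ dominating M K) : ∃ k : A, ‖k‖ ≤ 1 ∧ star k * k = f := by
  obtain ⟨s, hs, hsf⟩ := hM.exists_mul_self_eq fun x => (hf.1 x).1
  have h : star (s : A) * s = f := by
    rw [← hsf]
    exact congrArg (fun t : M => (t : A) * s) hs.star_eq
  refine ⟨s, ?_, h⟩
  have := hM.norm_le_one_of_dominating hf
  rw [← h, CStarRing.norm_star_mul_self] at this
  nlinarith [norm_nonneg (s : A)]

theorem eq_one_of_one_le {z : ℂ} (h : 1 ≤ z) (h1 : ‖z‖ ≤ 1) : z = 1 := by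
  obtain ⟨a, b⟩ := Complex.le_def.1 h
  refine Complex.ext (le_antisymm ((Complex.re_le_norm z).trans h1) a) b.symm

namespace IsTopography

variable (hM : IsTopography M)
include hM

/-- Positivity makes φ decrease along the net, so φ(f) ≥ φ(1_K) = 1 for each f. Conversely a
contractive functional with value 1 at one such f is automatically a state. The right-hand side is
weak* closed, whence the compactness of `statesOn`. -/
theorem mem_statesOn (hK : IsCompact K) {φ : WeakDual ℂ A} :
    φ ∈ statesOn M K ↔ ‖WeakDual.toStrongDual φ‖ ≤ 1 ∧ ∀ f ∈ dominating M K, φ (f : A) = 1 := by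
  have hne := hM.dominating_nonempty hK
  have := decreasingTo_neBot hne
  have hlim := hM.tendsto_indicator hne (WeakDual.toStrongDual φ)
  constructor
  · rintro ⟨⟨hpos, hnorm⟩, hφ⟩
    refine ⟨hnorm.le, fun f₀ hf₀ => eq_one_of_one_le ?_ ?_⟩
    · change indicator M K (WeakDual.toStrongDual φ) = 1 at hφ
      rw [hφ] at hlim
      refine le_of_tendsto hlim ?_
      filter_upwards [(hasBasis_decreasingTo hne).mem_of_mem hf₀] with f hf
      obtain ⟨s, hs, hsf⟩ := hM.exists_mul_self_eq (f := f₀ - f) fun x => by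
        rw [map_sub]; exact sub_nonneg.2 (hf.2 x)
      have h1 := hpos (s : A)
      have h2 : star (s : A) * s = f₀ - f := by
        rw [← NonUnitalStarSubalgebra.coe_sub, ← hsf]
        exact congrArg (fun t : M => (t : A) * s) hs.star_eq
      rw [h2, map_sub, sub_nonneg] at h1
      exact h1
    · have := (WeakDual.toStrongDual φ).le_opNorm_of_le (hM.norm_le_one_of_dominating hf₀)
      rw [hnorm, one_mul] at this
      exact this
  · rintro ⟨hnorm, hφ⟩
    refine ⟨?_, ?_⟩
    · obtain ⟨k, hk, hkf⟩ := hM.exists_star_mul_self_eq hne.some_mem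
      exact toWeakDual_mem_stateSpace hnorm hk (by rw [hkf]; exact hφ _ hne.some_mem)
    · refine tendsto_nhds_unique hlim (tendsto_const_nhds.congr' ?_)
      filter_upwards [dominating_mem_decreasingTo hne] with f hf
      exact (hφ f hf).symm

theorem statesOn_mono (hK : IsCompact K) {K' : Set (Spec M)} (hK' : IsCompact K') (h : K ⊆ K') :
    statesOn M K ⊆ statesOn M K' := fun φ hφ => by
  rw [hM.mem_statesOn hK] at hφ
  exact (hM.mem_statesOn hK').2 ⟨hφ.1, fun f hf => hφ.2 f (dominating_anti h hf)⟩

theorem isCompact_statesOn (hK : IsCompact K) : IsCompact (statesOn M K) := by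
  have h : statesOn M K = (WeakDual.toStrongDual ⁻¹' Metric.closedBall (0 : StrongDual ℂ A) 1) ∩
      ⋂ f ∈ dominating M K, {φ | φ (f : A) = 1} := by
    ext φ
    rw [hM.mem_statesOn hK]
    simp
  rw [h]
  exact (WeakDual.isCompact_closedBall 0 1).inter_right (isClosed_biInter fun f _ =>
    isClosed_eq (WeakDual.eval_continuous _) continuous_const)

section Apply

variable {φ : WeakDual ℂ A} (hK : IsCompact K) (hφ : φ ∈ statesOn M K) {f : M}
  (hf : f ∈ dominating M K)
include hK hφ hf

theorem statesOn_mul_left (a : A) : φ (f * a) = φ a := by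
  rw [hM.mem_statesOn hK] at hφ
  obtain ⟨k, hk, hkf⟩ := hM.exists_star_mul_self_eq hf
  have := apply_mul_left (φ := WeakDual.toStrongDual φ) hφ.1 hk (by rw [hkf]; exact hφ.2 f hf) a
  rwa [hkf] at this

theorem statesOn_mul_right (a : A) : φ (a * f) = φ a := by
  rw [hM.mem_statesOn hK] at hφ
  obtain ⟨k, hk, hkf⟩ := hM.exists_star_mul_self_eq hf
  have := apply_mul_right (φ := WeakDual.toStrongDual φ) hφ.1 hk (by rw [hkf]; exact hφ.2 f hf) a
  rwa [hkf] at this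

end Apply

/-- As soon as K' contains K, φ(1_K' a 1_K') = φ(a), so the quantity in `IsTame` is eventually zero.
Hence the Monge-Kantorovich metric metrizes the weak* topology on these states. -/
theorem isTame_statesOn (L : A → ℝ≥0∞) (hK : IsCompact K) : IsTame L M (statesOn M K) := by
  refine tendsto_const_nhds.congr' ?_
  filter_upwards [eventually_ge_atTop (⟨K, hK⟩ : TopologicalSpace.Compacts (Spec M))] with K' hK'
  symm
  simp only [ENNReal.iSup_eq_zero]
  intro φ hφ a _
  have hφ' := hM.statesOn_mono hK K'.isCompact hK' hφ
  have h : corner M (K' : Set (Spec M)) a (WeakDual.toStrongDual φ) = φ a :=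
    hM.corner_apply_eq (hM.dominating_nonempty K'.isCompact) fun f hf g hg =>
      (hM.statesOn_mul_right K'.isCompact hφ' hg _).trans
        (hM.statesOn_mul_left K'.isCompact hφ' hf _)
  rw [enorm_eq_zero]
  change φ a - corner M (K' : Set (Spec M)) a (WeakDual.toStrongDual φ) = 0
  rw [h, sub_self]

/-- Any Hahn-Banach extension of the character x works: it is contractive and equals 1 on the
functions that are 1 at x. -/
theorem exists_mem_statesOn_apply_eq (hK : IsCompact K) {x : Spec M} (hx : x ∈ K) :
    ∃ φ ∈ statesOn M K, ∀ m : M, φ (m : A) = x m := by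
  obtain ⟨φ, h1, h2⟩ := exists_norm_le_one_extension M (WeakDual.CharacterSpace.toCLM x)
    (hM.norm_apply_le x)
  exact ⟨StrongDual.toWeakDual φ, (hM.mem_statesOn hK).2 ⟨h1, fun f hf => (h2 f).trans (hf.2 x hx)⟩,
    h2⟩

/-- A self-adjoint element which is supported on `K` is normed by a state supported on `K`. -/
theorem exists_mem_statesOn_norm_eq (hK : IsCompact K) {d : A} (hd : IsSelfAdjoint d)
    (hd0 : d ≠ 0) (h : ∀ f ∈ dominating M K, (f : A) * d = d ∧ d * f = d) :
    ∃ φ ∈ statesOn M K, ‖φ d‖ = ‖d‖ := by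
  have := hd.isStarNormal
  let d' : NonUnitalStarAlgebra.elemental ℂ d := ⟨d, NonUnitalStarAlgebra.elemental.self_mem ℂ d⟩
  obtain ⟨x, hx⟩ := exists_character_norm_eq (m := d') fun h => hd0 (congrArg Subtype.val h)
  obtain ⟨φ, h1, h2⟩ := exists_norm_le_one_extension (NonUnitalStarAlgebra.elemental ℂ d)
    (WeakDual.CharacterSpace.toCLM x) (norm_character_apply_le x)
  have hn : (0 : ℝ) < ‖d‖ := norm_pos_iff.2 hd0
  -- The normalization of d provides a positive contraction k*k with φ(k*k) = 1.
  let k : A := ((‖d‖⁻¹ : ℝ) : ℂ) • d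
  have hk : ‖k‖ ≤ 1 := by
    rw [norm_smul, Complex.norm_real, norm_inv, norm_norm, inv_mul_cancel₀ hn.ne']
  have hkφ : φ (star k * k) = 1 := by
    have e : x (star d' * d') = ((‖d‖ ^ 2 : ℝ) : ℂ) := by
      rw [map_mul, character_star, Complex.star_def, Complex.conj_mul', hx]
      push_cast; rfl
    have e1 : φ (star d * d) = ((‖d‖ ^ 2 : ℝ) : ℂ) := (h2 (star d' * d')).trans e
    rw [star_smul, smul_mul_smul_comm, map_smul, e1, smul_eq_mul, Complex.star_def,
      Complex.conj_ofReal, ← Complex.ofReal_mul, ← Complex.ofReal_mul]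
    rw [show ‖d‖⁻¹ * ‖d‖⁻¹ * ‖d‖ ^ 2 = 1 by field_simp, Complex.ofReal_one]
  refine ⟨StrongDual.toWeakDual φ, (hM.mem_statesOn hK).2 ⟨h1, fun f hf => ?_⟩, ?_⟩
  -- As df = d, absorption gives φ(f) = φ(k*k f) = φ(k*k) = 1.
  · have e := apply_mul_left h1 hk hkφ (f : A)
    rw [mul_assoc, smul_mul_assoc, (h f hf).2, hkφ] at e
    exact e.symm
  · exact (congrArg norm (h2 d')).trans hx

theorem norm_le_of_forall_statesOn (hK : IsCompact K) {d : A} (hd : IsSelfAdjoint d)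
    (h : ∀ f ∈ dominating M K, (f : A) * d = d ∧ d * f = d) {C : ℝ} (hC : 0 ≤ C)
    (hφ : ∀ φ ∈ statesOn M K, ‖φ d‖ ≤ C) : ‖d‖ ≤ C := by
  by_cases hd0 : d = 0
  · simpa [hd0] using hC
  · obtain ⟨φ, h1, h2⟩ := hM.exists_mem_statesOn_norm_eq hK hd hd0 h
    exact h2 ▸ hφ φ h1

end IsTopography

end States

/-! ### The Monge-Kantorovich metric -/

section MongeKantorovich

theorem norm_sub_le_of_mongeKantorovich_le {X : Type*} [AddCommMonoid X] [Module ℂ X]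
    {L : X → ℝ≥0∞} (hL : ∀ (t : ℝ) (a : X), L ((t : ℂ) • a) = ENNReal.ofReal |t| * L a)
    {φ ψ : X → ℂ} (hφ : ∀ (c : ℂ) (a : X), φ (c • a) = c * φ a)
    (hψ : ∀ (c : ℂ) (a : X), ψ (c • a) = c * ψ a) {ε l : ℝ} (hε : 0 ≤ ε) (hl : 0 ≤ l)
    (h : mongeKantorovich L φ ψ ≤ ENNReal.ofReal ε) {a : X} (ha : L a ≤ ENNReal.ofReal l) :
    ‖φ a - ψ a‖ ≤ ε * l := by
  -- Since l may be 0, a is rescaled by some l' > l, and l' then tends to l.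
  have key : ∀ l' > l, ‖φ a - ψ a‖ ≤ ε * l' := by
    intro l' hl'
    have hl0 : 0 < l' := hl.trans_lt hl'
    have h1 : L (((l'⁻¹ : ℝ) : ℂ) • a) ≤ 1 := by
      rw [hL, abs_of_pos (inv_pos.2 hl0)]
      calc ENNReal.ofReal l'⁻¹ * L a ≤ ENNReal.ofReal l'⁻¹ * ENNReal.ofReal l' := by
            gcongr; exact ha.trans (ENNReal.ofReal_le_ofReal hl'.le)
        _ = 1 := by
            rw [← ENNReal.ofReal_mul (inv_pos.2 hl0).le, inv_mul_cancel₀ hl0.ne', ENNReal.ofReal_one]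
    have h2 : ‖φ (((l'⁻¹ : ℝ) : ℂ) • a) - ψ (((l'⁻¹ : ℝ) : ℂ) • a)‖ₑ ≤ ENNReal.ofReal ε :=
      (le_iSup₂ (f := fun (a : X) (_ : L a ≤ 1) => ‖φ a - ψ a‖ₑ) _ h1).trans h
    rw [hφ, hψ, ← mul_sub, ← ofReal_norm, ENNReal.ofReal_le_ofReal_iff hε, norm_mul,
      Complex.norm_real, Real.norm_of_nonneg (inv_pos.2 hl0).le, inv_mul_le_iff₀ hl0] at h2
    linarith
  refine le_of_forall_pos_le_add fun δ hδ => ?_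
  have h3 := key (l + δ / (ε + 1)) (lt_add_of_pos_right _ (by positivity))
  have h4 : ε * (δ / (ε + 1)) ≤ δ := by
    rw [mul_div_assoc', div_le_iff₀ (by positivity)]
    nlinarith
  linarith

theorem sigmaKantorovich_le {A : Type*} [NonUnitalCStarAlgebra A] {L : A → ℝ≥0∞}
    {M : NonUnitalStarSubalgebra ℂ A} {x y : M → ℂ} {φ ψ : WeakDual ℂ A}
    (hx : ∀ m : M, φ (m : A) = x m) (hy : ∀ m : M, ψ (m : A) = y m) :
    sigmaKantorovich L M x y ≤ mongeKantorovich L φ ψ := by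
  refine iSup₂_le fun m hm => ?_
  rw [← hx, ← hy]
  exact le_iSup₂ (f := fun (a : A) (_ : L a ≤ 1) => ‖φ a - ψ a‖ₑ) (m : A) hm

variable {A : Type*} [NonUnitalCStarAlgebra A] {L : A → ℝ≥0∞} {S : Set (WeakDual ℂ A)}

theorem Metrizes.tendsto (h : Metrizes L S) {ι : Type*} {l : Filter ι} {u : ι → WeakDual ℂ A}
    {φ : WeakDual ℂ A} (hu : ∀ᶠ i in l, u i ∈ S) (hφ : φ ∈ S) (hlim : Tendsto u l (𝓝 φ)) :
    Tendsto (fun i => mongeKantorovich L (u i) φ) l (𝓝 0) := by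
  classical
  obtain ⟨m, h1, h2⟩ := h
  let v : ι → S := fun i => if hi : u i ∈ S then ⟨u i, hi⟩ else ⟨φ, hφ⟩
  have hv : ∀ᶠ i in l, (v i : WeakDual ℂ A) = u i := by
    filter_upwards [hu] with i hi
    simp [v, hi]
  have hlim' : Tendsto v l (@nhds S instTopologicalSpaceSubtype ⟨φ, hφ⟩) :=
    tendsto_subtype_rng.2 (hlim.congr' (hv.mono fun _ hi => hi.symm))
  rw [← h2] at hlim'
  have h3 := (@tendsto_iff_edist_tendsto_0 S _ m.toPseudoEMetricSpace l v ⟨φ, hφ⟩).1 hlim'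
  refine h3.congr' ?_
  filter_upwards [hv] with i hi
  rw [h1, hi]

theorem Metrizes.exists_finite_net (h : Metrizes L S) (hS : IsCompact S) {ε : ℝ≥0∞} (hε : 0 < ε) :
    ∃ t : Set S, t.Finite ∧ ∀ φ ∈ S, ∃ ψ ∈ t, mongeKantorovich L φ (ψ : WeakDual ℂ A) < ε := by
  obtain ⟨m, h1, h2⟩ := h
  have hc : @CompactSpace S m.toUniformSpace.toTopologicalSpace := by
    rw [h2]; exact isCompact_iff_compactSpace.1 hS
  have htb : @TotallyBounded S m.toUniformSpace Set.univ :=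
    @IsCompact.totallyBounded S m.toUniformSpace _
      (@isCompact_univ S m.toUniformSpace.toTopologicalSpace hc)
  obtain ⟨t, ht, hcov⟩ := (@EMetric.totallyBounded_iff S m.toPseudoEMetricSpace _).1 htb ε hε
  refine ⟨t, ht, fun φ hφ => ?_⟩
  obtain ⟨ψ, hψ, hlt⟩ := Set.mem_iUnion₂.1 (hcov (Set.mem_univ ⟨φ, hφ⟩))
  refine ⟨ψ, hψ, ?_⟩
  have h3 : m.edist ⟨φ, hφ⟩ ψ < ε := hlt
  rwa [h1] at h3

end MongeKantorovich

/-! ### Consequences of metrization on the states supported on a compact set. -/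

section QLCMS

variable {A : Type*} [NonUnitalCStarAlgebra A] {L : A → ℝ≥0∞} {M : NonUnitalStarSubalgebra ℂ A}
  {K : Set (Spec M)}

namespace IsQLCMS

variable (hQ : IsQLCMS L M) (hK : IsCompact K)
include hQ hK

theorem metrizes_statesOn : Metrizes L (statesOn M K) :=
  hQ.metrizes _ (fun _ hφ => hφ.1) (hQ.topography.isTame_statesOn L hK)

/-- The states ψ + (φ - ψ)/(n + 1) converge weak* to ψ, so some of them are at distance less than 1
from ψ. The distance scales linearly along the segment, which bounds the distance of φ and ψ by n +
1. -/
theorem mongeKantorovich_lt_top {φ ψ : WeakDual ℂ A} (hφ : φ ∈ statesOn M K)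
    (hψ : ψ ∈ statesOn M K) : mongeKantorovich L φ ψ < ∞ := by
  have hM := hQ.topography
  let u : ℕ → WeakDual ℂ A := fun n => ψ + (((n : ℝ) + 1)⁻¹ : ℂ) • (φ - ψ)
  have hu : Tendsto u atTop (𝓝 ψ) := by
    have h1 : Tendsto (fun n : ℕ => (((n : ℝ) + 1)⁻¹ : ℂ)) atTop (𝓝 0) := by
      have h := (Complex.continuous_ofReal.tendsto 0).comp
        (tendsto_one_div_add_atTop_nhds_zero_nat (𝕜 := ℝ))
      rw [Complex.ofReal_zero] at h
      exact h.congr fun n => by simp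
    have h2 := (h1.smul_const (φ - ψ)).const_add ψ
    rwa [zero_smul, add_zero] at h2
  have hS : ∀ n, u n ∈ statesOn M K := by
    intro n
    have hφ' := (hM.mem_statesOn hK).1 hφ
    have hψ' := (hM.mem_statesOn hK).1 hψ
    refine (hM.mem_statesOn hK).2 ⟨?_, fun f hf => ?_⟩
    · have hn : (0 : ℝ) < (n : ℝ) + 1 := by positivity
      have h1 : ((n : ℝ) + 1)⁻¹ ≤ 1 := inv_le_one_of_one_le₀ (by linarith [n.cast_nonneg (α := ℝ)])
      have e : WeakDual.toStrongDual (u n) =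
          ((1 - ((n : ℝ) + 1)⁻¹ : ℝ) : ℂ) • WeakDual.toStrongDual ψ +
          ((((n : ℝ) + 1)⁻¹ : ℝ) : ℂ) • WeakDual.toStrongDual φ := by
        ext a
        change ψ a + (((n : ℝ) + 1)⁻¹ : ℂ) * (φ a - ψ a) =
          ((1 - ((n : ℝ) + 1)⁻¹ : ℝ) : ℂ) * ψ a + ((((n : ℝ) + 1)⁻¹ : ℝ) : ℂ) * φ a
        push_cast; ring
      rw [e]
      refine (norm_add_le _ _).trans ?_
      rw [norm_smul, norm_smul, Complex.norm_real, Complex.norm_real,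
        Real.norm_of_nonneg (sub_nonneg.2 h1), Real.norm_of_nonneg (inv_pos.2 hn).le]
      nlinarith [mul_le_mul_of_nonneg_left hφ'.1 (inv_pos.2 hn).le,
        mul_le_mul_of_nonneg_left hψ'.1 (sub_nonneg.2 h1)]
    · change ψ f + (((n : ℝ) + 1)⁻¹ : ℂ) * (φ f - ψ f) = 1
      rw [hφ'.2 f hf, hψ'.2 f hf]; ring
  have hlim := (hQ.metrizes_statesOn hK).tendsto (Eventually.of_forall hS) hψ hu
  obtain ⟨n, hn⟩ := (hlim.eventually_lt_const zero_lt_one).exists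
  refine lt_of_le_of_lt (b := ENNReal.ofReal ((n : ℝ) + 1)) (iSup₂_le fun a ha => ?_)
    ENNReal.ofReal_lt_top
  have h1 : ‖u n a - ψ a‖ₑ ≤ 1 :=
    (le_iSup₂ (f := fun (a : A) (_ : L a ≤ 1) => ‖u n a - ψ a‖ₑ) a ha).trans hn.le
  have e : u n a - ψ a = (((n : ℝ) + 1)⁻¹ : ℂ) * (φ a - ψ a) := by
    change ψ a + (((n : ℝ) + 1)⁻¹ : ℂ) * (φ a - ψ a) - ψ a = _
    ring
  have hn0 : (0 : ℝ) < (n : ℝ) + 1 := by positivity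
  have h2 : ‖(((n : ℝ) + 1)⁻¹ : ℂ)‖ = ((n : ℝ) + 1)⁻¹ := by
    rw [← Complex.ofReal_one, ← Complex.ofReal_add, ← Complex.ofReal_inv, Complex.norm_real,
      Real.norm_of_nonneg (inv_pos.2 hn0).le]
  rw [e, ← ofReal_norm, ← ENNReal.ofReal_one, ENNReal.ofReal_le_ofReal_iff zero_le_one, norm_mul, h2,
    inv_mul_le_iff₀ hn0, mul_one] at h1
  rw [← ofReal_norm]
  exact ENNReal.ofReal_le_ofReal h1

/-- Characters in K are extended to states supported on K, a compact set which the metric metrizes.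
A limit of the extensions restricts to the limit character y, and restriction to `M` does not
increase distances. -/
theorem exists_tendsto_sigmaKantorovich (U : Ultrafilter (Spec M)) (hU : K ∈ U) :
    ∃ y ∈ K, Tendsto (fun x : Spec M => sigmaKantorovich L M x y) U (𝓝 0) := by
  have hM := hQ.topography
  obtain ⟨y, hy, hUy⟩ := hK.ultrafilter_le_nhds U (le_principal_iff.2 hU)
  have hE : ∀ x : Spec M, ∃ φ : WeakDual ℂ A, x ∈ K → φ ∈ statesOn M K ∧
      ∀ m : M, φ (m : A) = x m := by
    intro x
    by_cases hx : x ∈ K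
    · obtain ⟨φ, h1, h2⟩ := hM.exists_mem_statesOn_apply_eq hK hx
      exact ⟨φ, fun _ => ⟨h1, h2⟩⟩
    · exact ⟨0, fun h => absurd h hx⟩
  choose E hE using hE
  have hES : ∀ᶠ x in (U : Filter (Spec M)), E x ∈ statesOn M K := by
    filter_upwards [hU] with x hx using (hE x hx).1
  obtain ⟨φ, hφ, hUφ⟩ := (hM.isCompact_statesOn hK).ultrafilter_le_nhds (U.map E)
    (le_principal_iff.2 hES)
  have hUφ' : Tendsto E U (𝓝 φ) := hUφ
  have hφy : ∀ m : M, φ (m : A) = y m := by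
    intro m
    have h1 : Tendsto (fun x => E x (m : A)) U (𝓝 (φ (m : A))) :=
      ((WeakDual.eval_continuous (m : A)).tendsto φ).comp hUφ'
    refine tendsto_nhds_unique (h1.congr' ?_) (((continuous_spec_apply m).tendsto y).mono_left hUy)
    filter_upwards [hU] with x hx using (hE x hx).2 m
  refine ⟨y, hy, ?_⟩
  have h := (hQ.metrizes_statesOn hK).tendsto (l := U) (u := E) hES hφ hUφ'
  refine tendsto_of_tendsto_of_tendsto_of_le_of_le' tendsto_const_nhds h
    (Eventually.of_forall fun _ => zero_le) ?_
  filter_upwards [hU] with x hx using sigmaKantorovich_le (hE x hx).2 hφy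

theorem isCompact_sigma (m : MetricSpace (Spec M))
    (hm : ∀ x y : Spec M, m.edist x y = sigmaKantorovich L M x y) :
    @IsCompact (Spec M) m.toUniformSpace.toTopologicalSpace K := by
  refine (@isCompact_iff_ultrafilter_le_nhds' (Spec M) m.toUniformSpace.toTopologicalSpace K).2
    fun U hU => ?_
  obtain ⟨y, hy, hlim⟩ := hQ.exists_tendsto_sigmaKantorovich hK U hU
  refine ⟨y, hy, ?_⟩
  refine (@tendsto_iff_edist_tendsto_0 (Spec M) _ m.toPseudoMetricSpace.toPseudoEMetricSpace U id
    y).2 (hlim.congr fun x => (hm x y).symm)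

end IsQLCMS

end QLCMS

/-! ### Strongly proper quantum metric spaces -/

section StronglyProper

variable {A : Type*} [NonUnitalCStarAlgebra A] {L : A → ℝ≥0∞} {M : NonUnitalStarSubalgebra ℂ A}

theorem saRestrict_of_isSelfAdjoint {a : A} (ha : IsSelfAdjoint a) : saRestrict L a = L a :=
  if_pos ha

theorem isSelfAdjoint_of_saRestrict_lt_top {a : A} (h : saRestrict L a < ∞) : IsSelfAdjoint a := by
  by_contra ha
  simp [saRestrict, ha] at h

/-- In the weak* compact unit ball, the only multiplicative functional missing from the spectrum is
0, and the closed condition |x(m)| ≥ c > 0 excludes it. -/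
theorem IsTopography.isCompact_setOf_le_norm_apply (hM : IsTopography M) (m : M) {c : ℝ}
    (hc : 0 < c) : IsCompact {x : Spec M | c ≤ ‖x m‖} := by
  rw [Topology.IsEmbedding.subtypeVal.isCompact_iff]
  have h : (Subtype.val '' {x : Spec M | c ≤ ‖x m‖} : Set (WeakDual ℂ M)) =
      (WeakDual.toStrongDual ⁻¹' Metric.closedBall (0 : StrongDual ℂ M) 1) ∩
      ({φ | ∀ a b : M, φ (a * b) = φ a * φ b} ∩ {φ | c ≤ ‖φ m‖}) := by
    ext φ
    constructor
    · rintro ⟨x, hx, rfl⟩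
      refine ⟨?_, x.2.2, hx⟩
      simp only [Set.mem_preimage]
      exact ContinuousLinearMap.opNorm_le_bound _ zero_le_one fun n => by
        simpa using! hM.norm_apply_le x n
    · rintro ⟨-, h1, h2⟩
      refine ⟨⟨φ, fun h0 => ?_, h1⟩, h2, rfl⟩
      have h3 : c ≤ ‖φ m‖ := h2
      have h4 : φ m = 0 := by rw [h0]; rfl
      rw [h4, norm_zero] at h3
      exact h3.not_gt hc
  rw [h]
  refine (WeakDual.isCompact_closedBall 0 1).inter_right (IsClosed.inter ?_ ?_)
  · simp only [Set.ofPred_forall]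
    exact isClosed_iInter fun a => isClosed_iInter fun b => isClosed_eq (WeakDual.eval_continuous _)
      ((WeakDual.eval_continuous _).mul (WeakDual.eval_continuous _))
  · exact isClosed_le continuous_const (WeakDual.eval_continuous _).norm

theorem sigmaKantorovich_self (x : M → ℂ) : sigmaKantorovich L M x x = 0 := by
  simp [sigmaKantorovich, mongeKantorovich]

theorem sigmaKantorovich_comm (x y : M → ℂ) :
    sigmaKantorovich L M x y = sigmaKantorovich L M y x := by
  unfold sigmaKantorovich mongeKantorovich
  refine iSup_congr fun m => iSup_congr fun _ => ?_
  rw [← neg_sub, enorm_neg]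

theorem sigmaKantorovich_triangle (x y z : M → ℂ) :
    sigmaKantorovich L M x z ≤ sigmaKantorovich L M x y + sigmaKantorovich L M y z := by
  refine iSup₂_le fun m hm => ?_
  calc ‖x m - z m‖ₑ = ‖(x m - y m) + (y m - z m)‖ₑ := by rw [sub_add_sub_cancel]
    _ ≤ ‖x m - y m‖ₑ + ‖y m - z m‖ₑ := enorm_add_le _ _
    _ ≤ _ := add_le_add
        (le_iSup₂ (f := fun (a : M) (_ : L a ≤ 1) => ‖x a - y a‖ₑ) m hm)
        (le_iSup₂ (f := fun (a : M) (_ : L a ≤ 1) => ‖y a - z a‖ₑ) m hm)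

theorem IsLipschitzPair.norm_sub_le (hL : IsLipschitzPair L) {φ ψ : WeakDual ℂ A} {ε l : ℝ}
    (hε : 0 ≤ ε) (hl : 0 ≤ l) (h : mongeKantorovich L φ ψ ≤ ENNReal.ofReal ε) {a : A}
    (ha : L a ≤ ENNReal.ofReal l) : ‖φ a - ψ a‖ ≤ ε * l :=
  norm_sub_le_of_mongeKantorovich_le hL.smul (map_smul φ) (map_smul ψ) hε hl h ha

theorem IsLipschitzPair.norm_spec_sub_le (hL : IsLipschitzPair L) {x y : Spec M} {ε l : ℝ}
    (hε : 0 ≤ ε) (hl : 0 ≤ l) (h : sigmaKantorovich L M x y ≤ ENNReal.ofReal ε) {m : M}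
    (hm : L m ≤ ENNReal.ofReal l) : ‖x m - y m‖ ≤ ε * l :=
  norm_sub_le_of_mongeKantorovich_le (L := fun m : M => L m) (fun t m => hL.smul t m) (map_smul x)
    (map_smul y) hε hl h hm

theorem IsLipschitzPair.isSelfAdjoint (hL : IsLipschitzPair L) {a : A} (h : L a < ∞) :
    IsSelfAdjoint a := by
  by_contra ha
  exact h.ne (hL.eq_top a ha)

/-- A closed subspace of a topography which contains a dense set of self-adjoint elements of the
topography is the whole topography. -/
theorem mem_of_dense {S : Set A} (hd : ∀ m ∈ M, IsSelfAdjoint m → m ∈ closure (S ∩ (M : Set A)))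
    {T : Submodule ℂ M} (hT : IsClosed (T : Set M)) (h : ∀ m : M, (m : A) ∈ S → m ∈ T) (m : M) :
    m ∈ T := by
  have hsa : ∀ m : M, IsSelfAdjoint m → m ∈ T := by
    intro m hm
    have h1 : m ∈ closure {b : M | (b : A) ∈ S} := by
      rw [closure_subtype]
      refine closure_mono ?_ (hd m m.2 (congrArg Subtype.val hm.star_eq))
      rintro b ⟨hb, hb'⟩
      exact ⟨⟨b, hb'⟩, hb, rfl⟩
    exact closure_minimal (t := (T : Set M)) (fun b hb => h b hb) hT h1
  have h1 := hsa _ (IsSelfAdjoint.add_star_self m)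
  have h2 := hsa _ (show IsSelfAdjoint (Complex.I • (m - star m)) by
    rw [isSelfAdjoint_iff, star_smul, star_sub, star_star, Complex.star_def, Complex.conj_I, neg_smul,
      ← smul_neg, neg_sub])
  have h3 := T.smul_mem (1 / 2 : ℂ) (T.add_mem h1 (T.smul_mem (-Complex.I) h2))
  have e : (1 / 2 : ℂ) • (m + star m + -Complex.I • Complex.I • (m - star m)) = m := by
    rw [smul_smul, neg_mul, Complex.I_mul_I, neg_neg, one_smul, add_add_sub_cancel, ← two_smul ℂ m,
      smul_smul]
    norm_num
  rwa [e] at h3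

theorem spec_eq_of_dense {S : Set A}
    (hd : ∀ m ∈ M, IsSelfAdjoint m → m ∈ closure (S ∩ (M : Set A))) {x y : StrongDual ℂ M}
    (h : ∀ m : M, (m : A) ∈ S → x m = y m) : x = y :=
  ContinuousLinearMap.ext fun m =>
    mem_of_dense hd (T := LinearMap.eqLocus (x : M →ₗ[ℂ] ℂ) (y : M →ₗ[ℂ] ℂ))
      (isClosed_eq x.continuous y.continuous) h m

theorem mul_mul_mem_locStar (hM : IsTopography M) {L' : A → ℝ≥0∞} {e a : A}
    (he : e ∈ LocStar L' M) (ha : IsSelfAdjoint a) (h : L' (e * a * e) < ∞) :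
    e * a * e ∈ LocStar L' M := by
  obtain ⟨K, hK⟩ := Set.mem_iUnion.1 he
  rw [hM.mem_Loc K.isCompact] at hK
  refine Set.mem_iUnion.2 ⟨K, (hM.mem_Loc K.isCompact).2 ⟨?_, fun f hf => ⟨?_, ?_⟩, h⟩⟩
  · rw [isSelfAdjoint_iff, star_mul, star_mul, hK.1.star_eq, ha.star_eq, mul_assoc]
  · rw [← mul_assoc, ← mul_assoc, (hK.2.1 f hf).1]
  · rw [mul_assoc, (hK.2.1 f hf).2]

theorem tendsto_mul_mul {e : ℕ → A} (he : (atTop.map e).IsApproximateUnit)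
    (he1 : ∀ n, ‖e n‖ ≤ 1) (a : A) : Tendsto (fun n => e n * a * e n) atTop (𝓝 a) := by
  have h1 : Tendsto (fun n => a * e n) atTop (𝓝 a) := he.tendsto_mul_left a
  have h2 : Tendsto (fun n => e n * a) atTop (𝓝 a) := he.tendsto_mul_right a
  rw [tendsto_iff_norm_sub_tendsto_zero] at h1 h2 ⊢
  refine squeeze_zero (fun _ => norm_nonneg _) (fun n => ?_) (by simpa using h1.add h2)
  calc ‖e n * a * e n - a‖ = ‖e n * (a * e n - a) + (e n * a - a)‖ := by
        rw [mul_sub, ← mul_assoc]; abel_nf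
    _ ≤ ‖e n‖ * ‖a * e n - a‖ + ‖e n * a - a‖ :=
        (norm_add_le _ _).trans (by gcongr; exact norm_mul_le _ _)
    _ ≤ 1 * ‖a * e n - a‖ + ‖e n * a - a‖ := by gcongr; exact he1 n
    _ = _ := by rw [one_mul]

theorem tendsto_spec_apply {e : ℕ → A} (he : (atTop.map e).IsApproximateUnit)
    (hen : ∀ n, e n ∈ M) (x : Spec M) :
    Tendsto (fun n => x ⟨e n, hen n⟩) atTop (𝓝 1) := by
  obtain ⟨m, hm⟩ : ∃ m : M, x m ≠ 0 := by
    by_contra! hc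
    exact x.2.1 (ContinuousLinearMap.ext hc)
  have h1 : Tendsto (fun n => m * ⟨e n, hen n⟩) atTop (𝓝 m) :=
    tendsto_subtype_rng.2 (he.tendsto_mul_left (m : A))
  have h2 := ((map_continuous x).tendsto m).comp h1
  have h3 := h2.const_mul (x m)⁻¹
  rw [inv_mul_cancel₀ hm] at h3
  refine h3.congr fun n => ?_
  rw [Function.comp_apply, map_mul, inv_mul_cancel_left₀ hm]

namespace IsStronglyProper

variable (h : TopographicPropinquity.IsStronglyProper L M)
include h

/-- The product rule is applied to ea, which need not be self-adjoint; this is where a seminorm on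
all of `A` is needed. With L(e_n) → 0 it gives limsup L(e_n a e_n) ≤ L(a). -/
theorem apply_mul_mul_le {e : A} (he : ‖e‖ ≤ 1) (a : A) :
    L (e * a * e) ≤ L a + 2 * (‖a‖ₑ * L e) := by
  have he' : ‖e‖ₑ ≤ 1 := by
    rw [← ofReal_norm, ← ENNReal.ofReal_one]; exact ENNReal.ofReal_le_ofReal he
  have hea : ‖e * a‖ₑ ≤ ‖a‖ₑ := by
    rw [← ofReal_norm, ← ofReal_norm]
    refine ENNReal.ofReal_le_ofReal ((norm_mul_le _ _).trans ?_)
    exact mul_le_of_le_one_left (norm_nonneg _) he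
  calc L (e * a * e) ≤ ‖e * a‖ₑ * L e + ‖e‖ₑ * L (e * a) := h.leibniz _ _
    _ ≤ ‖a‖ₑ * L e + 1 * (1 * L a + ‖a‖ₑ * L e) := by
        gcongr
        refine (h.leibniz e a).trans ?_
        gcongr
    _ = L a + 2 * (‖a‖ₑ * L e) := by ring

/-- The sequence is e_n a e_n. `apply_mul_mul_le` bounds its seminorms from above, lower
semicontinuity bounds them from below, and it stays in `M` when a does. -/
theorem exists_approximation {a : A} (ha : IsSelfAdjoint a) (hLa : L a < ∞) :
    ∃ s : ℕ → A, (∀ n, s n ∈ LocStar (saRestrict L) M) ∧ Tendsto s atTop (𝓝 a) ∧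
      Tendsto (fun n => L (s n)) atTop (𝓝 (L a)) ∧ (a ∈ M → ∀ n, s n ∈ M) := by
  have hM := h.isQLCMS.topography
  obtain ⟨e, he, hen, heL⟩ := h.exists_approximateUnit
  have hlim := tendsto_mul_mul he (fun n => (hen n).2.2.1) a
  have hle (n : ℕ) := h.apply_mul_mul_le (hen n).2.2.1 a
  have hup : Tendsto (fun n => L a + 2 * (‖a‖ₑ * L (e n))) atTop (𝓝 (L a)) := by
    have h1 := ENNReal.Tendsto.const_mul (a := ‖a‖ₑ) heL (Or.inr enorm_ne_top)
    have h2 := ENNReal.Tendsto.const_mul (a := 2) h1 (Or.inr (by simp))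
    simpa using h2.const_add (L a)
  refine ⟨fun n => e n * a * e n, fun n => ?_, hlim, ?_, fun haM n => ?_⟩
  · have hsa : IsSelfAdjoint (e n * a * e n) := by
      rw [isSelfAdjoint_iff, star_mul, star_mul, (hen n).2.1.star_eq, ha.star_eq, mul_assoc]
    refine mul_mul_mem_locStar hM (hen n).2.2.2 ha ?_
    rw [saRestrict_of_isSelfAdjoint hsa]
    obtain ⟨K, hK⟩ := Set.mem_iUnion.1 (hen n).2.2.2
    have hf := hK.2.2
    rw [saRestrict_of_isSelfAdjoint (hen n).2.1] at hf
    refine (hle n).trans_lt (ENNReal.add_lt_top.2 ⟨hLa, ?_⟩)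
    exact ENNReal.mul_lt_top (by simp) (ENNReal.mul_lt_top enorm_lt_top hf)
  · refine tendsto_order.2 ⟨fun c hc => hlim.eventually (h.lowerSemicontinuous a c hc),
      fun c hc => ?_⟩
    filter_upwards [hup.eventually_lt_const hc] with n hn using (hle n).trans_lt hn
  · exact mul_mem (mul_mem (hen n).1 haM) (hen n).1

theorem nonempty_spec [Nontrivial A] : Nonempty (Spec M) := by
  by_contra hempty
  rw [not_nonempty_iff] at hempty
  have hM := h.isQLCMS.topography
  obtain ⟨e, he, hen, -⟩ := h.exists_approximateUnit
  have h0 (n : ℕ) : e n = 0 :=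
    congrArg Subtype.val (hM.ext (m := ⟨e n, (hen n).1⟩) (m' := 0) fun x => hempty.elim x)
  obtain ⟨a, ha⟩ := exists_ne (0 : A)
  have h1 : Tendsto (fun n => a * e n) atTop (𝓝 a) := he.tendsto_mul_left a
  simp only [h0, mul_zero] at h1
  exact ha (tendsto_nhds_unique h1 tendsto_const_nhds)

/-- Choose n with |x(e_n)| > 3/4 and L(e_n) < 1/(4(r + 1)). A character within r of x changes the
value at e_n by at most 1/4, so |y(e_n)| ≥ 1/2, which defines a compact set. -/
theorem exists_isCompact_ball_subset (x : Spec M) {r : ℝ} (hr : 0 ≤ r) :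
    ∃ C : Set (Spec M), IsCompact C ∧
      ∀ y : Spec M, sigmaKantorovich (saRestrict L) M y x ≤ ENNReal.ofReal r → y ∈ C := by
  have hM := h.isQLCMS.topography
  obtain ⟨e, he, hen, heL⟩ := h.exists_approximateUnit
  have h1 := (tendsto_spec_apply he (fun n => (hen n).1) x).norm
  rw [norm_one] at h1
  have hδ : (0 : ℝ) < 1 / (4 * (r + 1)) := by positivity
  obtain ⟨n, hn1, hn2⟩ := ((h1.eventually_const_lt (show (3 / 4 : ℝ) < 1 by norm_num)).and
    (heL.eventually_lt_const (ENNReal.ofReal_pos.2 hδ))).exists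
  refine ⟨_, hM.isCompact_setOf_le_norm_apply ⟨e n, (hen n).1⟩ (one_half_pos (α := ℝ)),
    fun y hy => ?_⟩
  have h2 := h.isQLCMS.lipschitzPair.norm_spec_sub_le hr hδ.le hy (m := ⟨e n, (hen n).1⟩)
    (by rw [saRestrict_of_isSelfAdjoint (hen n).2.1]; exact hn2.le)
  have h3 : r * (1 / (4 * (r + 1))) ≤ 1 / 4 := by
    rw [mul_one_div, div_le_div_iff₀ (by positivity) (by norm_num)]
    linarith
  have h4 := norm_sub_norm_le (x ⟨e n, (hen n).1⟩) (y ⟨e n, (hen n).1⟩)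
  rw [norm_sub_rev] at h4
  change 1 / 2 ≤ ‖y ⟨e n, (hen n).1⟩‖
  linarith

/-- The distance of x and y is finite because {x, y} is compact, and it separates points because the
space is standard. Closed balls are closed subsets of compact sets. -/
theorem hasProperSpectrum : HasProperSpectrum (saRestrict L) M := by
  have hM := h.isQLCMS.topography
  have hL := h.isQLCMS.lipschitzPair
  have hfin (x y : Spec M) : sigmaKantorovich (saRestrict L) M x y ≠ ∞ := by
    have hK : IsCompact ({x, y} : Set (Spec M)) := (Set.toFinite _).isCompact
    obtain ⟨φ, hφ, hφx⟩ := hM.exists_mem_statesOn_apply_eq hK (x := x) (by simp)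
    obtain ⟨ψ, hψ, hψy⟩ := hM.exists_mem_statesOn_apply_eq hK (x := y) (by simp)
    exact ((sigmaKantorovich_le hφx hψy).trans_lt
      (h.isQLCMS.mongeKantorovich_lt_top hK hφ hψ)).ne
  let em : EMetricSpace (Spec M) :=
    { edist := fun x y => sigmaKantorovich (saRestrict L) M x y
      edist_self := fun x => sigmaKantorovich_self x
      edist_comm := fun x y => sigmaKantorovich_comm x y
      edist_triangle := fun x y z => sigmaKantorovich_triangle x y z
      eq_of_edist_eq_zero := fun {x y} hxy => by
        refine Subtype.ext (spec_eq_of_dense (S := {b | saRestrict L b < ∞}) (fun m hm hm' => ?_)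
          (x := WeakDual.CharacterSpace.toCLM x) (y := WeakDual.CharacterSpace.toCLM y) fun m hm => ?_)
        · rw [Set.inter_comm]
          exact h.isStandard m hm hm'
        have hxy' : sigmaKantorovich (saRestrict L) M x y = 0 := hxy
        have := hL.norm_spec_sub_le le_rfl ENNReal.toReal_nonneg (by rw [hxy']; exact zero_le)
          (ENNReal.ofReal_toReal hm.ne).ge
        rw [zero_mul, norm_le_zero_iff, sub_eq_zero] at this
        exact this }
  let m : MetricSpace (Spec M) := @EMetricSpace.toMetricSpace (Spec M) em hfin
  have hm (x y : Spec M) : m.edist x y = sigmaKantorovich (saRestrict L) M x y := rfl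
  refine ⟨m, hm, @ProperSpace.mk (Spec M) m.toPseudoMetricSpace fun x r => ?_⟩
  -- The radius r may be negative, hence `max r 0`.
  obtain ⟨C, hC, hball⟩ := h.exists_isCompact_ball_subset x (le_max_right r 0)
  refine @IsCompact.of_isClosed_subset (Spec M) m.toUniformSpace.toTopologicalSpace _ _
    (h.isQLCMS.isCompact_sigma hC m hm) (@Metric.isClosed_closedBall _ m.toPseudoMetricSpace _ _)
    fun y hy => hball y ?_
  rw [← hm]
  have h1 : m.dist y x ≤ r := hy
  have h2 : m.edist y x = ENNReal.ofReal (m.dist y x) := m.edist_dist y x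
  rw [h2]
  exact ENNReal.ofReal_le_ofReal (h1.trans (le_max_left _ _))

theorem leibnizOn : LeibnizOn (saRestrict L) {a | IsSelfAdjoint a} := by
  intro a ha b hb
  have ha' : star a = a := ha
  have hb' : star b = b := hb
  have key (c : ℂ) (hc : ‖c‖ = 1 / 2) (x y : A) (hx : L x ≤ ‖a‖ₑ * L b + L a * ‖b‖ₑ)
      (hy : L y ≤ ‖a‖ₑ * L b + L a * ‖b‖ₑ) : L (c • (x + y)) ≤ ‖a‖ₑ * L b + L a * ‖b‖ₑ := by
    have hc' : ‖c‖ₑ * 2 = 1 := by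
      rw [← ofReal_norm, hc, ← ENNReal.ofReal_ofNat, ← ENNReal.ofReal_mul (by norm_num)]
      norm_num
    calc L (c • (x + y)) = ‖c‖ₑ * L (x + y) := h.smul _ _
      _ ≤ ‖c‖ₑ * ((‖a‖ₑ * L b + L a * ‖b‖ₑ) + (‖a‖ₑ * L b + L a * ‖b‖ₑ)) := by
          gcongr; exact (h.add_le _ _).trans (add_le_add hx hy)
      _ = ‖c‖ₑ * 2 * (‖a‖ₑ * L b + L a * ‖b‖ₑ) := by ring
      _ = _ := by rw [hc', one_mul]
  have hab : L (a * b) ≤ ‖a‖ₑ * L b + L a * ‖b‖ₑ :=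
    (h.leibniz a b).trans_eq (by rw [mul_comm ‖b‖ₑ])
  have hba : L (b * a) ≤ ‖a‖ₑ * L b + L a * ‖b‖ₑ :=
    (h.leibniz b a).trans_eq (by rw [add_comm, mul_comm ‖b‖ₑ])
  rw [saRestrict_of_isSelfAdjoint ha, saRestrict_of_isSelfAdjoint hb]
  constructor
  · rw [saRestrict_of_isSelfAdjoint]
    · exact key _ (by simp) _ _ hab hba
    · rw [isSelfAdjoint_iff, star_smul, star_add, star_mul, star_mul, ha', hb', add_comm]
      simp
  · rw [saRestrict_of_isSelfAdjoint]
    · rw [sub_eq_add_neg]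
      refine key _ (by simp) _ _ hab ?_
      have := h.smul (-1) (b * a)
      rw [neg_one_smul, enorm_neg, enorm_one, one_mul] at this
      rw [this]
      exact hba
    · rw [isSelfAdjoint_iff, star_smul, star_sub, star_mul, star_mul, ha', hb', ← neg_sub, smul_neg,
        ← neg_smul]
      congr 1
      simp

theorem isProperQMS : IsProperQMS (saRestrict L) M where
  isQLCMS := h.isQLCMS
  separable := h.separable
  leibniz := h.leibnizOn
  lowerSemicontinuous := by
    intro a c hc
    by_cases ha : IsSelfAdjoint a
    · rw [saRestrict_of_isSelfAdjoint ha] at hc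
      filter_upwards [h.lowerSemicontinuous a c hc] with b hb
      unfold saRestrict
      split_ifs
      · exact hb
      · exact hb.trans_le le_top
    -- Off the self-adjoint part, which is closed, the restricted seminorm is constantly ∞ on a
    -- neighbourhood.
    · have hopen : IsOpen {b : A | ¬ IsSelfAdjoint b} :=
        (isClosed_eq continuous_star continuous_id).isOpen_compl
      filter_upwards [hopen.mem_nhds ha] with b hb
      rw [saRestrict, if_neg ha] at hc
      rw [saRestrict, if_neg hb]
      exact hc
  locStar_dense := by
    intro a ha
    have hsa := isSelfAdjoint_of_saRestrict_lt_top ha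
    obtain ⟨s, hs, hlim, -⟩ := h.exists_approximation hsa
      (by rwa [Set.mem_ofPred_eq, saRestrict_of_isSelfAdjoint hsa] at ha)
    exact mem_closure_of_tendsto hlim (Eventually.of_forall hs)
  locStar_inter_dense := by
    intro m hm hsa
    refine closure_minimal ?_ isClosed_closure (h.isStandard m hm hsa)
    rintro b ⟨hb, hLb⟩
    have hsb := isSelfAdjoint_of_saRestrict_lt_top hLb
    obtain ⟨s, hs, hlim, -, hsM⟩ := h.exists_approximation hsb
      (by rwa [saRestrict_of_isSelfAdjoint hsb] at hLb)
    exact mem_closure_of_tendsto hlim (Eventually.of_forall fun n => ⟨hs n, hsM hb n⟩)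
  properSpectrum := h.hasProperSpectrum

end IsStronglyProper

end StronglyProper

/-! ### Jordan-Lie subspaces and *-isomorphisms -/

section JordanLie

/-- Real subspaces of the self-adjoint part which are closed under the Jordan and Lie products. -/
structure IsJordanLie {P : Type*} [NonUnitalCStarAlgebra P] (R : Set P) : Prop where
  isSelfAdjoint : ∀ a ∈ R, IsSelfAdjoint a
  zero_mem : (0 : P) ∈ R
  add_mem : ∀ a ∈ R, ∀ b ∈ R, a + b ∈ R
  smul_mem : ∀ (t : ℝ), ∀ a ∈ R, (t : ℂ) • a ∈ R
  jordan_mem : ∀ a ∈ R, ∀ b ∈ R, (1 / 2 : ℂ) • (a * b + b * a) ∈ R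
  lie_mem : ∀ a ∈ R, ∀ b ∈ R, (1 / (2 * Complex.I) : ℂ) • (a * b - b * a) ∈ R

namespace IsJordanLie

variable {P : Type*} [NonUnitalCStarAlgebra P] {R : Set P} (hR : IsJordanLie R)
include hR

theorem exists_eq_add_of_mem_span {x : P} (hx : x ∈ Submodule.span ℂ R) :
    ∃ a ∈ R, ∃ b ∈ R, x = a + Complex.I • b := by
  induction hx using Submodule.span_induction with
  | mem x hx => exact ⟨x, hx, 0, hR.zero_mem, by simp⟩
  | zero => exact ⟨0, hR.zero_mem, 0, hR.zero_mem, by simp⟩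
  | add x y _ _ hx hy =>
    obtain ⟨a, ha, b, hb, rfl⟩ := hx
    obtain ⟨c, hc, d, hd, rfl⟩ := hy
    exact ⟨a + c, hR.add_mem _ ha _ hc, b + d, hR.add_mem _ hb _ hd, by rw [smul_add]; abel⟩
  | smul z x _ hx =>
    obtain ⟨a, ha, b, hb, rfl⟩ := hx
    refine ⟨(z.re : ℂ) • a + ((-z.im : ℝ) : ℂ) • b,
      hR.add_mem _ (hR.smul_mem _ _ ha) _ (hR.smul_mem _ _ hb),
      (z.im : ℂ) • a + (z.re : ℂ) • b, hR.add_mem _ (hR.smul_mem _ _ ha) _ (hR.smul_mem _ _ hb), ?_⟩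
    have hI : Complex.I * Complex.I = -1 := Complex.I_mul_I
    conv_lhs => rw [← Complex.re_add_im z]
    match_scalars
    · ring
    · linear_combination (z.im : ℂ) * hI

/-- The complex span is R + iR, and the component in iR of a self-adjoint element vanishes. -/
theorem mem_of_mem_span {x : P} (hx : x ∈ Submodule.span ℂ R) (hsa : IsSelfAdjoint x) : x ∈ R := by
  obtain ⟨a, ha, b, hb, rfl⟩ := hR.exists_eq_add_of_mem_span hx
  have h1 := hsa.star_eq
  rw [star_add, star_smul, (hR.isSelfAdjoint a ha).star_eq, (hR.isSelfAdjoint b hb).star_eq,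
    add_right_inj, Complex.star_def, Complex.conj_I, neg_smul, neg_eq_iff_add_eq_zero, ← two_smul ℂ,
    smul_smul, smul_eq_zero] at h1
  rcases h1 with h1 | h1
  · simp at h1
  · rw [h1, smul_zero, add_zero]
    exact ha

/-- The *-algebra generated by a Jordan-Lie subspace is its complex span. -/
noncomputable def starSubalgebra : NonUnitalStarSubalgebra ℂ P :=
  { Submodule.span ℂ R with
    mul_mem' := by
      intro x y hx hy
      change x * y ∈ Submodule.span ℂ R
      induction hx using Submodule.span_induction with
      | zero => rw [zero_mul]; exact Submodule.zero_mem _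
      | add x x' _ _ hx hx' => rw [add_mul]; exact Submodule.add_mem _ hx hx'
      | smul c x _ hx => rw [smul_mul_assoc]; exact Submodule.smul_mem _ _ hx
      | mem x hx =>
        induction hy using Submodule.span_induction with
        | zero => rw [mul_zero]; exact Submodule.zero_mem _
        | add y y' _ _ hy hy' => rw [mul_add]; exact Submodule.add_mem _ hy hy'
        | smul c y _ hy => rw [mul_smul_comm]; exact Submodule.smul_mem _ _ hy
        | mem y hy =>
          -- The product is the Jordan product plus i times the Lie product.
          have h : x * y = (1 / 2 : ℂ) • (x * y + y * x) +
              Complex.I • ((1 / (2 * Complex.I) : ℂ) • (x * y - y * x)) := by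
            have hI : Complex.I ≠ 0 := Complex.I_ne_zero
            match_scalars
            · field_simp; norm_num
            · field_simp; norm_num
          rw [h]
          exact Submodule.add_mem _ (Submodule.subset_span (hR.jordan_mem x hx y hy))
            (Submodule.smul_mem _ _ (Submodule.subset_span (hR.lie_mem x hx y hy)))
    star_mem' := by
      intro x hx
      change star x ∈ Submodule.span ℂ R
      induction hx using Submodule.span_induction with
      | zero => rw [star_zero]; exact Submodule.zero_mem _
      | add x x' _ _ hx hx' => rw [star_add]; exact Submodule.add_mem _ hx hx'
      | smul c x _ hx => rw [star_smul]; exact Submodule.smul_mem _ _ hx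
      | mem x hx => rw [(hR.isSelfAdjoint x hx).star_eq]; exact Submodule.subset_span hx }

end IsJordanLie

variable {A B : Type*} [NonUnitalCStarAlgebra A] [NonUnitalCStarAlgebra B] {R : Set (A × B)}

/-- For q in the span, q*q is self-adjoint and so belongs to `R`. The C*-identity then carries
equality of norms from `R` to the span, and continuity to its closure. -/
theorem IsJordanLie.norm_eq_of_mem (hR : IsJordanLie R) (hn : ∀ p ∈ R, ‖p.1‖ = ‖p.2‖) {p : A × B}
    (hp : p ∈ hR.starSubalgebra.topologicalClosure) : ‖p.1‖ = ‖p.2‖ := by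
  refine closure_minimal (s := (hR.starSubalgebra : Set (A × B))) (t := {p | ‖p.1‖ = ‖p.2‖})
    (fun q hq => ?_) (isClosed_eq continuous_fst.norm continuous_snd.norm) hp
  have h1 : star q * q ∈ hR.starSubalgebra := mul_mem (star_mem hq) hq
  have h2 := hn _ (hR.mem_of_mem_span h1 (IsSelfAdjoint.star_mul_self q))
  rw [Prod.fst_mul, Prod.snd_mul, Prod.fst_star, Prod.snd_star, CStarRing.norm_star_mul_self,
    CStarRing.norm_star_mul_self] at h2
  exact (mul_self_inj (norm_nonneg _) (norm_nonneg _)).1 h2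

theorem mem_of_selfAdjoint_dense {S : Submodule ℂ A} (h : ∀ a, IsSelfAdjoint a → a ∈ S) (a : A) :
    a ∈ S := by
  rw [← realPart_add_I_smul_imaginaryPart a]
  exact S.add_mem (h _ (realPart a).2) (S.smul_mem _ (h _ (imaginaryPart a).2))

/-- The range of an isometry on a complete space is closed, and here it contains all self-adjoint
elements. -/
theorem bijective_of_dense {G : NonUnitalStarSubalgebra ℂ (A × B)} (hG : IsClosed (G : Set (A × B)))
    {C : Type*} [NonUnitalCStarAlgebra C] (f : G →⋆ₙₐ[ℂ] C) (hf : ∀ p : G, ‖f p‖ = ‖p‖)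
    (hd : ∀ a, IsSelfAdjoint a → a ∈ closure (Set.range f)) : Function.Bijective f := by
  have hiso : Isometry f := AddMonoidHomClass.isometry_of_norm f hf
  have hcomp : CompleteSpace G := hG.completeSpace_coe
  have hcl : IsClosed (Set.range f) := hiso.isClosedEmbedding.isClosed_range
  refine ⟨hiso.injective, fun c => ?_⟩
  exact mem_of_selfAdjoint_dense (S := LinearMap.range (f : G →ₗ[ℂ] C))
    (fun a ha => by
      have := hd a ha
      rwa [hcl.closure_eq] at this) c

/-- A norm preserving correspondence between dense Jordan-Lie subspaces of the self-adjoint parts of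
two C*-algebras extends to a *-isomorphism. -/
theorem IsJordanLie.exists_starAlgEquiv (hR : IsJordanLie R) (hn : ∀ p ∈ R, ‖p.1‖ = ‖p.2‖)
    (h1 : ∀ a, IsSelfAdjoint a → a ∈ closure (Prod.fst '' R))
    (h2 : ∀ b, IsSelfAdjoint b → b ∈ closure (Prod.snd '' R)) :
    ∃ e : A ≃⋆ₐ[ℂ] B, ∀ p ∈ R, e p.1 = p.2 := by
  set G := hR.starSubalgebra.topologicalClosure
  have hG : IsClosed (G : Set (A × B)) := hR.starSubalgebra.isClosed_topologicalClosure
  have hRG : R ⊆ G := fun p hp =>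
    hR.starSubalgebra.le_topologicalClosure (Submodule.subset_span (R := ℂ) hp)
  have hnorm (p : G) : ‖(p : A × B).1‖ = ‖(p : A × B).2‖ := hR.norm_eq_of_mem hn p.2
  -- Both coordinate projections of the closed algebra `G` are isometric with dense range, so `G` is
  -- the graph of a *-isomorphism.
  let f : G →⋆ₙₐ[ℂ] A := (NonUnitalStarAlgHom.fst ℂ A B).comp (NonUnitalStarSubalgebraClass.subtype G)
  let g : G →⋆ₙₐ[ℂ] B := (NonUnitalStarAlgHom.snd ℂ A B).comp (NonUnitalStarSubalgebraClass.subtype G)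
  have hf : Function.Bijective f := by
    refine bijective_of_dense hG f (fun p => ?_) fun a ha => closure_mono ?_ (h1 a ha)
    · change ‖(p : A × B).1‖ = max ‖(p : A × B).1‖ ‖(p : A × B).2‖
      rw [← hnorm p, max_self]
    · rintro _ ⟨p, hp, rfl⟩
      exact ⟨⟨p, hRG hp⟩, rfl⟩
  have hg : Function.Bijective g := by
    refine bijective_of_dense hG g (fun p => ?_) fun a ha => closure_mono ?_ (h2 a ha)
    · change ‖(p : A × B).2‖ = max ‖(p : A × B).1‖ ‖(p : A × B).2‖
      rw [hnorm p, max_self]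
    · rintro _ ⟨p, hp, rfl⟩
      exact ⟨⟨p, hRG hp⟩, rfl⟩
  let e₁ : G ≃⋆ₐ[ℂ] A := StarAlgEquiv.ofBijective f hf
  let e₂ : G ≃⋆ₐ[ℂ] B := StarAlgEquiv.ofBijective g hg
  refine ⟨e₁.symm.trans e₂, fun p hp => ?_⟩
  have h3 : e₁ ⟨p, hRG hp⟩ = p.1 := rfl
  rw [← h3, StarAlgEquiv.trans_apply, StarAlgEquiv.symm_apply_apply]
  rfl

end JordanLie

/-! ### Elements supported on a compact subset of the spectrum -/

section Loc

variable {A : Type*} [NonUnitalCStarAlgebra A] {L : A → ℝ≥0∞} {M : NonUnitalStarSubalgebra ℂ A}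
  {K : Set (Spec M)}

namespace IsQLCMS

variable (hQ : IsQLCMS L M) (hK : IsCompact K)
include hQ hK

theorem zero_mem_Loc : (0 : A) ∈ Loc L M K := by
  refine (hQ.topography.mem_Loc hK).2 ⟨.zero _, by simp, ?_⟩
  have := hQ.lipschitzPair.smul 0 0
  simp only [abs_zero, ENNReal.ofReal_zero, zero_mul, smul_zero] at this
  rw [this]
  exact ENNReal.zero_lt_top

theorem add_mem_Loc {a b : A} (ha : a ∈ Loc L M K) (hb : b ∈ Loc L M K) : a + b ∈ Loc L M K := by
  rw [hQ.topography.mem_Loc hK] at *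
  refine ⟨ha.1.add hb.1, fun f hf => ?_, ?_⟩
  · rw [mul_add, add_mul, (ha.2.1 f hf).1, (ha.2.1 f hf).2, (hb.2.1 f hf).1, (hb.2.1 f hf).2]
    exact ⟨rfl, rfl⟩
  · exact (hQ.lipschitzPair.add_le a b).trans_lt (ENNReal.add_lt_top.2 ⟨ha.2.2, hb.2.2⟩)

theorem smul_mem_Loc (t : ℝ) {a : A} (ha : a ∈ Loc L M K) : (t : ℂ) • a ∈ Loc L M K := by
  rw [hQ.topography.mem_Loc hK] at *
  refine ⟨?_, fun f hf => ?_, ?_⟩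
  · rw [isSelfAdjoint_iff, star_smul, ha.1.star_eq, Complex.star_def, Complex.conj_ofReal]
  · rw [mul_smul_comm, smul_mul_assoc, (ha.2.1 f hf).1, (ha.2.1 f hf).2]
    exact ⟨rfl, rfl⟩
  · rw [hQ.lipschitzPair.smul]
    exact ENNReal.mul_lt_top ENNReal.ofReal_lt_top ha.2.2

/-- The parameters z and w treat both products at once: w = 1 for the Jordan product, w = -1 for the
Lie product. -/
theorem smul_mul_add_mul_mem_Loc {a b : A} (ha : a ∈ Loc L M K) (hb : b ∈ Loc L M K) {z w : ℂ}
    (hL : L (z • (a * b + w • (b * a))) < ∞) : z • (a * b + w • (b * a)) ∈ Loc L M K := by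
  refine (hQ.topography.mem_Loc hK).2 ⟨hQ.lipschitzPair.isSelfAdjoint hL, fun f hf => ?_, hL⟩
  rw [hQ.topography.mem_Loc hK] at ha hb
  rw [mul_smul_comm, smul_mul_assoc, mul_add, add_mul, mul_smul_comm, smul_mul_assoc, ← mul_assoc,
    ← mul_assoc, mul_assoc a, mul_assoc b, (ha.2.1 f hf).1, (ha.2.1 f hf).2, (hb.2.1 f hf).1,
    (hb.2.1 f hf).2]
  exact ⟨rfl, rfl⟩

/-- Bounded sets of elements supported on a compact set, with bounded Lipschitz seminorms, are
relatively compact. -/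
theorem exists_tendsto_of_Loc (hlsc : LowerSemicontinuous L) {ι : Type*} (U : Ultrafilter ι)
    {b : ι → A} {l C : ℝ} (hl : 0 ≤ l)
    (hb : ∀ᶠ i in U, b i ∈ Loc L M K ∧ L (b i) ≤ ENNReal.ofReal l ∧ ‖b i‖ ≤ C) :
    ∃ c ∈ Loc L M K, L c ≤ ENNReal.ofReal l ∧ Tendsto b U (𝓝 c) := by
  have hM := hQ.topography
  have hcauchy : Cauchy (map b U) := by
    refine Metric.cauchy_iff.2 ⟨inferInstance, fun ε hε => ?_⟩
    -- Chosen so that the final bound 2δ + 2lδ equals ε/2.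
    set δ := ε / (4 * (1 + l)) with hδ
    have hδ0 : 0 < δ := by positivity
    obtain ⟨t, htf, ht⟩ := (hQ.metrizes_statesOn hK).exists_finite_net (hM.isCompact_statesOn hK)
      (ENNReal.ofReal_pos.2 hδ0)
    -- Bounded scalars converge along an ultrafilter, so no subsequence is extracted.
    have hconv (ψ : WeakDual ℂ A) : ∃ c : ℂ, Tendsto (fun i => ψ (b i)) U (𝓝 c) := by
      have hbd : ∀ᶠ i in U, ψ (b i) ∈
          Metric.closedBall (0 : ℂ) (‖WeakDual.toStrongDual ψ‖ * C) := by
        filter_upwards [hb] with i hi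
        rw [mem_closedBall_zero_iff]
        exact (WeakDual.toStrongDual ψ).le_opNorm_of_le hi.2.2
      obtain ⟨c, -, hc⟩ := (isCompact_closedBall (0 : ℂ) _).ultrafilter_le_nhds
        (U.map fun i => ψ (b i)) (le_principal_iff.2 hbd)
      exact ⟨c, hc⟩
    choose c hc using hconv
    have hev : ∀ᶠ i in U, ∀ ψ ∈ t, ‖(ψ : WeakDual ℂ A) (b i) - c ψ‖ < δ := by
      refine (eventually_all_finite htf).2 fun ψ _ => ?_
      have := (tendsto_iff_norm_sub_tendsto_zero.1 (hc ψ)).eventually_lt_const hδ0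
      exact this
    refine ⟨_, image_mem_map (hb.and hev), ?_⟩
    rintro _ ⟨i, ⟨⟨hi, hiL, -⟩, hiψ⟩, rfl⟩ _ ⟨j, ⟨⟨hj, hjL, -⟩, hjψ⟩, rfl⟩
    have hneg : b i - b j = b i + ((-1 : ℝ) : ℂ) • b j := by
      rw [Complex.ofReal_neg, Complex.ofReal_one, neg_one_smul, sub_eq_add_neg]
    have hd : b i - b j ∈ Loc L M K := by
      rw [hneg]; exact hQ.add_mem_Loc hK hi (hQ.smul_mem_Loc hK _ hj)
    have hdL : L (b i - b j) ≤ ENNReal.ofReal (2 * l) := by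
      rw [hneg, two_mul, ENNReal.ofReal_add hl hl]
      refine (hQ.lipschitzPair.add_le _ _).trans (add_le_add hiL ?_)
      rw [hQ.lipschitzPair.smul]
      simpa using hjL
    rw [hM.mem_Loc hK] at hd
    -- The norm of b i - b j is attained on states supported on K. These are within δ of the finite
    -- net t, where the values are already within 2δ, and L(b i - b j) ≤ 2l controls the change.
    have hle : ‖b i - b j‖ ≤ 2 * δ + δ * (2 * l) := by
      refine hM.norm_le_of_forall_statesOn hK hd.1 hd.2.1 (by positivity) fun φ hφ => ?_
      obtain ⟨ψ, hψ, hφψ⟩ := ht φ hφ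
      have h1 := hQ.lipschitzPair.norm_sub_le hδ0.le (by positivity) hφψ.le hdL
      have h2 : ‖(ψ : WeakDual ℂ A) (b i - b j)‖ ≤ 2 * δ := by
        rw [map_sub, ← sub_sub_sub_cancel_right _ _ (c ψ)]
        refine (_root_.norm_sub_le _ _).trans ?_
        linarith [hiψ ψ hψ, hjψ ψ hψ]
      calc ‖φ (b i - b j)‖ = ‖(ψ : WeakDual ℂ A) (b i - b j) +
            (φ (b i - b j) - (ψ : WeakDual ℂ A) (b i - b j))‖ := by rw [add_sub_cancel]
        _ ≤ _ := (norm_add_le _ _).trans (add_le_add h2 h1)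
    rw [dist_eq_norm]
    refine hle.trans_lt ?_
    have : 2 * δ + δ * (2 * l) = ε / 2 := by
      rw [hδ]; field_simp; ring
    linarith
  obtain ⟨c, hc⟩ := cauchy_map_iff_exists_tendsto.1 hcauchy
  have hLc : L c ≤ ENNReal.ofReal l := by
    by_contra! hlt
    obtain ⟨i, hi1, hi2⟩ := ((hc.eventually (hlsc c _ hlt)).and hb).exists
    exact hi1.not_ge hi2.2.1
  refine ⟨c, (hM.mem_Loc hK).2 ⟨?_, fun f hf => ⟨?_, ?_⟩, hLc.trans_lt ENNReal.ofReal_lt_top⟩, hLc, hc⟩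
  · refine tendsto_nhds_unique ((continuous_star.tendsto c).comp hc) (hc.congr' ?_)
    filter_upwards [hb] with i hi using hi.1.1.star_eq.symm
  · refine tendsto_nhds_unique (hc.const_mul (f : A)) (hc.congr' ?_)
    filter_upwards [hb] with i hi using (((hM.mem_Loc hK).1 hi.1).2.1 f hf).1.symm
  · refine tendsto_nhds_unique (hc.mul_const (f : A)) (hc.congr' ?_)
    filter_upwards [hb] with i hi using (((hM.mem_Loc hK).1 hi.1).2.1 f hf).2.symm

end IsQLCMS

/-- A state supported near a character `μ` is close to `μ` on the Lipschitz elements of the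
topography. -/
theorem IsQLCMS.norm_statesOn_sub_le (hQ : IsQLCMS L M) (μ : Spec M) {s l : ℝ} (hs : 0 ≤ s)
    (hl : 0 ≤ l) (hK : IsCompact K)
    (hKμ : ∀ x ∈ K, sigmaKantorovich L M x μ ≤ ENNReal.ofReal s) {ψ : WeakDual ℂ A}
    (hψ : ψ ∈ statesOn M K) {b : M} (hb : L b ≤ ENNReal.ofReal l) : ‖ψ (b : A) - μ b‖ ≤ s * l := by
  have hM := hQ.topography
  have hsa : IsSelfAdjoint b :=
    Subtype.ext (hQ.lipschitzPair.isSelfAdjoint (hb.trans_lt ENNReal.ofReal_lt_top)).star_eq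
  refine le_of_forall_pos_le_add fun η hη => ?_
  set c := (μ b).re with hc
  have hμ : (c : ℂ) = μ b := hM.re_apply μ hsa
  -- The cut-off g is 1 where |t - c| ≤ sl and 0 where |t - c| ≥ sl + η. On K the values of b lie in
  -- the first region, so f₀ g(b) still dominates K, while g(b)(b - c) has size at most sl + η.
  let g : ℝ → ℝ := fun t => max 0 (min 1 (1 - (|t - c| - s * l) / η))
  have hg : Continuous g := by fun_prop
  have hg0 (t : ℝ) : 0 ≤ g t := le_max_left _ _
  have hg1 (t : ℝ) : g t ≤ 1 := max_le zero_le_one (min_le_left _ _)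
  have hgc (t : ℝ) (ht : |t - c| ≤ s * l) : g t = 1 := by
    have : 1 ≤ 1 - (|t - c| - s * l) / η := by
      have := div_nonpos_of_nonpos_of_nonneg (sub_nonpos.2 ht) hη.le
      linarith
    simp only [g, min_eq_left this, max_eq_right zero_le_one]
  have hgs (t : ℝ) : g t * |t - c| ≤ s * l + η := by
    by_cases ht : |t - c| ≤ s * l + η
    · exact (mul_le_of_le_one_left (abs_nonneg _) (hg1 t)).trans ht
    · have : 1 - (|t - c| - s * l) / η ≤ 0 := by
        rw [sub_nonpos, le_div_iff₀ hη]; linarith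
      have h0 : g t = 0 := max_eq_left ((min_le_right _ _).trans this)
      rw [h0, zero_mul]
      positivity
  obtain ⟨m, -, hm⟩ := hM.exists_apply_eq hsa (g := fun t => g t - g 0) (by fun_prop) (sub_self _)
  obtain ⟨f₀, hf₀⟩ := hM.dominating_nonempty hK
  -- This is f₀ g(b). Functional calculus without a unit requires a function vanishing at 0, so the
  -- constant g(0) is split off and multiplied by f₀.
  set f : M := (g 0 : ℂ) • f₀ + f₀ * m with hf
  have hfx (x : Spec M) : x f = x f₀ * (g (x b).re : ℂ) := by
    rw [hf, map_add, map_smul, map_mul, hm, smul_eq_mul]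
    push_cast; ring
  have hfd : f ∈ dominating M K := by
    refine ⟨fun x => ?_, fun x hx => ?_⟩
    · rw [hfx]
      have h1 : (0 : ℂ) ≤ (g (x b).re : ℂ) := by exact_mod_cast hg0 _
      have h2 : (g (x b).re : ℂ) ≤ 1 := by exact_mod_cast hg1 _
      exact ⟨mul_nonneg (hf₀.1 x).1 h1, mul_le_one₀ (hf₀.1 x).2 h1 h2⟩
    · have h1 := hQ.lipschitzPair.norm_spec_sub_le hs hl (hKμ x hx) hb
      have h2 : |(x b).re - c| ≤ s * l := by
        rw [hc, ← Complex.sub_re]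
        exact (Complex.abs_re_le_norm _).trans h1
      rw [hfx, hf₀.2 x hx, hgc _ h2, Complex.ofReal_one, one_mul]
  have hnorm : ‖((f * b - (c : ℂ) • f : M) : A)‖ ≤ s * l + η := by
    refine hM.norm_le (by positivity) fun x => ?_
    have e : x (f * b - (c : ℂ) • f) =
        x f₀ * (((g (x b).re * ((x b).re - c) : ℝ)) : ℂ) := by
      rw [map_sub, map_mul, map_smul, hfx, smul_eq_mul]
      conv_lhs => rw [← hM.re_apply x hsa, Complex.ofReal_re]
      push_cast; ring
    rw [e, norm_mul, Complex.norm_real, norm_mul, Real.norm_of_nonneg (hg0 _), Real.norm_eq_abs]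
    exact (mul_le_of_le_one_left (mul_nonneg (hg0 _) (abs_nonneg _))
      (norm_le_one_of_mem_Icc (hf₀.1 x))).trans (hgs _)
  have hψ' := (hM.mem_statesOn hK).1 hψ
  have e : ψ ((f * b - (c : ℂ) • f : M) : A) = ψ (b : A) - μ b := by
    change ψ ((f : A) * b - (c : ℂ) • (f : A)) = _
    rw [map_sub, map_smul, hM.statesOn_mul_left hK hψ hfd, hψ'.2 f hfd, smul_eq_mul, mul_one, hμ]
  rw [← e]
  have := (WeakDual.toStrongDual ψ).le_of_opNorm_le hψ'.1 ((f * b - (c : ℂ) • f : M) : A)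
  rw [one_mul] at this
  exact this.trans hnorm

end Loc

/-! ### Balls of a pointed proper quantum metric space -/

namespace PPQMS

variable (A : PPQMS.{u})

/-- Properness gives compactness for the metric, and weak* compactness has to be deduced. If an
ultrafilter converges to y in the metric, its weak* limit in the unit ball agrees with y on the
Lipschitz elements of the topography, which are dense, and so equals y. -/
theorem isCompact_ball (r : ℝ) : IsCompact (A.ball r) := by
  have hQ := A.isProper.isQLCMS
  obtain ⟨m, hm, hproper⟩ := A.isProper.properSpectrum
  have hball : A.ball r = @Metric.closedBall _ m.toPseudoMetricSpace A.base (max r 0) := by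
    ext x
    have h2 : m.edist x A.base = ENNReal.ofReal (m.dist x A.base) := m.edist_dist x A.base
    change sigmaKantorovich A.L A.M x A.base ≤ ENNReal.ofReal r ↔ m.dist x A.base ≤ max r 0
    have h3 : ENNReal.ofReal r = ENNReal.ofReal (max r 0) := by simp [ENNReal.ofReal, Real.toNNReal]
    rw [← hm, h2, h3, ENNReal.ofReal_le_ofReal_iff (le_max_right _ _)]
  have hcomp := @isCompact_closedBall _ m.toPseudoMetricSpace hproper A.base (max r 0)
  rw [← hball] at hcomp
  refine isCompact_iff_ultrafilter_le_nhds'.2 fun U hU => ?_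
  obtain ⟨y, hy, hUy⟩ := (@isCompact_iff_ultrafilter_le_nhds' _ m.toUniformSpace.toTopologicalSpace
    _).1 hcomp U hU
  refine ⟨y, hy, ?_⟩
  have h0 : Tendsto (fun x => m.edist x y) U (𝓝 0) :=
    (@tendsto_iff_edist_tendsto_0 (Spec A.M) _ m.toPseudoMetricSpace.toPseudoEMetricSpace
      (U : Filter (Spec A.M)) id y).1 hUy
  have hlim : Tendsto (fun x : Spec A.M => sigmaKantorovich A.L A.M x y) U (𝓝 0) :=
    h0.congr fun x => hm x y
  obtain ⟨φ, -, hφ⟩ := (WeakDual.isCompact_closedBall (0 : StrongDual ℂ A.M) 1).ultrafilter_le_nhds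
    (U.map Subtype.val) (le_principal_iff.2 (Ultrafilter.mem_map.2 (univ_mem' fun x : Spec A.M =>
      mem_closedBall_zero_iff.2 (ContinuousLinearMap.opNorm_le_bound _ zero_le_one fun n => by
        simpa using! hQ.topography.norm_apply_le x n))))
  have hφ' : Tendsto (Subtype.val : Spec A.M → WeakDual ℂ A.M) U (𝓝 φ) := hφ
  have hφy : WeakDual.toStrongDual φ = WeakDual.CharacterSpace.toCLM y := by
    refine spec_eq_of_dense A.isProper.locStar_inter_dense fun n hn => ?_
    obtain ⟨K, hK⟩ := Set.mem_iUnion.1 hn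
    have h1 : Tendsto (fun x : Spec A.M => x n) U (𝓝 (φ n)) :=
      ((WeakDual.eval_continuous n).tendsto φ).comp hφ'
    refine tendsto_nhds_unique h1 ?_
    rw [tendsto_iff_norm_sub_tendsto_zero]
    have h2 := (ENNReal.tendsto_toReal ENNReal.zero_ne_top).comp hlim
    have h3 := h2.mul_const (A.L n).toReal
    rw [ENNReal.toReal_zero, zero_mul] at h3
    refine squeeze_zero' (Eventually.of_forall fun _ => norm_nonneg _) ?_ h3
    filter_upwards [hlim.eventually_lt_const ENNReal.zero_lt_top] with x hx
    exact hQ.lipschitzPair.norm_spec_sub_le ENNReal.toReal_nonneg ENNReal.toReal_nonneg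
      (ENNReal.ofReal_toReal hx.ne).ge (ENNReal.ofReal_toReal hK.2.2.ne).ge
  have hφy' : φ = y := hφy
  rw [hφy'] at hφ'
  exact tendsto_subtype_rng.2 hφ'

theorem base_mem_ball (r : ℝ) : A.base ∈ A.ball r := by
  change sigmaKantorovich A.L A.M A.base A.base ≤ _
  rw [sigmaKantorovich_self]
  exact zero_le

/-- A weak* compact set is compact, hence bounded, for the Monge-Kantorovich metric, so it lies in a
ball about the base point. -/
theorem exists_mem_loc {a : A.carrier} (ha : a ∈ A.locStar) : ∃ r > 0, a ∈ A.loc r := by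
  have hQ := A.isProper.isQLCMS
  obtain ⟨m, hm, -⟩ := A.isProper.properSpectrum
  obtain ⟨K, hK⟩ := Set.mem_iUnion.1 ha
  have hKm := hQ.isCompact_sigma K.isCompact m hm
  obtain ⟨r, hr⟩ := (@Metric.isBounded_iff_subset_closedBall (Spec A.M)
    (K : Set (Spec A.M)) m.toPseudoMetricSpace A.base).1
    (@IsCompact.isBounded (Spec A.M) m.toPseudoMetricSpace (K : Set (Spec A.M)) hKm)
  refine ⟨max r 1, lt_max_of_lt_right zero_lt_one,
    hQ.topography.Loc_mono K.isCompact (A.isCompact_ball _) (fun x hx => ?_) hK⟩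
  have h1 : m.dist x A.base ≤ r := hr hx
  have h2 : m.edist x A.base = ENNReal.ofReal (m.dist x A.base) := m.edist_dist x A.base
  change sigmaKantorovich A.L A.M x A.base ≤ ENNReal.ofReal _
  rw [← hm, h2]
  exact ENNReal.ofReal_le_ofReal (h1.trans (le_max_left _ _))

theorem loc_subset_locStar (r : ℝ) : A.loc r ⊆ A.locStar := fun _ ha =>
  Set.mem_iUnion.2 ⟨⟨A.ball r, A.isCompact_ball r⟩, ha⟩

theorem ball_mono {r r' : ℝ} (h : r ≤ r') : A.ball r ⊆ A.ball r' := fun _ hx =>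
  le_trans (b := ENNReal.ofReal r) hx (ENNReal.ofReal_le_ofReal h)

theorem loc_mono {r r' : ℝ} (h : r ≤ r') : A.loc r ⊆ A.loc r' :=
  A.isProper.isQLCMS.topography.Loc_mono (A.isCompact_ball r) (A.isCompact_ball r') (A.ball_mono h)

theorem mem_closure_locStar {a : A.carrier} (ha : IsSelfAdjoint a) : a ∈ closure A.locStar :=
  closure_minimal A.isProper.locStar_dense isClosed_closure
    (A.isProper.isQLCMS.lipschitzPair.dense a ha)

end PPQMS

/-! ### Bridges -/

/-- A bridge from `A` to `B`: a tunnel together with an admissible number `ε` and compact sets `K t`,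
for `0 < t ≤ R`. -/
structure Bridge (A B : PPQMS.{u}) : Type (u + 1) where
  D : Type u
  [cstar : NonUnitalCStarAlgebra D]
  L : D → ℝ≥0∞
  M : NonUnitalStarSubalgebra ℂ D
  π : D →⋆ₙₐ[ℂ] A.carrier
  ρ : D →⋆ₙₐ[ℂ] B.carrier
  isQLCMS : IsQLCMS L M
  ε : ℝ
  R : ℝ
  K : ℝ → Set (Spec M)
  ε_pos : 0 < ε
  isCompact : ∀ t, 0 < t → t ≤ R → IsCompact (K t)
  mono : ∀ t t', 0 < t → t ≤ t' → t' ≤ R → K t ⊆ K t'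
  leibniz : ∀ t, 0 < t → t ≤ R → LeibnizOn L (Loc L M (K t))
  states_left : ∀ t, 0 < t → t ≤ R → ∀ φ ∈ A.states t, pullback π φ ∈ statesOn M (K t)
  states_right : ∀ t, 0 < t → t ≤ R → ∀ φ ∈ B.states t, pullback ρ φ ∈ statesOn M (K t)
  near_left : ∀ t, 0 < t → t ≤ R → ∀ φ ∈ statesOn M (K t), ∃ ψ ∈ A.states (t + 4 * ε),
    mongeKantorovich L φ (pullback π ψ) ≤ ENNReal.ofReal ε
  near_right : ∀ t, 0 < t → t ≤ R → ∀ φ ∈ statesOn M (K t), ∃ ψ ∈ B.states (t + 4 * ε),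
    mongeKantorovich L φ (pullback ρ ψ) ≤ ENNReal.ofReal ε
  lift_left : ∀ t, 0 < t → t ≤ R → ∀ a ∈ A.loc t, ∃ d ∈ Loc L M (K t), π d = a ∧
    ρ d ∈ B.loc (t + 4 * ε) ∧ L d ≤ A.L a ∧ B.L (ρ d) ≤ L d ∧ (a ∈ A.M → ρ d ∈ B.M)
  lift_right : ∀ t, 0 < t → t ≤ R → ∀ b ∈ B.loc t, ∃ d ∈ Loc L M (K t), ρ d = b ∧
    π d ∈ A.loc (t + 4 * ε) ∧ L d ≤ B.L b ∧ A.L (π d) ≤ L d ∧ (b ∈ B.M → π d ∈ A.M)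

attribute [instance] Bridge.cstar

/-- The two nonemptiness conditions on target sets are merged: for a in the topography the lift is
chosen with its image in the topography of the codomain. -/
theorem Passage.IsLeftAdmissible.exists_lift {τ : Passage.{u}} {t ε : ℝ} {K : Set (Spec τ.M)}
    (h : τ.IsLeftAdmissible t ε K) {a : τ.dom.carrier} (ha : a ∈ τ.dom.loc t) :
    ∃ d ∈ Loc τ.L τ.M K, τ.π d = a ∧ τ.ρ d ∈ τ.cod.loc (t + 4 * ε) ∧ τ.L d ≤ τ.dom.L a ∧
      τ.cod.L (τ.ρ d) ≤ τ.L d ∧ (a ∈ τ.dom.M → τ.ρ d ∈ τ.cod.M) := by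
  by_cases haM : a ∈ τ.dom.M
  · obtain ⟨_, ⟨d, ⟨h1, h2, h3, h4⟩, rfl⟩, h5⟩ := h.target_inter_nonempty a ha haM
    exact ⟨d, h1, h2, h3, h4, h.map_le d h1, fun _ => h5⟩
  · obtain ⟨_, d, ⟨h1, h2, h3, h4⟩, rfl⟩ := h.target_nonempty a ha
    exact ⟨d, h1, h2, h3, h4, h.map_le d h1, fun h => absurd h haM⟩

theorem Passage.IsLeftAdmissible.exists_near {τ : Passage.{u}} {t ε : ℝ} {K : Set (Spec τ.M)}
    (h : τ.IsLeftAdmissible t ε K) {φ : WeakDual ℂ τ.D} (hφ : φ ∈ statesOn τ.M K) :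
    ∃ ψ ∈ τ.dom.states (t + 4 * ε), mongeKantorovich τ.L φ (pullback τ.π ψ) ≤ ENNReal.ofReal ε := by
  obtain ⟨_, ⟨ψ, hψ, rfl⟩, h1⟩ := h.subset_states φ hφ
  exact ⟨ψ, hψ, h1⟩

/-- The bridge of a tunnel and one of its admissible numbers. -/
theorem Passage.exists_bridge {τ : Passage.{u}} {r ε : ℝ} (hε : ε ∈ τ.Adm r) :
    ∃ b : Bridge τ.dom τ.cod, b.ε = ε ∧ b.R = r := by
  obtain ⟨h0, K, hmono, hK⟩ := hε
  exact ⟨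
    { D := τ.D
      L := τ.L
      M := τ.M
      π := τ.π
      ρ := τ.ρ
      isQLCMS := τ.isQLCMS
      ε := ε
      R := r
      K := K
      ε_pos := h0
      isCompact := fun t h1 h2 => (hK t h1 h2).left.isCompact
      mono := hmono
      leibniz := fun t h1 h2 => (hK t h1 h2).leibniz
      states_left := fun t h1 h2 φ hφ => (hK t h1 h2).left.states_subset ⟨φ, hφ, rfl⟩
      states_right := fun t h1 h2 φ hφ => (hK t h1 h2).right.states_subset ⟨φ, hφ, rfl⟩
      near_left := fun t h1 h2 φ hφ => (hK t h1 h2).left.exists_near hφ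
      near_right := fun t h1 h2 φ hφ => (hK t h1 h2).right.exists_near hφ
      lift_left := fun t h1 h2 a ha => (hK t h1 h2).left.exists_lift ha
      lift_right := fun t h1 h2 b hb => (hK t h1 h2).right.exists_lift hb }, rfl, rfl⟩

/-- As √2/4 > 0, the infimum itself is zero. It provides ε < δ and a (1/ε)-tunnel with an admissible
number below ε, and 1/ε > 1/δ. -/
theorem exists_bridge_of_propinquity_eq_zero {T : Set Passage.{u}} {A B : PPQMS.{u}}
    (h : propinquity T A B = 0) {δ : ℝ} (hδ : 0 < δ) :
    ∃ b : Bridge A B, b.ε < δ ∧ 1 / δ < b.R := by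
  have h1 : (⨅ ε : ℝ, ⨅ _ : 0 < ε ∧ localPropinquity T (1 / ε) A B < ENNReal.ofReal ε,
      ENNReal.ofReal ε) = 0 := by
    rcases min_eq_iff.1 h with h | h
    · exact h.1
    · have := h.1
      rw [ENNReal.ofReal_eq_zero] at this
      have h2 : (0 : ℝ) < √2 / 4 := by positivity
      linarith
  obtain ⟨ε, hε⟩ := iInf_lt_iff.1 (h1.trans_lt (ENNReal.ofReal_pos.2 hδ))
  obtain ⟨⟨hε0, hεT⟩, hεδ⟩ := iInf_lt_iff.1 hε
  rw [ENNReal.ofReal_lt_ofReal_iff hδ] at hεδ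
  obtain ⟨τ, hτ⟩ := iInf_lt_iff.1 hεT
  obtain ⟨⟨-, rfl, rfl, -⟩, hτε⟩ := iInf_lt_iff.1 hτ
  obtain ⟨ε', hε'⟩ := iInf_lt_iff.1 hτε
  obtain ⟨hadm, hlt⟩ := iInf_lt_iff.1 hε'
  rw [ENNReal.ofReal_lt_ofReal_iff hε0] at hlt
  obtain ⟨b, rfl, hb⟩ := Passage.exists_bridge hadm
  exact ⟨b, hlt.trans hεδ, by rw [hb]; exact one_div_lt_one_div_of_lt hε0 hεδ⟩

namespace Bridge

variable {A B : PPQMS.{u}}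

/-- The inverse bridge. -/
def symm (b : Bridge A B) : Bridge B A where
  D := b.D
  L := b.L
  M := b.M
  π := b.ρ
  ρ := b.π
  isQLCMS := b.isQLCMS
  ε := b.ε
  R := b.R
  K := b.K
  ε_pos := b.ε_pos
  isCompact := b.isCompact
  mono := b.mono
  leibniz := b.leibniz
  states_left := b.states_right
  states_right := b.states_left
  near_left := b.near_right
  near_right := b.near_left
  lift_left := b.lift_right
  lift_right := b.lift_left

variable (b : Bridge A B) {t l : ℝ}

/-- The norm of d is attained on states supported on K_t, and each of them is within ε of a state
factoring through π, where the value is at most ‖π(d)‖. Applied on both sides, this makes π(d) and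
ρ(d) almost equal in norm. -/
theorem norm_le_left (ht : 0 < t) (htR : t ≤ b.R) (hl : 0 ≤ l) {d : b.D}
    (hd : d ∈ Loc b.L b.M (b.K t)) (hdl : b.L d ≤ ENNReal.ofReal l) :
    ‖d‖ ≤ ‖b.π d‖ + b.ε * l := by
  have hK := b.isCompact t ht htR
  have hM := b.isQLCMS.topography
  have hd' := (hM.mem_Loc hK).1 hd
  have hε := b.ε_pos
  refine hM.norm_le_of_forall_statesOn hK hd'.1 hd'.2.1 (by positivity) fun φ hφ => ?_
  obtain ⟨ψ, hψ, hφψ⟩ := b.near_left t ht htR φ hφ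
  have h1 := b.isQLCMS.lipschitzPair.norm_sub_le hε.le hl hφψ hdl
  have h2 : ‖pullback b.π ψ d‖ ≤ ‖b.π d‖ := by
    have := (WeakDual.toStrongDual ψ).le_of_opNorm_le hψ.1.2.le (b.π d)
    rwa [one_mul] at this
  calc ‖φ d‖ = ‖pullback b.π ψ d + (φ d - pullback b.π ψ d)‖ := by rw [add_sub_cancel]
    _ ≤ _ := (norm_add_le _ _).trans (add_le_add h2 h1)

theorem norm_le_right (ht : 0 < t) (htR : t ≤ b.R) (hl : 0 ≤ l) {d : b.D}
    (hd : d ∈ Loc b.L b.M (b.K t)) (hdl : b.L d ≤ ENNReal.ofReal l) :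
    ‖d‖ ≤ ‖b.ρ d‖ + b.ε * l :=
  b.symm.norm_le_left ht htR hl hd hdl

theorem abs_norm_sub_norm_le (ht : 0 < t) (htR : t ≤ b.R) (hl : 0 ≤ l) {d : b.D}
    (hd : d ∈ Loc b.L b.M (b.K t)) (hdl : b.L d ≤ ENNReal.ofReal l) :
    |‖b.π d‖ - ‖b.ρ d‖| ≤ b.ε * l := by
  have h1 := b.norm_le_left ht htR hl hd hdl
  have h2 := b.norm_le_right ht htR hl hd hdl
  have h3 := NonUnitalStarAlgHom.norm_apply_le b.π d
  have h4 := NonUnitalStarAlgHom.norm_apply_le b.ρ d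
  rw [abs_le]
  constructor <;> linarith

theorem Loc_mono {t' : ℝ} (ht : 0 < t) (htt' : t ≤ t') (htR : t' ≤ b.R) :
    Loc b.L b.M (b.K t) ⊆ Loc b.L b.M (b.K t') :=
  b.isQLCMS.topography.Loc_mono (b.isCompact t ht (htt'.trans htR))
    (b.isCompact t' (ht.trans_le htt') htR) (b.mono t t' ht htt' htR)

end Bridge

/-! ### The correspondence defined by a sequence of bridges -/

section Linked

variable {A B : PPQMS.{u}} (F : ℕ → Bridge A B) (U : Ultrafilter ℕ)

/-- `d n` is a sequence of elements of the bridges, of Lipschitz seminorm at most `l` and supported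
on the compact sets of radius `r`, whose images converge to `a` and `b`. -/
structure IsLink (r l : ℝ) (d : ∀ n, (F n).D) (a : A.carrier) (b : B.carrier) : Prop where
  r_pos : 0 < r
  l_nonneg : 0 ≤ l
  mem_Loc : ∀ᶠ n in U, d n ∈ Loc (F n).L (F n).M ((F n).K r)
  le : ∀ᶠ n in U, (F n).L (d n) ≤ ENNReal.ofReal l
  left : Tendsto (fun n => (F n).π (d n)) U (𝓝 a)
  right : Tendsto (fun n => (F n).ρ (d n)) U (𝓝 b)

/-- The correspondence between `A` and `B` defined by a sequence of bridges. -/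
def Linked (a : A.carrier) (b : B.carrier) : Prop :=
  ∃ (r l : ℝ) (d : ∀ n, (F n).D), IsLink F U r l d a b

variable {F U}

theorem Linked.symm {a : A.carrier} {b : B.carrier} (h : Linked F U a b) :
    Linked (fun n => (F n).symm) U b a := by
  obtain ⟨r, l, d, h⟩ := h
  exact ⟨r, l, d, h.r_pos, h.l_nonneg, h.mem_Loc, h.le, h.right, h.left⟩

variable (hε : Tendsto (fun n => (F n).ε) U (𝓝 0)) (hR : Tendsto (fun n => (F n).R) U atTop)

section
include hR

theorem IsLink.mono {r l r' l' : ℝ} {d : ∀ n, (F n).D} {a : A.carrier} {b : B.carrier}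
    (h : IsLink F U r l d a b) (hr : r ≤ r') (hl : l ≤ l') : IsLink F U r' l' d a b where
  r_pos := h.r_pos.trans_le hr
  l_nonneg := h.l_nonneg.trans hl
  mem_Loc := by
    filter_upwards [h.mem_Loc, hR.eventually_ge_atTop r'] with n hn hn'
    exact (F n).Loc_mono h.r_pos hr hn' hn
  le := h.le.mono fun n hn => hn.trans (ENNReal.ofReal_le_ofReal hl)
  left := h.left
  right := h.right

theorem Linked.exists_common {a a' : A.carrier} {b b' : B.carrier} (h : Linked F U a b)
    (h' : Linked F U a' b') :
    ∃ (r l : ℝ) (d d' : ∀ n, (F n).D), IsLink F U r l d a b ∧ IsLink F U r l d' a' b' := by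
  obtain ⟨r, l, d, h⟩ := h
  obtain ⟨r', l', d', h'⟩ := h'
  exact ⟨max r r', max l l', d, d', h.mono hR (le_max_left _ _) (le_max_left _ _),
    h'.mono hR (le_max_right _ _) (le_max_right _ _)⟩

theorem Linked.add {a a' : A.carrier} {b b' : B.carrier} (h : Linked F U a b)
    (h' : Linked F U a' b') : Linked F U (a + a') (b + b') := by
  obtain ⟨r, l, d, d', h, h'⟩ := h.exists_common hR h'
  refine ⟨r, l + l, fun n => d n + d' n, h.r_pos, add_nonneg h.l_nonneg h.l_nonneg, ?_, ?_, ?_, ?_⟩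
  · filter_upwards [h.mem_Loc, h'.mem_Loc, hR.eventually_ge_atTop r] with n h1 h2 h3
    exact (F n).isQLCMS.add_mem_Loc ((F n).isCompact r h.r_pos h3) h1 h2
  · filter_upwards [h.le, h'.le] with n h1 h2
    rw [ENNReal.ofReal_add h.l_nonneg h.l_nonneg]
    exact ((F n).isQLCMS.lipschitzPair.add_le _ _).trans (add_le_add h1 h2)
  · simpa only [map_add] using h.left.add h'.left
  · simpa only [map_add] using h.right.add h'.right

theorem Linked.smul (t : ℝ) {a : A.carrier} {b : B.carrier} (h : Linked F U a b) :
    Linked F U ((t : ℂ) • a) ((t : ℂ) • b) := by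
  obtain ⟨r, l, d, h⟩ := h
  refine ⟨r, |t| * l, fun n => (t : ℂ) • d n, h.r_pos, mul_nonneg (abs_nonneg _) h.l_nonneg,
    ?_, ?_, ?_, ?_⟩
  · filter_upwards [h.mem_Loc, hR.eventually_ge_atTop r] with n h1 h3
    exact (F n).isQLCMS.smul_mem_Loc ((F n).isCompact r h.r_pos h3) t h1
  · filter_upwards [h.le] with n h1
    rw [(F n).isQLCMS.lipschitzPair.smul, ENNReal.ofReal_mul (abs_nonneg _)]
    gcongr
  · simpa only [map_smul] using h.left.const_smul (t : ℂ)
  · simpa only [map_smul] using h.right.const_smul (t : ℂ)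

theorem Linked.zero : Linked F U 0 0 := by
  refine ⟨1, 0, fun n => 0, one_pos, le_rfl, ?_, ?_, ?_, ?_⟩
  · filter_upwards [hR.eventually_ge_atTop 1] with n h3
    exact (F n).isQLCMS.zero_mem_Loc ((F n).isCompact 1 one_pos h3)
  · refine Eventually.of_forall fun n => ?_
    have := (F n).isQLCMS.lipschitzPair.smul 0 0
    simp only [abs_zero, ENNReal.ofReal_zero, zero_mul, smul_zero] at this
    rw [this]
    exact zero_le
  · simpa only [map_zero] using tendsto_const_nhds
  · simpa only [map_zero] using tendsto_const_nhds

end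

theorem Linked.isSelfAdjoint_left {a : A.carrier} {b : B.carrier} (h : Linked F U a b) :
    IsSelfAdjoint a := by
  obtain ⟨r, l, d, h⟩ := h
  refine tendsto_nhds_unique ((continuous_star.tendsto a).comp h.left) (h.left.congr' ?_)
  filter_upwards [h.mem_Loc] with n h1
  exact (h1.1.map (F n).π).star_eq.symm

theorem Linked.isSelfAdjoint_right {a : A.carrier} {b : B.carrier} (h : Linked F U a b) :
    IsSelfAdjoint b := by
  obtain ⟨r, l, d, h⟩ := h
  refine tendsto_nhds_unique ((continuous_star.tendsto b).comp h.right) (h.right.congr' ?_)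
  filter_upwards [h.mem_Loc] with n h1
  exact (h1.1.map (F n).ρ).star_eq.symm

include hε hR

theorem Linked.norm_eq {a : A.carrier} {b : B.carrier} (h : Linked F U a b) : ‖a‖ = ‖b‖ := by
  obtain ⟨r, l, d, h⟩ := h
  have h1 := (h.left.norm.sub h.right.norm).abs
  have h2 : Tendsto (fun n => (F n).ε * l) U (𝓝 0) := by simpa using hε.mul_const l
  have h3 : |‖a‖ - ‖b‖| ≤ 0 := by
    refine le_of_tendsto_of_tendsto h1 h2 ?_
    filter_upwards [h.mem_Loc, h.le, hR.eventually_ge_atTop r] with n h4 h5 h6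
    exact (F n).abs_norm_sub_norm_le h.r_pos h6 h.l_nonneg h4 h5
  exact sub_eq_zero.1 (abs_nonpos_iff.1 h3)

theorem IsLink.eventually_norm_le {r l : ℝ} {d : ∀ n, (F n).D} {a : A.carrier} {b : B.carrier}
    (h : IsLink F U r l d a b) : ∀ᶠ n in U, ‖d n‖ ≤ ‖a‖ + 1 := by
  have h2 : Tendsto (fun n => ‖(F n).π (d n)‖ + (F n).ε * l) U (𝓝 ‖a‖) := by
    simpa using h.left.norm.add (hε.mul_const l)
  filter_upwards [h.mem_Loc, h.le, hR.eventually_ge_atTop r,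
    h2.eventually_lt_const (lt_add_one ‖a‖)] with n h4 h5 h6 h7
  exact ((F n).norm_le_left h.r_pos h6 h.l_nonneg h4 h5).trans h7.le

/-- Norms of the d n are bounded by `eventually_norm_le`, so the Leibniz bound keeps the seminorms
of the products bounded. The pair z, w again covers the Jordan and Lie products. -/
theorem Linked.product {a a' : A.carrier} {b b' : B.carrier} (h : Linked F U a b)
    (h' : Linked F U a' b') {z w : ℂ}
    (hz : ∀ (n : ℕ) (r : ℝ), 0 < r → r ≤ (F n).R → ∀ d ∈ Loc (F n).L (F n).M ((F n).K r),
      ∀ d' ∈ Loc (F n).L (F n).M ((F n).K r),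
      (F n).L (z • (d * d' + w • (d' * d))) ≤ ‖d‖ₑ * (F n).L d' + (F n).L d * ‖d'‖ₑ) :
    Linked F U (z • (a * a' + w • (a' * a))) (z • (b * b' + w • (b' * b))) := by
  obtain ⟨r, l, d, d', h, h'⟩ := h.exists_common hR h'
  have hl := h.l_nonneg
  have hle : ∀ᶠ n in U, (F n).L (z • (d n * d' n + w • (d' n * d n))) ≤
      ENNReal.ofReal ((‖a‖ + 1) * l + l * (‖a'‖ + 1)) := by
    filter_upwards [h.mem_Loc, h'.mem_Loc, h.le, h'.le, h.eventually_norm_le hε hR,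
      h'.eventually_norm_le hε hR, hR.eventually_ge_atTop r] with n h1 h2 h3 h4 h5 h6 h7
    refine (hz n r h.r_pos h7 _ h1 _ h2).trans ?_
    rw [ENNReal.ofReal_add (by positivity) (by positivity), ENNReal.ofReal_mul (by positivity),
      ENNReal.ofReal_mul hl, ← ofReal_norm, ← ofReal_norm]
    gcongr
  refine ⟨r, (‖a‖ + 1) * l + l * (‖a'‖ + 1), fun n => z • (d n * d' n + w • (d' n * d n)), h.r_pos,
    by positivity, ?_, hle, ?_, ?_⟩
  · filter_upwards [h.mem_Loc, h'.mem_Loc, hle, hR.eventually_ge_atTop r] with n h1 h2 h3 h7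
    exact (F n).isQLCMS.smul_mul_add_mul_mem_Loc ((F n).isCompact r h.r_pos h7) h1 h2
      (h3.trans_lt ENNReal.ofReal_lt_top)
  · simpa only [map_smul, map_add, map_mul] using
      ((h.left.mul h'.left).add ((h'.left.mul h.left).const_smul w)).const_smul z
  · simpa only [map_smul, map_add, map_mul] using
      ((h.right.mul h'.right).add ((h'.right.mul h.right).const_smul w)).const_smul z

theorem isJordanLie_linked :
    IsJordanLie {p : A.carrier × B.carrier | Linked F U p.1 p.2} where
  isSelfAdjoint := fun p hp => Prod.ext (Linked.isSelfAdjoint_left hp).star_eq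
    (Linked.isSelfAdjoint_right hp).star_eq
  zero_mem := Linked.zero hR
  add_mem := fun p hp q hq => Linked.add hR hp hq
  smul_mem := fun t p hp => Linked.smul hR t hp
  jordan_mem := fun p hp q hq => by
    have := Linked.product hε hR hp hq (z := 1 / 2) (w := 1) fun n r hr hrR d hd d' hd' => by
      rw [one_smul]
      exact ((F n).leibniz r hr hrR d hd d' hd').1
    simp only [one_smul] at this
    exact this
  lie_mem := fun p hp q hq => by
    have := Linked.product hε hR hp hq (z := 1 / (2 * Complex.I)) (w := -1)
      fun n r hr hrR d hd d' hd' => by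
        rw [neg_one_smul, ← sub_eq_add_neg]
        exact ((F n).leibniz r hr hrR d hd d' hd').2
    simp only [neg_one_smul, ← sub_eq_add_neg] at this
    exact this

/-- The element a is lifted to d n with seminorm at most L(a). The images ρ(d n) have bounded norm,
seminorm and support, hence converge along the ultrafilter, and the limit inherits the seminorm
bound by lower semicontinuity. -/
theorem exists_linked {a : A.carrier} (ha : a ∈ A.locStar) :
    ∃ b ∈ B.locStar, Linked F U a b ∧ B.L b ≤ A.L a ∧ (a ∈ A.M → b ∈ B.M) ∧
      ∀ (ha : a ∈ A.M) (hb : b ∈ B.M), B.base ⟨b, hb⟩ = A.base ⟨a, ha⟩ := by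
  obtain ⟨r, hr, har⟩ := A.exists_mem_loc ha
  have hLa : A.L a < ∞ := har.2.2
  set l := (A.L a).toReal with hl
  have hl0 : 0 ≤ l := ENNReal.toReal_nonneg
  have hLl : ENNReal.ofReal l = A.L a := ENNReal.ofReal_toReal hLa.ne
  have hlift : ∀ n, ∃ d : (F n).D, r ≤ (F n).R → d ∈ Loc (F n).L (F n).M ((F n).K r) ∧
      (F n).π d = a ∧ (F n).ρ d ∈ B.loc (r + 4 * (F n).ε) ∧ (F n).L d ≤ A.L a ∧
      B.L ((F n).ρ d) ≤ (F n).L d ∧ (a ∈ A.M → (F n).ρ d ∈ B.M) := by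
    intro n
    by_cases hn : r ≤ (F n).R
    · obtain ⟨d, h1, h2⟩ := (F n).lift_left r hr hn a har
      exact ⟨d, fun _ => ⟨h1, h2⟩⟩
    · exact ⟨0, fun h => absurd h hn⟩
  choose d hd using hlift
  have hRr := hR.eventually_ge_atTop r
  have hε1 := hε.eventually_lt_const (one_pos (α := ℝ))
  -- Eventually ε < 1, so the supports of radius r + 4ε all lie in the ball of radius r + 4.
  obtain ⟨b, hbloc, hbL, hb⟩ := B.isProper.isQLCMS.exists_tendsto_of_Loc (B.isCompact_ball (r + 4))
    B.isProper.lowerSemicontinuous U (b := fun n => (F n).ρ (d n)) (C := ‖a‖ + 1 * l) hl0 (by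
      filter_upwards [hRr, hε1] with n h1 h2
      obtain ⟨h3, h4, h5, h6, h7, -⟩ := hd n h1
      refine ⟨B.loc_mono (by linarith) h5, ?_, ?_⟩
      · rw [hLl]; exact h7.trans h6
      · refine (NonUnitalStarAlgHom.norm_apply_le (F n).ρ (d n)).trans ?_
        have := (F n).norm_le_left hr h1 hl0 h3 (by rw [hLl]; exact h6)
        rw [h4] at this
        refine this.trans ?_
        gcongr)
  have hlink : IsLink F U r l d a b :=
    { r_pos := hr
      l_nonneg := hl0
      mem_Loc := hRr.mono fun n hn => (hd n hn).1
      le := hRr.mono fun n hn => by rw [hLl]; exact (hd n hn).2.2.2.1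
      left := tendsto_const_nhds.congr' (hRr.mono fun n hn => (hd n hn).2.1.symm)
      right := hb }
  refine ⟨b, B.loc_subset_locStar _ hbloc, ⟨r, l, d, hlink⟩, hLl ▸ hbL, fun haM => ?_,
    fun haM hbM => ?_⟩
  · exact B.isProper.isQLCMS.topography.isClosed.mem_of_tendsto hb
      (hRr.mono fun n hn => (hd n hn).2.2.2.2.2 haM)
  · classical
    let c : ℕ → B.M := fun n => if h : (F n).ρ (d n) ∈ B.M then ⟨_, h⟩ else 0
    have hc : ∀ᶠ n in U, (c n : B.carrier) = (F n).ρ (d n) := by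
      filter_upwards [hRr] with n hn
      simp [c, (hd n hn).2.2.2.2.2 haM]
    have hclim : Tendsto c U (𝓝 ⟨b, hbM⟩) :=
      tendsto_subtype_rng.2 (hb.congr' (hc.mono fun n hn => hn.symm))
    have h1 : Tendsto (fun n => B.base (c n)) U (𝓝 (B.base ⟨b, hbM⟩)) :=
      ((map_continuous B.base).tendsto _).comp hclim
    refine tendsto_nhds_unique h1 (tendsto_iff_norm_sub_tendsto_zero.2 ?_)
    have h2 : Tendsto (fun n => 6 * ((F n).ε * l)) U (𝓝 0) := by
      simpa using (hε.mul_const l).const_mul 6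
    refine squeeze_zero' (Eventually.of_forall fun _ => norm_nonneg _) ?_ h2
    filter_upwards [hRr, hc, hε1, hR.eventually_ge_atTop 1] with n h3 h4 h5 h6
    have hε0 := (F n).ε_pos
    obtain ⟨-, e2, -, e4, e5, -⟩ := hd n h3
    -- Base points are compared by admissibility at the small radius ε. A state extending the base
    -- point of `A` is carried through the bridge to a state ψ of `B` supported in the ball of
    -- radius 5ε. The passage costs εl and replacing ψ by the base point of `B` costs 5εl, in all
    -- 6εl.
    obtain ⟨φ, hφ, hφA⟩ := A.isProper.isQLCMS.topography.exists_mem_statesOn_apply_eq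
      (A.isCompact_ball (F n).ε) (A.base_mem_ball _)
    obtain ⟨ψ, hψ, hφψ⟩ := (F n).near_right _ hε0 (h5.le.trans h6) _
      ((F n).states_left _ hε0 (h5.le.trans h6) φ hφ)
    have h7 := (F n).isQLCMS.lipschitzPair.norm_sub_le hε0.le hl0 hφψ (by rw [hLl]; exact e4)
    have h8 : pullback (F n).π φ (d n) = A.base ⟨a, haM⟩ := by
      change φ ((F n).π (d n)) = _
      rw [e2]
      exact hφA ⟨a, haM⟩
    have h9 : pullback (F n).ρ ψ (d n) = ψ (c n : B.carrier) := by
      rw [h4]; rfl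
    rw [h8, h9] at h7
    have h10 := B.isProper.isQLCMS.norm_statesOn_sub_le B.base (s := (F n).ε + 4 * (F n).ε)
      (by positivity) hl0 (B.isCompact_ball _) (fun x hx => hx) hψ (b := c n)
      (by rw [h4, hLl]; exact e5.trans e4)
    rw [norm_sub_rev]
    calc ‖A.base ⟨a, haM⟩ - B.base (c n)‖
        = ‖(A.base ⟨a, haM⟩ - ψ (c n : B.carrier)) + (ψ (c n : B.carrier) - B.base (c n))‖ := by
          rw [sub_add_sub_cancel]
      _ ≤ (F n).ε * l + ((F n).ε + 4 * (F n).ε) * l := (norm_add_le _ _).trans (add_le_add h7 h10)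
      _ = 6 * ((F n).ε * l) := by ring

end Linked

/-! ### Isometric isomorphisms from the correspondence -/

section Isomorphism

variable {A B : PPQMS.{u}}

/-- A *-isomorphism which does not increase the seminorms of the locally supported elements, and
is compatible with the topographies and base points on these elements. -/
structure IsContractiveMatch (e : A.carrier ≃⋆ₐ[ℂ] B.carrier) : Prop where
  map_locStar : ∀ a ∈ A.locStar, e a ∈ B.locStar
  le : ∀ a ∈ A.locStar, B.L (e a) ≤ A.L a
  map_mem : ∀ a ∈ A.locStar, a ∈ A.M → e a ∈ B.M
  base : ∀ a ∈ A.locStar, ∀ (ha : a ∈ A.M) (hb : e a ∈ B.M), B.base ⟨e a, hb⟩ = A.base ⟨a, ha⟩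

variable {e : A.carrier ≃⋆ₐ[ℂ] B.carrier}

theorem continuous_starAlgEquiv (e : A.carrier ≃⋆ₐ[ℂ] B.carrier) : Continuous e :=
  (StarAlgEquiv.isometry e).continuous

namespace IsContractiveMatch

variable (h : IsContractiveMatch e)
include h

theorem map_topography {a : A.carrier} (ha : a ∈ A.M) : e a ∈ B.M :=
  mem_of_dense A.isProper.locStar_inter_dense
    (T := { carrier := {m : A.M | e m ∈ B.M}
            add_mem' := fun {m n} hm hn => by
              change e ((m : A.carrier) + n) ∈ B.M
              rw [map_add]; exact add_mem hm hn
            zero_mem' := by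
              change e (0 : A.carrier) ∈ B.M
              rw [map_zero]; exact zero_mem _
            smul_mem' := fun c m hm => by
              change e (c • (m : A.carrier)) ∈ B.M
              rw [map_smul]; exact SMulMemClass.smul_mem c hm })
    (B.isProper.isQLCMS.topography.isClosed.preimage
      ((continuous_starAlgEquiv e).comp continuous_subtype_val))
    (fun m hm => h.map_mem m hm m.2) ⟨a, ha⟩

theorem map_base {a : A.carrier} (ha : a ∈ A.M) (hb : e a ∈ B.M) :
    B.base ⟨e a, hb⟩ = A.base ⟨a, ha⟩ := by
  let f : A.M →L[ℂ] B.M :=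
    { toFun := fun m => ⟨e m, h.map_topography m.2⟩
      map_add' := fun m n => Subtype.ext (map_add e (m : A.carrier) n)
      map_smul' := fun c m => Subtype.ext (map_smul e c (m : A.carrier))
      cont := ((continuous_starAlgEquiv e).comp continuous_subtype_val).subtype_mk _ }
  have := spec_eq_of_dense A.isProper.locStar_inter_dense
    (x := (WeakDual.CharacterSpace.toCLM B.base).comp f)
    (y := WeakDual.CharacterSpace.toCLM A.base) fun m hm => h.base m hm m.2 (h.map_topography m.2)
  exact DFunLike.congr_fun this ⟨a, ha⟩

/-- The isometric isomorphism given by two mutually inverse contractive matches. -/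
def isometricIso (h' : IsContractiveMatch e.symm) : IsometricIso A B where
  equiv := e
  topographic := A.isProper.isQLCMS.topography.isTopographicMorphism e fun _ ha =>
    h.map_topography ha
  image_locStar := by
    refine Set.Subset.antisymm (Set.image_subset_iff.2 h.map_locStar) fun b hb =>
      ⟨e.symm b, h'.map_locStar b hb, e.apply_symm_apply b⟩
  image_topography := by
    refine Set.Subset.antisymm (Set.image_subset_iff.2 fun a ha => h.map_topography ha) fun b hb =>
      ⟨e.symm b, h'.map_topography hb, e.apply_symm_apply b⟩
  map_L := fun a ha => by
    refine le_antisymm (h.le a ha) ?_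
    have := h'.le (e a) (h.map_locStar a ha)
    rwa [e.symm_apply_apply] at this
  map_base := fun a ha hb => h.map_base ha hb

/-- For compactly supported s n → a with L_A(s n) → L_A(a), lower semicontinuity gives L_B(e a) ≤
liminf L_B(e(s n)) ≤ lim L_A(s n) = L_A(a). -/
theorem le_of_isStronglyProper (hA : A.IsStronglyProper) {a : A.carrier} (ha : IsSelfAdjoint a) :
    B.L (e a) ≤ A.L a := by
  obtain ⟨L', hL', hAL⟩ := hA
  by_cases htop : A.L a = ∞
  · rw [htop]; exact le_top
  have hLa : L' a = A.L a := by rw [hAL, saRestrict_of_isSelfAdjoint ha]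
  obtain ⟨s, hs, hlim, hL, -⟩ := hL'.exists_approximation ha (by
    rw [hLa]; exact lt_top_iff_ne_top.2 htop)
  rw [hLa] at hL
  have hs' : ∀ n, s n ∈ A.locStar := fun n => by
    rw [PPQMS.locStar, hAL]; exact hs n
  by_contra! hlt
  obtain ⟨c, hc1, hc2⟩ := exists_between hlt
  have h1 := ((continuous_starAlgEquiv e).tendsto a).comp hlim
  obtain ⟨n, hn1, hn2⟩ := ((h1.eventually (B.isProper.lowerSemicontinuous (e a) c hc2)).and
    (hL.eventually_lt_const hc1)).exists
  have h3 : A.L (s n) = L' (s n) := by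
    rw [hAL, saRestrict_of_isSelfAdjoint]
    exact A.isProper.isQLCMS.lipschitzPair.isSelfAdjoint
      (by obtain ⟨K, hK⟩ := Set.mem_iUnion.1 (hs' n); exact hK.2.2)
  have h2 := h.le (s n) (hs' n)
  rw [h3] at h2
  exact (hn1.trans_le h2).not_gt hn2

end IsContractiveMatch

theorem isContractiveMatch_of_linked {F : ℕ → Bridge A B} {U : Ultrafilter ℕ}
    (hε : Tendsto (fun n => (F n).ε) U (𝓝 0)) (hR : Tendsto (fun n => (F n).R) U atTop)
    (he : ∀ a b, Linked F U a b → e a = b) : IsContractiveMatch e := by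
  have key : ∀ a ∈ A.locStar, e a ∈ B.locStar ∧ B.L (e a) ≤ A.L a ∧ (a ∈ A.M → e a ∈ B.M) ∧
      ∀ (ha : a ∈ A.M) (hb : e a ∈ B.M), B.base ⟨e a, hb⟩ = A.base ⟨a, ha⟩ := by
    intro a ha
    obtain ⟨b, h1, h2, h3⟩ := exists_linked hε hR ha
    obtain rfl := he a b h2
    exact ⟨h1, h3⟩
  exact ⟨fun a ha => (key a ha).1, fun a ha => (key a ha).2.1, fun a ha => (key a ha).2.2.1,
    fun a ha => (key a ha).2.2.2⟩

/-- One ultrafilter serves all elements and both directions. The correspondence of the inverse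
bridges is the transpose of the original one, so the arguments for `e` apply to `e.symm`. -/
theorem exists_isContractiveMatch {F : ℕ → Bridge A B}
    (hε : Tendsto (fun n => (F n).ε) atTop (𝓝 0)) (hR : Tendsto (fun n => (F n).R) atTop atTop) :
    ∃ e : A.carrier ≃⋆ₐ[ℂ] B.carrier, IsContractiveMatch e ∧ IsContractiveMatch e.symm := by
  let U : Ultrafilter ℕ := Ultrafilter.of atTop
  replace hε := hε.mono_left (Ultrafilter.of_le atTop)
  replace hR := hR.mono_left (Ultrafilter.of_le atTop)
  obtain ⟨e, he⟩ := (isJordanLie_linked (U := U) hε hR).exists_starAlgEquiv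
    (fun p hp => Linked.norm_eq hε hR hp)
    (fun a ha => closure_mono (fun a ha => by
      obtain ⟨b, -, hb, -⟩ := exists_linked (U := U) hε hR ha
      exact ⟨(a, b), hb, rfl⟩) (A.mem_closure_locStar ha))
    (fun b hb => closure_mono (fun b hb => by
      obtain ⟨a, -, ha, -⟩ := exists_linked (F := fun n => (F n).symm) (U := U) hε hR hb
      exact ⟨(a, b), ha.symm, rfl⟩) (B.mem_closure_locStar hb))
  refine ⟨e, isContractiveMatch_of_linked (U := U) hε hR fun a b hab => he (a, b) hab,
    isContractiveMatch_of_linked (F := fun n => (F n).symm) (U := U) hε hR fun b a hab => ?_⟩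
  exact (congrArg e.symm (he (a, b) hab.symm)).symm.trans (e.symm_apply_apply a)

theorem exists_isometricIso_of_propinquity_eq_zero {T : Set Passage.{u}}
    (hA : A.IsStronglyProper) (hB : B.IsStronglyProper) (h : propinquity T A B = 0) :
    ∃ π : IsometricIso A B, (∀ a : A.carrier, IsSelfAdjoint a → B.L (π.equiv a) = A.L a) ∧
      (∀ b : B.carrier, IsSelfAdjoint b → A.L (π.equiv.symm b) = B.L b) := by
  choose F hFε hFR using fun n : ℕ =>
    exists_bridge_of_propinquity_eq_zero h (δ := 1 / ((n : ℝ) + 1)) (by positivity)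
  have hε : Tendsto (fun n => (F n).ε) atTop (𝓝 0) :=
    squeeze_zero (fun n => (F n).ε_pos.le) (fun n => (hFε n).le)
      tendsto_one_div_add_atTop_nhds_zero_nat
  have hR : Tendsto (fun n => (F n).R) atTop atTop := by
    refine tendsto_atTop_mono (fun n => ?_) tendsto_natCast_atTop_atTop
    have := hFR n
    rw [one_div_one_div] at this
    linarith
  obtain ⟨e, he, he'⟩ := exists_isContractiveMatch hε hR
  have key : ∀ a : A.carrier, IsSelfAdjoint a → B.L (e a) = A.L a := fun a ha => by
    refine le_antisymm (he.le_of_isStronglyProper hA ha) ?_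
    have := he'.le_of_isStronglyProper hB (ha.map e)
    rwa [e.symm_apply_apply] at this
  refine ⟨he.isometricIso he', key, fun b hb => ?_⟩
  have := key (e.symm b) (hb.map e.symm)
  rw [e.apply_symm_apply] at this
  exact this.symm

end Isomorphism

end TopographicPropinquity

theorem mainTheorem12 :
    (∀ (A : Type u) [NonUnitalCStarAlgebra A] (L : A → ℝ≥0∞) (M : NonUnitalStarSubalgebra ℂ A),
      TopographicPropinquity.IsStronglyProper L M →
        IsProperQMS (saRestrict L) M ∧
        (Nontrivial A → Nonempty (Spec M)) ∧
        ∀ a : A, IsSelfAdjoint a → L a < ∞ →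
          ∃ s : ℕ → A, (∀ n, s n ∈ LocStar (saRestrict L) M) ∧
            Tendsto s atTop (𝓝 a) ∧ Tendsto (fun n => L (s n)) atTop (𝓝 (L a)) ∧
            (a ∈ M → ∀ n, s n ∈ M)) ∧
    (∀ (C : Set PPQMS.{u}) (T : Set Passage.{u}), IsWeaklyAppropriate C T →
      ∀ A ∈ C, ∀ B ∈ C, A.IsStronglyProper → B.IsStronglyProper → propinquity T A B = 0 →
        ∃ π : IsometricIso A B,
          (∀ a : A.carrier, IsSelfAdjoint a → B.L (π.equiv a) = A.L a) ∧
          (∀ b : B.carrier, IsSelfAdjoint b → A.L (π.equiv.symm b) = B.L b)) :=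
  ⟨fun _ _ _ _ h => ⟨h.isProperQMS, fun _ => h.nonempty_spec, fun _ => h.exists_approximation⟩,
    fun _ _ _ _ _ _ _ hA hB h => exists_isometricIso_of_propinquity_eq_zero hA hB h⟩
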